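/- **Factorization of the bifurcation resultant of the rotating double pendulum.** Let $q,d,s,\chi$ be parameters and put $a=ds$, $b=2-d$, $c=d(2-s)$. For the rotating double pendulum, where $d=1+\delta$, $s=1+\sigma$, $q=Q/(1-Q)$ and the potential is $$V(\theta,\varphi)=-\tfrac Q2\left(a\sin^2\theta+2b\sin\theta\sin\varphi+c\sin^2\varphi\right)-2(1-Q)\left[(1+\chi)\cos\theta+(1-\chi)\cos\varphi\right],$$ the bifurcation conditions $\nabla V=0$, $\det H[V]=0$ become, with $c_1,s_1,c_2,s_2$ in place of $\cos\theta,\sin\theta,\cos\varphi,\sin\varphi$, the five polynomial equations $f_1=\dots=f_5=0$ given by $$f_1=qc_1(as_1+bs_2)-2(1+\chi)s_1,\qquad f_2=qc_2(bs_1+cs_2)-2(1-\chi)s_2,$$ $$f_3=c_1^2+s_1^2-1,\qquad f_4=c_2^2+s_2^2-1,$$ $$f_5=\bigl(2(1+\chi)c_1-qa(c_1^2-s_1^2)+qbs_1s_2\bigr)\bigl(2(1-\chi)c_2-qc(c_2^2-s_2^2)+qbs_1s_2\bigr)-(qbc_1c_2)^2 .$$ *Dixon resultant.* For polynomials $f_0,\dots,f_n$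 in ordered variables $x_1,\dots,x_n$ over an integral domain, the Dixon polynomial is the determinant of the $(n+1)\times(n+1)$ matrix with entries $f_j(\bar x_1,\dots,\bar x_i,x_{i+1},\dots,x_n)$, $0\le i,j\le n$, divided by $\prod_{i=1}^n(x_i-\bar x_i)$. The Dixon matrix is its coefficient matrix, with rows indexed by the monomials in $\bar x$ and columns by the monomials in $x$. A Dixon resultant is the determinant of any nonsingular square submatrix of the Dixon matrix whose size equals the rank of the Dixon matrix. Below, the variables $c_1,s_1,c_2,s_2$ are eliminated in this order. For $\varepsilon_1,\varepsilon_2\in\{1,-1\}$ let $T_{\varepsilon_1\varepsilon_2}\in\mathbb Q[q,d,s,\chi]$ be the value of $f_5$ at the trivial equilibrium $s_1=s_2=0$, $c_1=\varepsilon_1$, $c_2=\varepsilon_2$, and let $T$ be the product of these four polynomials. The number of terms of a polynomial is the number of its monomials with nonzero coefficient. **Claim.** There are polynomials $R\in\mathbb Q[q,d,s,\chi]$ and $N\in\mathbb Q[q,d,s]$ with the following properties. 1. Dixon resultants of $(f_1,\dots,f_5)$ over $\mathbb Q[q,d,s,\chi]$ exist, and each of them is divisible by $T\cdot R$. The polynomial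 $T\cdot R$ has exactly $23288$ terms. Each $T_{\varepsilon_1\varepsilon_2}$ has $10$ terms and does not divide $R$. The product $T$ has $175$ terms. The remaining factor $R$ has exactly $6744$ terms and involves all of $q,d,s,\chi$. 2. In the special case of point masses on massless rods (PMMR), $\chi=\chi_P:=\dfrac{d(1+s)-2}{2+d(s-1)}$. The PMMR bifurcation system consists of the numerators $e f_1,\ e f_2,\ f_3,\ f_4,\ e^2 f_5$ at $\chi=\chi_P$, where $e=2+d(s-1)$. Dixon resultants of this system over $\mathbb Q[q,d,s]$ exist, and each of them is divisible by $N$, which has exactly $1924$ terms. Moreover $N$ is exactly what the substitution into $R$ produces, up to the small factors $q^2$ and $\Delta^2$ with $\Delta=d^2s(2-s)-(2-d)^2$ and the denominator: $$R(q,d,s,\chi_P)=\frac{q^2\,\Delta^2\,N}{(2+d(s-1))^{10}},$$ and $N$ is divisible by none of $q$, $\Delta$, $2+d(s-1)$. -/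

import Mathlib

open MvPolynomial

/-! ### Dixon resultants

For `n + 1` polynomials `F` in `n` variables, variables `x` are tagged `Sum.inl` and the
auxiliary variables `x̄` are tagged `Sum.inr`. -/

/-- `f(x̄₁, …, x̄ᵢ, xᵢ₊₁, …, xₙ)`: the first `i` variables of `f` are replaced by auxiliary ones. -/
noncomputable def dixonReplace {R : Type*} [CommRing R] {n : ℕ} (i : ℕ)
    (f : MvPolynomial (Fin n) R) : MvPolynomial (Fin n ⊕ Fin n) R :=
  rename (fun j : Fin n => if (j : ℕ) < i then Sum.inr j else Sum.inl j) f

/-- The cancellation matrix: row `i` holds the `n + 1` polynomials with the first `i` variables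
replaced by the auxiliary ones, `i = 0, …, n`. -/
noncomputable def dixonCancellation {R : Type*} [CommRing R] {n : ℕ}
    (F : Fin (n + 1) → MvPolynomial (Fin n) R) :
    Matrix (Fin (n + 1)) (Fin (n + 1)) (MvPolynomial (Fin n ⊕ Fin n) R) :=
  Matrix.of fun i j => dixonReplace (i : ℕ) (F j)

/-- `P` is the Dixon polynomial of `F`: the determinant of the cancellation matrix divided by
`∏ᵢ (xᵢ - x̄ᵢ)`. -/
def IsDixonPolynomial {R : Type*} [CommRing R] {n : ℕ}
    (F : Fin (n + 1) → MvPolynomial (Fin n) R) (P : MvPolynomial (Fin n ⊕ Fin n) R) : Prop :=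
  P * ∏ i : Fin n, (X (Sum.inl i) - X (Sum.inr i)) = (dixonCancellation F).det

/-- The Dixon matrix of a Dixon polynomial `P`: the entry in row `α` and column `β` is the
coefficient of `x̄ ^ α * x ^ β` in `P`. Rows and columns are indexed by all monomials, all but
finitely many of them being zero. -/
noncomputable def dixonMatrix {R : Type*} [CommRing R] {n : ℕ}
    (P : MvPolynomial (Fin n ⊕ Fin n) R) : Matrix (Fin n →₀ ℕ) (Fin n →₀ ℕ) R :=
  Matrix.of fun α β => P.coeff (Finsupp.sumElim β α)

/-- `D` is a Dixon resultant of `F` (also called a projection operator): the determinant of a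
nonsingular square submatrix of the Dixon matrix whose size is the rank of the Dixon matrix, that
is, such that all minors of the next larger size vanish. -/
def IsDixonResultant {R : Type*} [CommRing R] {n : ℕ}
    (F : Fin (n + 1) → MvPolynomial (Fin n) R) (D : R) : Prop :=
  ∃ P : MvPolynomial (Fin n ⊕ Fin n) R, IsDixonPolynomial F P ∧
    ∃ (k : ℕ) (r c : Fin k → (Fin n →₀ ℕ)),
      D = ((dixonMatrix P).submatrix r c).det ∧ D ≠ 0 ∧
      ∀ r' c' : Fin (k + 1) → (Fin n →₀ ℕ), ((dixonMatrix P).submatrix r' c').det = 0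

/-! ### The bifurcation system of the rotating double pendulum

The variables to eliminate are `X 0 = c₁`, `X 1 = s₁`, `X 2 = c₂`, `X 3 = s₂`. -/

/-- The determinant of the Hessian of `V / (1 - Q)`, with the cosines and sines of the two angles
replaced by `c₁, s₁, c₂, s₂`. -/
noncomputable def hessianPoly {K : Type*} [CommRing K] (q d s χ : K) : MvPolynomial (Fin 4) K :=
  (C (2 * (1 + χ)) * X 0 - C (q * (d * s)) * (X 0 ^ 2 - X 1 ^ 2) + C (q * (2 - d)) * X 1 * X 3) *
    (C (2 * (1 - χ)) * X 2 - C (q * (d * (2 - s))) * (X 2 ^ 2 - X 3 ^ 2)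
      + C (q * (2 - d)) * X 1 * X 3) -
  (C (q * (2 - d)) * X 0 * X 2) ^ 2

/-- The bifurcation system: the two components of `-∇V / (1 - Q)`, the two Pythagorean identities
and the Hessian determinant. -/
noncomputable def bifurcationSystem {K : Type*} [CommRing K] (q d s χ : K) :
    Fin 5 → MvPolynomial (Fin 4) K :=
  ![C q * X 0 * (C (d * s) * X 1 + C (2 - d) * X 3) - C (2 * (1 + χ)) * X 1,
    C q * X 2 * (C (2 - d) * X 1 + C (d * (2 - s)) * X 3) - C (2 * (1 - χ)) * X 3,
    X 0 ^ 2 + X 1 ^ 2 - 1,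
    X 2 ^ 2 + X 3 ^ 2 - 1,
    hessianPoly q d s χ]

/-- The Hessian determinant at the trivial equilibrium `s₁ = s₂ = 0`, `c₁ = ε₁`, `c₂ = ε₂`
(`εᵢ = 1` for down, `εᵢ = -1` for up). -/
noncomputable def trivialPoly {K : Type*} [CommRing K] (q d s χ : K) (ε₁ ε₂ : ℤ) : K :=
  eval ![(ε₁ : K), 0, (ε₂ : K), 0] (hessianPoly q d s χ)

/-- Numerators of the bifurcation system after the substitution
`χ = (d (1 + s) - 2) / (2 + d (s - 1))`; see `pmmrSystem_eq`. -/
noncomputable def pmmrSystem {K : Type*} [CommRing K] (q d s : K) :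
    Fin 5 → MvPolynomial (Fin 4) K :=
  let e : K := 2 + d * (s - 1)
  ![C (q * e) * X 0 * (C (d * s) * X 1 + C (2 - d) * X 3) - C (4 * (d * s)) * X 1,
    C (q * e) * X 2 * (C (2 - d) * X 1 + C (d * (2 - s)) * X 3) - C (4 * (2 - d)) * X 3,
    X 0 ^ 2 + X 1 ^ 2 - 1,
    X 2 ^ 2 + X 3 ^ 2 - 1,
    (C (4 * (d * s)) * X 0 - C (q * e * (d * s)) * (X 0 ^ 2 - X 1 ^ 2)
        + C (q * e * (2 - d)) * X 1 * X 3) *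
      (C (4 * (2 - d)) * X 2 - C (q * e * (d * (2 - s))) * (X 2 ^ 2 - X 3 ^ 2)
        + C (q * e * (2 - d)) * X 1 * X 3) -
    (C (q * e * (2 - d)) * X 0 * X 2) ^ 2]

theorem pmmrSystem_eq {L : Type*} [Field L] (q d s : L) (he : 2 + d * (s - 1) ≠ 0) (i : Fin 5) :
    pmmrSystem q d s i =
      C ((2 + d * (s - 1)) ^ (![1, 1, 0, 0, 2] i : ℕ)) *
        bifurcationSystem q d s ((d * (1 + s) - 2) / (2 + d * (s - 1))) i := by
  have h1 : 4 * (d * s) =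
      (2 + d * (s - 1)) * (2 * (1 + (d * (1 + s) - 2) / (2 + d * (s - 1)))) := by
    field_simp; ring
  have h2 : 4 * (2 - d) =
      (2 + d * (s - 1)) * (2 * (1 - (d * (1 + s) - 2) / (2 + d * (s - 1)))) := by
    field_simp; ring
  fin_cases i <;>
    simp only [pmmrSystem, bifurcationSystem, hessianPoly, h1, h2] <;>
    generalize (d * (1 + s) - 2) / (2 + d * (s - 1)) = χ <;>
    generalize 2 + d * (s - 1) = e <;>
    simp <;> ring

/-! ### The potential of the rotating double pendulum

The following facts tie the polynomial system to the potential, with `q = Q / (1 - Q)`,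
`d = 1 + δ` and `s = 1 + σ`. -/

/-- The effective potential of the rotating double pendulum. -/
noncomputable def pendulumPotential (Q δ σ χ θ φ : ℝ) : ℝ :=
  -(Q / 2) * ((1 + δ) * (1 + σ) * Real.sin θ ^ 2 + 2 * (1 - δ) * Real.sin θ * Real.sin φ
      + (1 + δ) * (1 - σ) * Real.sin φ ^ 2)
    - 2 * (1 - Q) * ((1 + χ) * Real.cos θ + (1 - χ) * Real.cos φ)

theorem deriv_potential_fst (Q δ σ χ θ φ : ℝ) :
    deriv (fun t => pendulumPotential Q δ σ χ t φ) θ =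
      -(Q * ((1 + δ) * (1 + σ) * Real.sin θ + (1 - δ) * Real.sin φ) * Real.cos θ
        - 2 * (1 - Q) * (1 + χ) * Real.sin θ) := by
  unfold pendulumPotential
  apply HasDerivAt.deriv
  have hs := Real.hasDerivAt_sin θ
  have hc := Real.hasDerivAt_cos θ
  refine (((((((hs.pow 2).const_mul ((1 + δ) * (1 + σ))).add
    ((hs.const_mul (2 * (1 - δ))).mul_const (Real.sin φ))).add_const
    ((1 + δ) * (1 - σ) * Real.sin φ ^ 2)).const_mul (-(Q / 2))).sub
    (((hc.const_mul (1 + χ)).add_const ((1 - χ) * Real.cos φ)).const_mul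
      (2 * (1 - Q))))).congr_deriv ?_
  simp; ring

theorem deriv_potential_snd (Q δ σ χ θ φ : ℝ) :
    deriv (fun t => pendulumPotential Q δ σ χ θ t) φ =
      -(Q * ((1 - δ) * Real.sin θ + (1 + δ) * (1 - σ) * Real.sin φ) * Real.cos φ
        - 2 * (1 - Q) * (1 - χ) * Real.sin φ) := by
  have h : (fun t => pendulumPotential Q δ σ χ θ t) =
      fun t => pendulumPotential Q δ (-σ) (-χ) t θ := by
    funext t; unfold pendulumPotential; ring
  rw [h, deriv_potential_fst]; ring

theorem bifurcationSystem_grad (Q δ σ χ θ φ : ℝ) (hQ : Q ≠ 1) :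
    deriv (fun t => pendulumPotential Q δ σ χ t φ) θ =
        -(1 - Q) * eval ![Real.cos θ, Real.sin θ, Real.cos φ, Real.sin φ]
          (bifurcationSystem (Q / (1 - Q)) (1 + δ) (1 + σ) χ 0) ∧
      deriv (fun t => pendulumPotential Q δ σ χ θ t) φ =
        -(1 - Q) * eval ![Real.cos θ, Real.sin θ, Real.cos φ, Real.sin φ]
          (bifurcationSystem (Q / (1 - Q)) (1 + δ) (1 + σ) χ 1) := by
  have hQ' : 1 - Q ≠ 0 := sub_ne_zero.mpr hQ.symm
  rw [deriv_potential_fst, deriv_potential_snd]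
  constructor <;> simp [bifurcationSystem] <;> field_simp <;> ring

theorem bifurcationSystem_hessian (Q δ σ χ θ φ : ℝ) (hQ : Q ≠ 1) :
    deriv (fun t => deriv (fun u => pendulumPotential Q δ σ χ u φ) t) θ *
        deriv (fun t => deriv (fun u => pendulumPotential Q δ σ χ θ u) t) φ -
      deriv (fun t => deriv (fun u => pendulumPotential Q δ σ χ u t) θ) φ *
        deriv (fun t => deriv (fun u => pendulumPotential Q δ σ χ t u) φ) θ =
      (1 - Q) ^ 2 * eval ![Real.cos θ, Real.sin θ, Real.cos φ, Real.sin φ]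
          (bifurcationSystem (Q / (1 - Q)) (1 + δ) (1 + σ) χ 4) := by
  have hQ' : 1 - Q ≠ 0 := sub_ne_zero.mpr hQ.symm
  simp only [deriv_potential_fst, deriv_potential_snd]
  have key : ∀ A B G x : ℝ,
      deriv (fun t => -(Q * (A * Real.sin t + B) * Real.cos t - G * Real.sin t)) x =
        G * Real.cos x - Q * A * (Real.cos x ^ 2 - Real.sin x ^ 2) + Q * B * Real.sin x := by
    intro A B G x
    apply HasDerivAt.deriv
    have hs := Real.hasDerivAt_sin x
    have hc := Real.hasDerivAt_cos x
    refine ((((((hs.const_mul A).add_const B).const_mul Q).mul hc).sub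
      (hs.const_mul G)).neg).congr_deriv ?_
    simp; ring
  have key2 : ∀ A B E G x : ℝ,
      deriv (fun t => -(Q * (A + B * Real.sin t) * E - G)) x = -(Q * B * E * Real.cos x) := by
    intro A B E G x
    apply HasDerivAt.deriv
    have hs := Real.hasDerivAt_sin x
    refine ((((((hs.const_mul B).const_add A).const_mul Q).mul_const E).sub_const G).neg).congr_deriv
      ?_
    ring
  have e1 := key ((1 + δ) * (1 + σ)) ((1 - δ) * Real.sin φ) (2 * (1 - Q) * (1 + χ)) θ
  have e2 := key ((1 + δ) * (1 - σ)) ((1 - δ) * Real.sin θ) (2 * (1 - Q) * (1 - χ)) φ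
  have e3 := key2 ((1 + δ) * (1 + σ) * Real.sin θ) (1 - δ) (Real.cos θ)
    (2 * (1 - Q) * (1 + χ) * Real.sin θ) φ
  have e4 := key2 ((1 + δ) * (1 - σ) * Real.sin φ) (1 - δ) (Real.cos φ)
    (2 * (1 - Q) * (1 - χ) * Real.sin φ) θ
  simp only [add_comm ((1 + δ) * (1 - σ) * Real.sin _)] at e2 e4
  rw [e1, e2, e3, e4]
  simp [bifurcationSystem, hessianPoly]
  field_simp
  ring

/-!
The Dixon polynomial of a system is, up to sign, the determinant of its divided differences
bordered by the polynomials themselves (`isDixonPolynomial_of_isDividedDifference`). If a minor of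
the Dixon matrix has maximal rank, then its determinant, multiplied by the value of the Dixon
polynomial at a pair of points, is a bilinear expression in the rows and columns of that minor
(`evalPair_mul_det`). This gives a principle about coalescing zeros,
`IsDixonResultant.not_isUnit`, over a local domain: if two different common zeros of all
polynomials but the last agree in the residue field, and the last polynomial vanishes at neither
of them, then no Dixon resultant is a unit. Here the last polynomial has to be, up to a unit, the
Jacobian determinant of the others. For the pendulum this holds because the Hessian determinant
is the Jacobian determinant of the equilibrium conditions (`evalPair_det_systemDifference`).

To show that a prime `p` divides every Dixon resultant, pass to a valuation ring that dominates
the localization at `p` and has an algebraically closed field of fractions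
(`Prime.exists_valuationSubring`). There the equilibria can be written down and followed to the
residue field. The nontrivial ones correspond to the roots `r = s₂ / s₁` of a sextic. If `p`
divides the Hessian determinant at a trivial equilibrium, a nontrivial equilibrium runs into it
(`IsRegularParameter.hasCoalescence_of_trivial`). A double root of the sextic in the residue field
makes two nontrivial equilibria coalesce (`IsRegularParameter.hasCoalescence_of_det`). Double roots
are described by two equations in each of which only one of the two gravity coefficients occurs,
and the Bezout determinant of two combinations of them is `bifurcationForm`, up to factors that
are units in the situation at hand (`det_bezoutMatrix_eq`). So every prime factor of `T`, and
every prime factor of the value `R` of `bifurcationForm` that is not one of a few degenerate ones,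
divides every Dixon resultant (`IsDixonResultant.prime_dvd`).

As `T * R` multiplied by the degenerate factors is squarefree (`squarefree_main`), none of the
prime factors of `T * R` is degenerate and all of them are simple, so `T * R` divides every Dixon
resultant; it also follows that no factor of `T` divides `R`. For point masses, `bifurcationForm`
acquires the factor `q ^ 2 * Δ ^ 2` (`bifurcationForm_pointMass`), and the same argument applies to
the complementary factor `N`.

The polynomial identities and the numbers of terms are obtained by Kronecker substitution: at
powers of a large power of two, a polynomial with small coefficients takes an integer value of
which the coefficients are the digits (`eval_eq_eval_of_evalInt_eq`, `card_support_eval_eq`).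
Squarefreeness is checked on the restriction to a line, modulo a small prime (`squarefree_eval`).
-/

/-! ### Polynomial expressions and Kronecker substitution -/

/-- Syntax trees of polynomials with integer coefficients in the variables `σ`. They make degree
bounds, coefficient bounds and integer values computable. -/
inductive PolyExpr (σ : Type) : Type
  | const (z : ℤ) : PolyExpr σ
  | var (i : σ) : PolyExpr σ
  | add (e f : PolyExpr σ) : PolyExpr σ
  | mul (e f : PolyExpr σ) : PolyExpr σ
  | pow (e : PolyExpr σ) (n : ℕ) : PolyExpr σ

namespace PolyExpr

variable {σ : Type}

instance : IntCast (PolyExpr σ) := ⟨const⟩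
instance (n : ℕ) : OfNat (PolyExpr σ) n := ⟨const n⟩
instance : Add (PolyExpr σ) := ⟨add⟩
instance : Mul (PolyExpr σ) := ⟨mul⟩
instance : Sub (PolyExpr σ) := ⟨fun e f => add e (mul (const (-1)) f)⟩
instance : Pow (PolyExpr σ) ℕ := ⟨pow⟩

/-- The value of an expression in a commutative ring. -/
def eval {A : Type*} [CommRing A] (ρ : σ → A) : PolyExpr σ → A
  | const z => z
  | var i => ρ i
  | add e f => e.eval ρ + f.eval ρ
  | mul e f => e.eval ρ * f.eval ρ
  | pow e n => e.eval ρ ^ n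

/-- The value of an expression at integers, written with the primitive operations of `ℤ` so that
it reduces quickly. -/
def evalInt (ρ : σ → ℤ) : PolyExpr σ → ℤ
  | const z => z
  | var i => ρ i
  | add e f => Int.add (e.evalInt ρ) (f.evalInt ρ)
  | mul e f => Int.mul (e.evalInt ρ) (f.evalInt ρ)
  | pow e n => Int.pow (e.evalInt ρ) n

/-- An upper bound for the sum of the absolute values of the coefficients, if `ν i` is one for
the `i`-th variable. -/
def norm (ν : σ → ℕ) : PolyExpr σ → ℕ
  | const z => z.natAbs
  | var i => ν i
  | add e f => e.norm ν + f.norm ν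
  | mul e f => e.norm ν * f.norm ν
  | pow e n => e.norm ν ^ n

/-- An upper bound for the weighted degree, if the `i`-th variable has weight `δ i`. -/
def deg (δ : σ → ℕ) : PolyExpr σ → ℕ
  | const _ => 0
  | var i => δ i
  | add e f => max (e.deg δ) (f.deg δ)
  | mul e f => e.deg δ + f.deg δ
  | pow e n => n * e.deg δ

section eval

variable {A : Type*} [CommRing A] (ρ : σ → A)

@[simp] lemma eval_var (i : σ) : (var i).eval ρ = ρ i := rfl
@[simp] lemma eval_const (z : ℤ) : (const z).eval ρ = z := rfl
@[simp] lemma eval_intCast (z : ℤ) : ((z : ℤ) : PolyExpr σ).eval ρ = z := rfl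
@[simp] lemma eval_zero : (0 : PolyExpr σ).eval ρ = 0 := Int.cast_zero
@[simp] lemma eval_one : (1 : PolyExpr σ).eval ρ = 1 := Int.cast_one
@[simp] lemma eval_ofNat (n : ℕ) [n.AtLeastTwo] :
    (ofNat(n) : PolyExpr σ).eval ρ = ofNat(n) := Int.cast_natCast n
@[simp] lemma eval_add (e f : PolyExpr σ) : (e + f).eval ρ = e.eval ρ + f.eval ρ := rfl
@[simp] lemma eval_mul (e f : PolyExpr σ) : (e * f).eval ρ = e.eval ρ * f.eval ρ := rfl
@[simp] lemma eval_pow (e : PolyExpr σ) (n : ℕ) : (e ^ n).eval ρ = e.eval ρ ^ n := rfl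
@[simp] lemma eval_sub (e f : PolyExpr σ) : (e - f).eval ρ = e.eval ρ - f.eval ρ := by
  change e.eval ρ + ((-1 : ℤ) : A) * f.eval ρ = _
  push_cast; ring

lemma map_eval {B : Type*} [CommRing B] (φ : A →+* B) (e : PolyExpr σ) :
    φ (e.eval ρ) = e.eval (fun i => φ (ρ i)) := by
  induction e with
  | const z => simp [eval]
  | var i => rfl
  | add e f he hf => simp [eval, he, hf]
  | mul e f he hf => simp [eval, he, hf]
  | pow e n he => simp [eval, he]

lemma evalInt_eq (ρ : σ → ℤ) (e : PolyExpr σ) : e.evalInt ρ = e.eval ρ := by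
  induction e with
  | const z => simp [eval, evalInt]
  | var i => rfl
  | add e f he hf => rw [evalInt, he, hf]; rfl
  | mul e f he hf => rw [evalInt, he, hf]; rfl
  | pow e n he => rw [evalInt, he]; rfl

end eval

/-- `f` is a difference of polynomials with nonnegative coefficients whose values at `1` add up
to at most `n`; equivalently, the absolute values of the coefficients of `f` add up to at most
`n`. -/
def NormLE (f : Polynomial ℤ) (n : ℕ) : Prop :=
  ∃ P Q : Polynomial ℕ, f = P.map (Nat.castRingHom ℤ) - Q.map (Nat.castRingHom ℤ) ∧
    P.eval 1 + Q.eval 1 ≤ n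

lemma coeff_le_eval_one (P : Polynomial ℕ) (i : ℕ) : P.coeff i ≤ P.eval 1 := by
  rw [Polynomial.eval_eq_sum, Polynomial.sum_def]
  by_cases h : i ∈ P.support
  · simpa using Finset.single_le_sum (f := fun i => P.coeff i) (fun _ _ => Nat.zero_le _) h
  · simp [Polynomial.notMem_support_iff.mp h]

lemma NormLE.abs_coeff_le {f : Polynomial ℤ} {n : ℕ} (h : NormLE f n) (i : ℕ) :
    |f.coeff i| ≤ n := by
  obtain ⟨P, Q, rfl, hn⟩ := h
  have hP := coeff_le_eval_one P i
  have hQ := coeff_le_eval_one Q i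
  simp only [Polynomial.coeff_sub, Polynomial.coeff_map, Nat.coe_castRingHom]
  rw [abs_le]
  constructor <;> omega

lemma NormLE.intCast (z : ℤ) : NormLE (z : Polynomial ℤ) z.natAbs := by
  obtain ⟨n, rfl | rfl⟩ := z.eq_nat_or_neg
  · exact ⟨n, 0, by simp, by simp⟩
  · exact ⟨0, n, by simp, by simp⟩

lemma NormLE.add {f g : Polynomial ℤ} {m n : ℕ} (hf : NormLE f m) (hg : NormLE g n) :
    NormLE (f + g) (m + n) := by
  obtain ⟨P, Q, rfl, h⟩ := hf
  obtain ⟨P', Q', rfl, h'⟩ := hg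
  refine ⟨P + P', Q + Q', by simp; ring, ?_⟩
  simp only [Polynomial.eval_add]; omega

lemma NormLE.mul {f g : Polynomial ℤ} {m n : ℕ} (hf : NormLE f m) (hg : NormLE g n) :
    NormLE (f * g) (m * n) := by
  obtain ⟨P, Q, rfl, h⟩ := hf
  obtain ⟨P', Q', rfl, h'⟩ := hg
  refine ⟨P * P' + Q * Q', P * Q' + Q * P', by simp; ring, ?_⟩
  simp only [Polynomial.eval_add, Polynomial.eval_mul]
  calc _ = (P.eval 1 + Q.eval 1) * (P'.eval 1 + Q'.eval 1) := by ring
    _ ≤ _ := Nat.mul_le_mul h h'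

lemma NormLE.pow {f : Polynomial ℤ} {m : ℕ} (hf : NormLE f m) (n : ℕ) :
    NormLE (f ^ n) (m ^ n) := by
  induction n with
  | zero => exact ⟨1, 0, by simp, by simp⟩
  | succ n ih => rw [pow_succ, pow_succ]; exact ih.mul hf

lemma normLE_eval {ρ : σ → Polynomial ℤ} {ν : σ → ℕ} (h : ∀ i, NormLE (ρ i) (ν i))
    (e : PolyExpr σ) : NormLE (e.eval ρ) (e.norm ν) := by
  induction e with
  | const z => exact NormLE.intCast z
  | var i => exact h i
  | add e f he hf => exact he.add hf
  | mul e f he hf => exact he.mul hf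
  | pow e n he => exact he.pow n

lemma natDegree_eval_le {ρ : σ → Polynomial ℤ} {δ : σ → ℕ} (h : ∀ i, (ρ i).natDegree ≤ δ i)
    (e : PolyExpr σ) : (e.eval ρ).natDegree ≤ e.deg δ := by
  induction e with
  | const z => simp [eval]
  | var i => exact h i
  | add e f he hf =>
    exact (Polynomial.natDegree_add_le _ _).trans (max_le_max he hf)
  | mul e f he hf => exact Polynomial.natDegree_mul_le.trans (Nat.add_le_add he hf)
  | pow e n he => exact Polynomial.natDegree_pow_le.trans (Nat.mul_le_mul_left n he)

lemma degreeOf_eval_le [DecidableEq σ] (j : σ) (e : PolyExpr σ) :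
    degreeOf j (e.eval (X : σ → MvPolynomial σ ℤ)) ≤ e.deg (fun i => if i = j then 1 else 0) := by
  induction e with
  | const z =>
    have : (const z).eval (X : σ → MvPolynomial σ ℤ) = C z := by simp [eval]
    rw [this, degreeOf_C]; exact Nat.zero_le _
  | var i => simp only [eval, deg, degreeOf_X]; split_ifs <;> simp_all
  | add e f he hf => exact (degreeOf_add_le _ _ _).trans (max_le_max he hf)
  | mul e f he hf => exact (degreeOf_mul_le _ _ _).trans (Nat.add_le_add he hf)
  | pow e n he => exact (degreeOf_pow_le _ _ _).trans (Nat.mul_le_mul_left n he)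

lemma totalDegree_eval_le (e : PolyExpr σ) :
    (e.eval (X : σ → MvPolynomial σ ℤ)).totalDegree ≤ e.deg (fun _ => 1) := by
  induction e with
  | const z =>
    have : (const z).eval (X : σ → MvPolynomial σ ℤ) = C z := by simp [eval]
    rw [this, totalDegree_C]; exact Nat.zero_le _
  | var i => simp [eval, deg]
  | add e f he hf => exact (totalDegree_add _ _).trans (max_le_max he hf)
  | mul e f he hf => exact (totalDegree_mul _ _).trans (Nat.add_le_add he hf)
  | pow e n he => exact (totalDegree_pow _ _).trans (Nat.mul_le_mul_left n he)

end PolyExpr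

/-- A polynomial with small integer coefficients is determined by its value at one large
integer. -/
lemma Polynomial.eq_of_eval_eq {B M : ℤ} : ∀ {f g : Polynomial ℤ},
    (∀ i, |f.coeff i| ≤ M) → (∀ i, |g.coeff i| ≤ M) → 2 * M < B → f.eval B = g.eval B →
    f = g := by
  suffices H : ∀ (n : ℕ) (f : Polynomial ℤ), f.natDegree < n → (∀ i, |f.coeff i| < B) →
      f.eval B = 0 → f = 0 by
    intro f g hf hg hB h
    refine sub_eq_zero.mp (H _ (f - g) (Nat.lt_succ_self _) (fun i => ?_) (by simp [h]))
    have h1 := abs_le.mp (hf i)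
    have h2 := abs_le.mp (hg i)
    rw [Polynomial.coeff_sub, abs_lt]
    constructor <;> linarith
  intro n
  induction n with
  | zero => intro f h; omega
  | succ n ih =>
    intro f hn hc h0
    have hdiv := f.divX_mul_X_add
    have hc0 : f.coeff 0 = 0 := by
      apply Int.eq_zero_of_abs_lt_dvd _ (hc 0)
      have : f.eval B = f.divX.eval B * B + f.coeff 0 := by
        conv_lhs => rw [← hdiv]
        simp
      exact ⟨-f.divX.eval B, by linarith⟩
    have hB : B ≠ 0 := by
      have := hc 0
      have := abs_nonneg (f.coeff 0)
      omega
    rw [hc0, map_zero, add_zero] at hdiv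
    rw [← hdiv] at h0 ⊢
    have h1 : f.divX.eval B = 0 := by simpa [hB] using h0
    have h2 : f.divX = 0 := by
      by_cases hd : f.natDegree = 0
      · rw [Polynomial.eq_C_of_natDegree_eq_zero hd, Polynomial.divX_C]
      · refine ih _ ?_ (fun i => ?_) h1
        · rw [Polynomial.natDegree_divX_eq_natDegree_tsub_one]; omega
        · rw [Polynomial.coeff_divX]; exact hc _
    rw [h2, zero_mul]

/-! ### Counting the terms of a polynomial by its value at a power of two -/

/-- The number with `n` digits `1` to the base `2 ^ b`. -/
def onesDigits (b n : ℕ) : ℕ := Nat.div ((2 ^ b) ^ n - 1) (2 ^ b - 1)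

/-- The number of positive coefficients among the lowest `n` coefficients of a polynomial with
value `m` at `2 ^ b`, if these are smaller than `2 ^ (b - 1)` in absolute value. Adding
`2 ^ (b - 1) - 1` to each coefficient makes it a digit to the base `2 ^ b` whose leading bit tells
whether the coefficient is positive. These bits are extracted together, and as `2 ^ b` is `1`
modulo `2 ^ b - 1`, a remainder counts them. -/
def countPositive (b n : ℕ) (m : ℤ) : ℕ :=
  Nat.mod (Nat.land (Nat.shiftRight (Int.toNat (Int.add m
    (Int.ofNat (Nat.mul (2 ^ (b - 1) - 1) (onesDigits b n))))) (b - 1)) (onesDigits b n)) (2 ^ b - 1)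

lemma onesDigits_eq {b : ℕ} (hb : 1 < b) (n : ℕ) :
    onesDigits b n = ∑ i ∈ Finset.range n, 2 ^ (b * i) := by
  have h2 : 2 ≤ 2 ^ b := le_self_pow₀ (by norm_num) (by omega)
  simp only [pow_mul]
  rw [Nat.geomSum_eq h2]
  rfl

lemma Nat.land_add_two_pow_mul {b x y : ℕ} (X Y : ℕ) (hx : x < 2 ^ b) (hy : y < 2 ^ b) :
    (x + 2 ^ b * X) &&& (y + 2 ^ b * Y) = (x &&& y) + 2 ^ b * (X &&& Y) := by
  have hxy : x &&& y < 2 ^ b := lt_of_le_of_lt Nat.and_le_left hx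
  refine Nat.eq_of_testBit_eq fun j => ?_
  rw [Nat.testBit_and, add_comm x, add_comm y, add_comm (x &&& y),
    Nat.testBit_two_pow_mul_add _ hx, Nat.testBit_two_pow_mul_add _ hy,
    Nat.testBit_two_pow_mul_add _ hxy]
  split_ifs <;> simp

/-- The leading bits of the digits of a number. -/
lemma land_shiftRight_eq {b : ℕ} (hb : 1 < b) (n : ℕ) {u : ℕ → ℕ} (hu : ∀ i, u i < 2 ^ b) :
    Nat.land (Nat.shiftRight (∑ i ∈ Finset.range n, u i * 2 ^ (b * i)) (b - 1))
      (∑ i ∈ Finset.range n, 2 ^ (b * i)) =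
    ∑ i ∈ Finset.range n, (if 2 ^ (b - 1) ≤ u i then 1 else 0) * 2 ^ (b * i) := by
  obtain ⟨c, rfl⟩ : ∃ c, b = c + 1 := ⟨b - 1, by omega⟩
  rw [Nat.add_sub_cancel]
  change (_ >>> c) &&& _ = _
  induction n generalizing u with
  | zero => simp
  | succ n ih =>
    have peel : ∀ v : ℕ → ℕ, ∑ i ∈ Finset.range (n + 1), v i * 2 ^ ((c + 1) * i) =
        v 0 + 2 ^ (c + 1) * ∑ i ∈ Finset.range n, v (i + 1) * 2 ^ ((c + 1) * i) := fun v => by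
      rw [Finset.sum_range_succ', Finset.mul_sum, add_comm]
      simp only [mul_zero, pow_zero, mul_one]
      congr 1
      exact Finset.sum_congr rfl fun i _ => by rw [mul_add, pow_add]; ring
    have peel1 := peel fun _ => 1
    simp only [one_mul] at peel1
    rw [peel u, peel1, peel fun i => if 2 ^ c ≤ u i then 1 else 0]
    have ih' := ih (u := fun i => u (i + 1)) fun i => hu _
    set U := ∑ i ∈ Finset.range n, u (i + 1) * 2 ^ ((c + 1) * i)
    rw [Nat.shiftRight_eq_div_pow] at ih' ⊢
    have hpos : 0 < 2 ^ c := by positivity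
    have h0 := hu 0
    set x := (u 0 + 2 ^ (c + 1) * U) / 2 ^ c with hx_def
    have hx : x = u 0 / 2 ^ c + 2 * U := by
      rw [hx_def, pow_succ, mul_assoc, Nat.add_mul_div_left _ _ hpos]
    have hxx : x = x % 2 ^ (c + 1) + 2 ^ (c + 1) * (U / 2 ^ c) := by
      conv_lhs => rw [← Nat.mod_add_div x (2 ^ (c + 1))]
      congr 2
      rw [hx_def, Nat.div_div_eq_div_mul, mul_comm (2 ^ c), ← Nat.div_div_eq_div_mul,
        Nat.add_mul_div_left _ _ (by positivity), Nat.div_eq_of_lt h0, zero_add]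
    have h1 : (1 : ℕ) < 2 ^ (c + 1) := Nat.one_lt_two_pow (by omega)
    rw [hxx, Nat.land_add_two_pow_mul _ _ (Nat.mod_lt _ (by positivity)) h1, ih',
      Nat.and_one_is_mod, Nat.mod_mod_of_dvd _ (dvd_pow_self 2 (by omega)), hx,
      Nat.add_mul_mod_self_left]
    congr 1
    split_ifs with h
    · rw [Nat.div_eq_of_lt_le (by rwa [one_mul]) (by rw [pow_succ] at h0; linarith), Nat.one_mod]
    · rw [Nat.div_eq_of_lt (not_le.mp h)]

/-- The digits of `f.eval (2 ^ b)` after the shift by `2 ^ (b - 1) - 1` are the shifted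
coefficients of `f`. -/
lemma Polynomial.countPositive_eq {b n : ℕ} (hb : 1 < b) (f : Polynomial ℤ)
    (hdeg : f.natDegree < n) (hc : ∀ i, |f.coeff i| < 2 ^ (b - 1)) (hn : n < 2 ^ b - 1) :
    countPositive b n (f.eval (2 ^ b)) = (f.support.filter fun i => 0 < f.coeff i).card := by
  set u : ℕ → ℕ := fun i => (f.coeff i + (2 ^ (b - 1) - 1)).toNat with hu_def
  have hcast : ∀ i, (u i : ℤ) = f.coeff i + (2 ^ (b - 1) - 1) := fun i =>
    Int.toNat_of_nonneg (by have := abs_lt.mp (hc i); linarith)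
  have h2 : (2 : ℤ) ^ b = 2 * 2 ^ (b - 1) := by
    rw [← pow_succ', Nat.sub_add_cancel hb.le]
  have hu : ∀ i, u i < 2 ^ b := fun i => by
    have h1 := hcast i
    have h3 := abs_lt.mp (hc i)
    zify
    rw [h1, h2]; linarith
  have hmem : ∀ i, 2 ^ (b - 1) ≤ u i ↔ 0 < f.coeff i := fun i => by
    zify
    rw [hcast]
    constructor <;> intro h <;> linarith
  have hsum : Int.toNat (Int.add (f.eval (2 ^ b))
      (Int.ofNat (Nat.mul (2 ^ (b - 1) - 1) (onesDigits b n)))) =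
      ∑ i ∈ Finset.range n, u i * 2 ^ (b * i) := by
    have : Int.add (f.eval (2 ^ b)) (Int.ofNat (Nat.mul (2 ^ (b - 1) - 1) (onesDigits b n))) =
        ((∑ i ∈ Finset.range n, u i * 2 ^ (b * i) : ℕ) : ℤ) := by
      change f.eval (2 ^ b) + (((2 ^ (b - 1) - 1) * onesDigits b n : ℕ) : ℤ) = _
      rw [onesDigits_eq hb, Polynomial.eval_eq_sum_range' hdeg]
      have h1 : ((2 ^ (b - 1) - 1 : ℕ) : ℤ) = 2 ^ (b - 1) - 1 := by
        rw [Nat.cast_sub Nat.one_le_two_pow]; simp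
      push_cast
      rw [h1, Finset.mul_sum, ← Finset.sum_add_distrib]
      refine Finset.sum_congr rfl fun i _ => ?_
      rw [hcast, pow_mul]; ring
    rw [this, Int.toNat_natCast]
  have hfil : (f.support.filter fun i => 0 < f.coeff i) =
      (Finset.range n).filter fun i => 0 < f.coeff i := by
    ext i
    simp only [Finset.mem_filter, Polynomial.mem_support_iff, Finset.mem_range]
    constructor
    · rintro ⟨h, h'⟩
      exact ⟨lt_of_le_of_lt (Polynomial.le_natDegree_of_ne_zero h) hdeg, h'⟩
    · rintro ⟨-, h⟩
      exact ⟨h.ne', h⟩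
  rw [countPositive, hsum, onesDigits_eq hb, land_shiftRight_eq hb n hu, hfil,
    Finset.card_filter]
  simp only [hmem]
  set e : ℕ → ℕ := fun i => if 0 < f.coeff i then 1 else 0 with he
  have hmod : ∑ i ∈ Finset.range n, e i * 2 ^ (b * i) ≡ ∑ i ∈ Finset.range n, e i
      [MOD 2 ^ b - 1] := by
    refine Nat.ModEq.sum fun i _ => ?_
    have h1 : 2 ^ b ≡ 1 [MOD 2 ^ b - 1] :=
      ((Nat.modEq_iff_dvd' Nat.one_le_two_pow).mpr dvd_rfl).symm
    rw [pow_mul]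
    simpa using (Nat.ModEq.refl (e i)).mul (h1.pow i)
  refine Eq.trans hmod (Nat.mod_eq_of_lt (lt_of_le_of_lt ?_ hn))
  calc ∑ i ∈ Finset.range n, e i ≤ ∑ _i ∈ Finset.range n, 1 :=
        Finset.sum_le_sum fun i _ => by simp only [he]; split_ifs <;> omega
    _ = n := by simp

lemma Polynomial.card_support_eq_countPositive {b n : ℕ} (hb : 1 < b) (f : Polynomial ℤ)
    (hdeg : f.natDegree < n) (hc : ∀ i, |f.coeff i| < 2 ^ (b - 1)) (hn : n < 2 ^ b - 1) :
    f.support.card =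
      countPositive b n (f.eval (2 ^ b)) + countPositive b n (Int.neg (f.eval (2 ^ b))) := by
  have hneg : Int.neg (f.eval (2 ^ b)) = (-f).eval (2 ^ b) := (Polynomial.eval_neg _ _).symm
  rw [hneg, countPositive_eq hb f hdeg hc hn,
    countPositive_eq hb (-f) (by rwa [Polynomial.natDegree_neg])
      (fun i => by simpa using hc i) hn, Polynomial.support_neg,
    ← Finset.card_filter_add_card_filter_not (p := fun i => 0 < f.coeff i) (s := f.support)]
  congr 2
  refine Finset.filter_congr fun i hi => ?_
  rw [Polynomial.mem_support_iff] at hi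
  rw [Polynomial.coeff_neg]
  omega

section Kronecker

variable {σ : Type} [Fintype σ]

/-- The Kronecker substitution `Xᵢ ↦ X ^ wᵢ`. -/
noncomputable def kronecker (w : σ → ℕ) : MvPolynomial σ ℤ →ₐ[ℤ] Polynomial ℤ :=
  aeval fun i => (Polynomial.X : Polynomial ℤ) ^ w i

/-- The weights `w` separate the monomials whose exponents are bounded by `n`. -/
def Separates (w n : σ → ℕ) : Prop :=
  ∀ m m' : σ → ℕ, (∀ i, m i ≤ n i) → (∀ i, m' i ≤ n i) →
    ∑ i, w i * m i = ∑ i, w i * m' i → m = m'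

lemma kronecker_eq_sum (w : σ → ℕ) (p : MvPolynomial σ ℤ) :
    kronecker w p = ∑ m ∈ p.support, Polynomial.monomial (∑ i, w i * m i) (p.coeff m) := by
  conv_lhs => rw [p.as_sum, map_sum]
  refine Finset.sum_congr rfl fun m _ => ?_
  rw [kronecker, aeval_monomial, ← Polynomial.C_mul_X_pow_eq_monomial, Finsupp.prod_fintype]
  · congr 1
    rw [← Finset.prod_pow_eq_pow_sum]
    exact Finset.prod_congr rfl fun i _ => (pow_mul _ _ _).symm
  · simp

variable {w n : σ → ℕ} (hw : Separates w n)
include hw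

lemma coeff_kronecker {p : MvPolynomial σ ℤ} (hp : ∀ i, degreeOf i p ≤ n i) {m : σ →₀ ℕ}
    (hm : ∀ i, m i ≤ n i) : (kronecker w p).coeff (∑ i, w i * m i) = p.coeff m := by
  rw [kronecker_eq_sum, Polynomial.finsetSum_coeff]
  simp only [Polynomial.coeff_monomial]
  rw [Finset.sum_eq_single m]
  · simp
  · intro m' hm' hne
    rw [if_neg]
    intro h
    exact hne (DFunLike.coe_injective
      (hw _ _ (fun i => (monomial_le_degreeOf _ hm').trans (hp i)) hm h))
  · intro h
    simp [notMem_support_iff.mp h]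

/-- Separating weights keep the terms of a polynomial apart. -/
lemma card_support_kronecker {p : MvPolynomial σ ℤ} (hp : ∀ i, degreeOf i p ≤ n i) :
    (kronecker w p).support.card = p.support.card := by
  classical
  have hbd : ∀ m ∈ p.support, ∀ i, m i ≤ n i := fun m hm i => (monomial_le_degreeOf _ hm).trans (hp i)
  have : (kronecker w p).support = p.support.image fun m => ∑ i, w i * m i := by
    ext j
    simp only [Finset.mem_image, Polynomial.mem_support_iff]
    constructor
    · intro h
      by_contra hne
      push Not at hne
      apply h
      rw [kronecker_eq_sum, Polynomial.finsetSum_coeff]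
      exact Finset.sum_eq_zero fun m hm => by rw [Polynomial.coeff_monomial, if_neg (hne m hm)]
    · rintro ⟨m, hm, rfl⟩
      rw [coeff_kronecker hw hp (hbd m hm)]
      exact mem_support_iff.mp hm
  rw [this, Finset.card_image_of_injOn]
  intro m hm m' hm' h
  exact DFunLike.coe_injective (hw _ _ (hbd m hm) (hbd m' hm') h)

lemma kronecker_inj {p p' : MvPolynomial σ ℤ} (hp : ∀ i, degreeOf i p ≤ n i)
    (hp' : ∀ i, degreeOf i p' ≤ n i) (h : kronecker w p = kronecker w p') : p = p' := by
  ext m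
  by_cases hm : ∀ i, m i ≤ n i
  · rw [← coeff_kronecker hw hp hm, h, coeff_kronecker hw hp' hm]
  · push Not at hm
    obtain ⟨i, hi⟩ := hm
    have key : ∀ {r : MvPolynomial σ ℤ}, degreeOf i r ≤ n i → r.coeff m = 0 := fun hr => by
      by_contra hne
      have := monomial_le_degreeOf i (mem_support_iff.mpr hne)
      omega
    rw [key (hp i), key (hp' i)]

omit hw [Fintype σ] in
lemma kronecker_eval (w : σ → ℕ) (e : PolyExpr σ) :
    kronecker w (e.eval X) = e.eval fun i => (Polynomial.X : Polynomial ℤ) ^ w i := by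
  have := PolyExpr.map_eval (X : σ → MvPolynomial σ ℤ) (kronecker w : _ →+* Polynomial ℤ) e
  simpa [kronecker] using this

omit hw [Fintype σ] in
lemma normLE_kronecker (w : σ → ℕ) (e : PolyExpr σ) :
    PolyExpr.NormLE (e.eval fun i => (Polynomial.X : Polynomial ℤ) ^ w i)
      (e.norm fun _ => 1) :=
  PolyExpr.normLE_eval (fun i => ⟨Polynomial.X ^ w i, 0, by simp, by simp⟩) e

omit hw [Fintype σ] in
lemma eval_kronecker (w : σ → ℕ) (e : PolyExpr σ) (B : ℤ) :
    (e.eval fun i => (Polynomial.X : Polynomial ℤ) ^ w i).eval B =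
      e.evalInt fun i => B ^ w i := by
  rw [PolyExpr.evalInt_eq]
  have := PolyExpr.map_eval (fun i => (Polynomial.X : Polynomial ℤ) ^ w i)
    (Polynomial.evalRingHom B) e
  simpa using this

/-- The number of terms of the polynomial of an expression, as a computation with integers. -/
lemma card_support_eval_eq [DecidableEq σ] {b k : ℕ} (e : PolyExpr σ)
    (hn : ∀ j, e.deg (fun i => if i = j then 1 else 0) ≤ n j) (hb : 1 < b)
    (hk : e.deg w < k) (hkb : k < 2 ^ b - 1) (hnorm : e.norm (fun _ => 1) < 2 ^ (b - 1)) :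
    (e.eval (X : σ → MvPolynomial σ ℤ)).support.card =
      countPositive b k (e.evalInt fun i => 2 ^ (b * w i)) +
        countPositive b k (Int.neg (e.evalInt fun i => 2 ^ (b * w i))) := by
  rw [← card_support_kronecker hw fun i => (PolyExpr.degreeOf_eval_le i e).trans (hn i),
    kronecker_eval]
  have hdeg := PolyExpr.natDegree_eval_le
    (ρ := fun i => (Polynomial.X : Polynomial ℤ) ^ w i) (δ := w) (by simp) e
  rw [Polynomial.card_support_eq_countPositive hb _ (hdeg.trans_lt hk) _ hkb, eval_kronecker]
  · simp only [pow_mul]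
  · intro i
    refine lt_of_le_of_lt ((normLE_kronecker w e).abs_coeff_le i) ?_
    exact_mod_cast hnorm

/-- Two expressions define the same polynomial if their values agree at one integer point whose
coordinates are sufficiently large powers of each other. -/
lemma eval_eq_eval_of_evalInt_eq [DecidableEq σ] {b : ℕ} (e f : PolyExpr σ)
    (he : ∀ j, e.deg (fun i => if i = j then 1 else 0) ≤ n j)
    (hf : ∀ j, f.deg (fun i => if i = j then 1 else 0) ≤ n j)
    (hne : 2 * e.norm (fun _ => 1) < 2 ^ b) (hnf : 2 * f.norm (fun _ => 1) < 2 ^ b)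
    (h : (e.evalInt fun i => 2 ^ (b * w i)) = f.evalInt fun i => 2 ^ (b * w i))
    {A : Type*} [CommRing A] (ρ : σ → A) : e.eval ρ = f.eval ρ := by
  have key : e.eval (X : σ → MvPolynomial σ ℤ) = f.eval X := by
    refine kronecker_inj hw (fun i => (PolyExpr.degreeOf_eval_le i e).trans (he i))
      (fun i => (PolyExpr.degreeOf_eval_le i f).trans (hf i)) ?_
    rw [kronecker_eval, kronecker_eval]
    refine Polynomial.eq_of_eval_eq (B := 2 ^ b)
      (M := max (e.norm fun _ => 1 : ℕ) (f.norm fun _ => 1))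
      (fun i => ((normLE_kronecker w e).abs_coeff_le i).trans (le_max_left _ _))
      (fun i => ((normLE_kronecker w f).abs_coeff_le i).trans (le_max_right _ _)) ?_ ?_
    · exact_mod_cast (by omega : 2 * max (e.norm fun _ => 1) (f.norm fun _ => 1) < 2 ^ b)
    · rw [eval_kronecker, eval_kronecker]; simpa only [pow_mul] using h
  have h2 := congrArg (eval₂Hom (Int.castRingHom A) ρ) key
  rw [PolyExpr.map_eval, PolyExpr.map_eval] at h2
  simpa using h2

end Kronecker

/-! ### The bifurcation polynomials -/

section Terms

variable {A : Type*} [Add A] [Mul A] [Zero A] [IntCast A] [Pow A ℕ]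

/-- The form `∑ v * aⁱ * bʲ * cᵏ` of degree `m` with the terms `(v, i, k)`. -/
def ternaryForm (m : ℕ) (ts : List (ℤ × ℕ × ℕ)) (a b c : A) : A :=
  ts.foldr (fun t r => (t.1 : A) * (a ^ t.2.1 * b ^ (m - t.2.1 - t.2.2) * c ^ t.2.2) + r) 0

/-- The sum of `g ^ l * h ^ n * z ^ (6 - l - n) * P l n (a, b, c)` over the list of all
`(l, n, P l n)`, where `P l n` is a form of degree `24 - 2 * (l + n)`. -/
def bifurcationSum (L : List (ℕ × ℕ × List (ℤ × ℕ × ℕ))) (a b c g h z : A) : A :=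
  L.foldr (fun t r => ternaryForm (24 - 2 * (t.1 + t.2.1)) t.2.2 a b c *
    (g ^ t.1 * h ^ t.2.1 * z ^ (6 - t.1 - t.2.1)) + r) 0

/-- The sum of `y ^ m * P m (a, b, c)` over the list of all `(m, P m)`, where `P m` is a form of
degree `20`. -/
def pointMassSum (L : List (ℕ × List (ℤ × ℕ × ℕ))) (a b c y : A) : A :=
  L.foldr (fun t r => ternaryForm 20 t.2 a b c * y ^ t.1 + r) 0

end Terms

/-- The terms of `bifurcationForm`. -/
def bifurcationTerms : List (ℕ × ℕ × List (ℤ × ℕ × ℕ)) :=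
  [(0, 0, [(1, 0, 0), (-3, 0, 2), (3, 0, 4), (-1, 0, 6), (-6, 1, 1), (18, 1, 3), (-18, 1, 5),
    (6, 1, 7), (-3, 2, 0), (24, 2, 2), (-54, 2, 4), (48, 2, 6), (-15, 2, 8), (18, 3, 1),
    (-74, 3, 3), (114, 3, 5), (-78, 3, 7), (20, 3, 9), (3, 4, 0), (-54, 4, 2), (159, 4, 4),
    (-183, 4, 6), (90, 4, 8), (-15, 4, 10), (-18, 5, 1), (114, 5, 3), (-240, 5, 5), (216, 5, 7),
    (-78, 5, 9), (6, 5, 11), (-1, 6, 0), (48, 6, 2), (-183, 6, 4), (272, 6, 6), (-183, 6, 8),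
    (48, 6, 10), (-1, 6, 12), (6, 7, 1), (-78, 7, 3), (216, 7, 5), (-240, 7, 7), (114, 7, 9),
    (-18, 7, 11), (-15, 8, 2), (90, 8, 4), (-183, 8, 6), (159, 8, 8), (-54, 8, 10), (3, 8, 12),
    (20, 9, 3), (-78, 9, 5), (114, 9, 7), (-74, 9, 9), (18, 9, 11), (-15, 10, 4), (48, 10, 6),
    (-54, 10, 8), (24, 10, 10), (-3, 10, 12), (6, 11, 5), (-18, 11, 7), (18, 11, 9), (-6, 11, 11),
    (-1, 12, 6), (3, 12, 8), (-3, 12, 10), (1, 12, 12)]),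
   (0, 1, [(3, 0, 0), (21, 0, 2), (3, 0, 4), (-18, 1, 1), (-126, 1, 3), (-18, 1, 5), (-12, 2, 0),
    (-9, 2, 2), (297, 2, 4), (48, 2, 6), (66, 3, 1), (282, 3, 3), (-330, 3, 5), (-72, 3, 7),
    (15, 4, 0), (-108, 4, 2), (-819, 4, 4), (120, 4, 6), (63, 4, 8), (-78, 5, 1), (-114, 5, 3),
    (1080, 5, 5), (114, 5, 7), (-30, 5, 9), (-6, 6, 0), (159, 6, 2), (687, 6, 4), (-687, 6, 6),
    (-159, 6, 8), (6, 6, 10), (30, 7, 1), (-114, 7, 3), (-1080, 7, 5), (114, 7, 7), (78, 7, 9),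
    (-63, 8, 2), (-120, 8, 4), (819, 8, 6), (108, 8, 8), (-15, 8, 10), (72, 9, 3), (330, 9, 5),
    (-282, 9, 7), (-66, 9, 9), (-48, 10, 4), (-297, 10, 6), (9, 10, 8), (12, 10, 10), (18, 11, 5),
    (126, 11, 7), (18, 11, 9), (-3, 12, 6), (-21, 12, 8), (-3, 12, 10)]),
   (0, 2, [(3, 0, 0), (-3, 0, 2), (-18, 1, 1), (18, 1, 3), (-18, 2, 0), (-9, 2, 2), (-54, 2, 4),
    (90, 3, 1), (138, 3, 3), (96, 3, 5), (30, 4, 0), (-81, 4, 2), (-171, 4, 4), (-102, 4, 6),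
    (-132, 5, 1), (-216, 5, 3), (-36, 5, 5), (60, 5, 7), (-15, 6, 0), (195, 6, 2), (450, 6, 4),
    (195, 6, 6), (-15, 6, 8), (60, 7, 1), (-36, 7, 3), (-216, 7, 5), (-132, 7, 7), (-102, 8, 2),
    (-171, 8, 4), (-81, 8, 6), (30, 8, 8), (96, 9, 3), (138, 9, 5), (90, 9, 7), (-54, 10, 4),
    (-9, 10, 6), (-18, 10, 8), (18, 11, 5), (-18, 11, 7), (-3, 12, 6), (3, 12, 8)]),
   (0, 3, [(1, 0, 0), (-6, 1, 1), (-12, 2, 0), (24, 2, 2), (54, 3, 1), (-56, 3, 3), (30, 4, 0),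
    (-54, 4, 2), (78, 4, 4), (-108, 5, 1), (42, 5, 3), (-60, 5, 5), (-20, 6, 0), (111, 6, 2),
    (-111, 6, 4), (20, 6, 6), (60, 7, 1), (-42, 7, 3), (108, 7, 5), (-78, 8, 2), (54, 8, 4),
    (-30, 8, 6), (56, 9, 3), (-54, 9, 5), (-24, 10, 4), (12, 10, 6), (6, 11, 5), (-1, 12, 6)]),
   (0, 4, [(-3, 2, 0), (12, 3, 1), (15, 4, 0), (-27, 4, 2), (-42, 5, 1), (30, 5, 3), (-15, 6, 0),
    (33, 6, 2), (-15, 6, 4), (30, 7, 1), (-42, 7, 3), (-27, 8, 2), (15, 8, 4), (12, 9, 3),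
    (-3, 10, 4)]),
   (0, 5, [(3, 4, 0), (-6, 5, 1), (-6, 6, 0), (6, 6, 2), (6, 7, 1), (-3, 8, 2)]),
   (0, 6, [(-1, 6, 0)]),
   (1, 0, [(3, 0, 0), (-12, 0, 2), (15, 0, 4), (-6, 0, 6), (-18, 1, 1), (66, 1, 3), (-78, 1, 5),
    (30, 1, 7), (21, 2, 0), (-9, 2, 2), (-108, 2, 4), (159, 2, 6), (-63, 2, 8), (-126, 3, 1),
    (282, 3, 3), (-114, 3, 5), (-114, 3, 7), (72, 3, 9), (3, 4, 0), (297, 4, 2), (-819, 4, 4),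
    (687, 4, 6), (-120, 4, 8), (-48, 4, 10), (-18, 5, 1), (-330, 5, 3), (1080, 5, 5),
    (-1080, 5, 7), (330, 5, 9), (18, 5, 11), (48, 6, 2), (120, 6, 4), (-687, 6, 6), (819, 6, 8),
    (-297, 6, 10), (-3, 6, 12), (-72, 7, 3), (114, 7, 5), (114, 7, 7), (-282, 7, 9), (126, 7, 11),
    (63, 8, 4), (-159, 8, 6), (108, 8, 8), (9, 8, 10), (-21, 8, 12), (-30, 9, 5), (78, 9, 7),
    (-66, 9, 9), (18, 9, 11), (6, 10, 6), (-15, 10, 8), (12, 10, 10), (-3, 10, 12)]),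
   (1, 1, [(9, 0, 0), (84, 0, 2), (15, 0, 4), (-48, 1, 1), (-420, 1, 3), (-72, 1, 5), (84, 2, 0),
    (459, 2, 2), (1026, 2, 4), (132, 2, 6), (-420, 3, 1), (-2652, 3, 3), (-1584, 3, 5),
    (-150, 3, 7), (15, 4, 0), (1026, 4, 2), (6894, 4, 4), (1788, 4, 6), (132, 4, 8), (-72, 5, 1),
    (-1584, 5, 3), (-9324, 5, 5), (-1584, 5, 7), (-72, 5, 9), (132, 6, 2), (1788, 6, 4),
    (6894, 6, 6), (1026, 6, 8), (15, 6, 10), (-150, 7, 3), (-1584, 7, 5), (-2652, 7, 7),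
    (-420, 7, 9), (132, 8, 4), (1026, 8, 6), (459, 8, 8), (84, 8, 10), (-72, 9, 5), (-420, 9, 7),
    (-48, 9, 9), (15, 10, 6), (84, 10, 8), (9, 10, 10)]),
   (1, 2, [(9, 0, 0), (-12, 0, 2), (-42, 1, 1), (54, 1, 3), (126, 2, 0), (432, 2, 2), (-54, 2, 4),
    (-504, 3, 1), (-372, 3, 3), (42, 3, 5), (30, 4, 0), (1164, 4, 2), (-960, 4, 4), (-111, 4, 6),
    (-108, 5, 1), (-1728, 5, 3), (1728, 5, 5), (108, 5, 7), (111, 6, 2), (960, 6, 4),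
    (-1164, 6, 6), (-30, 6, 8), (-42, 7, 3), (372, 7, 5), (504, 7, 7), (54, 8, 4), (-432, 8, 6),
    (-126, 8, 8), (-54, 9, 5), (42, 9, 7), (12, 10, 6), (-9, 10, 8)]),
   (1, 3, [(3, 0, 0), (-12, 1, 1), (84, 2, 0), (-36, 2, 2), (-252, 3, 1), (78, 3, 3), (30, 4, 0),
    (438, 4, 2), (21, 4, 4), (-72, 5, 1), (-456, 5, 3), (-72, 5, 5), (21, 6, 2), (438, 6, 4),
    (30, 6, 6), (78, 7, 3), (-252, 7, 5), (-36, 8, 4), (84, 8, 6), (-12, 9, 5), (3, 10, 6)]),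
   (1, 4, [(21, 2, 0), (-42, 3, 1), (15, 4, 0), (3, 4, 2), (-18, 5, 1), (18, 5, 3), (-3, 6, 2),
    (-15, 6, 4), (42, 7, 3), (-21, 8, 4)]),
   (1, 5, [(3, 4, 0), (3, 6, 2)]),
   (2, 0, [(3, 0, 0), (-18, 0, 2), (30, 0, 4), (-15, 0, 6), (-18, 1, 1), (90, 1, 3), (-132, 1, 5),
    (60, 1, 7), (-3, 2, 0), (-9, 2, 2), (-81, 2, 4), (195, 2, 6), (-102, 2, 8), (18, 3, 1),
    (138, 3, 3), (-216, 3, 5), (-36, 3, 7), (96, 3, 9), (-54, 4, 2), (-171, 4, 4), (450, 4, 6),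
    (-171, 4, 8), (-54, 4, 10), (96, 5, 3), (-36, 5, 5), (-216, 5, 7), (138, 5, 9), (18, 5, 11),
    (-102, 6, 4), (195, 6, 6), (-81, 6, 8), (-9, 6, 10), (-3, 6, 12), (60, 7, 5), (-132, 7, 7),
    (90, 7, 9), (-18, 7, 11), (-15, 8, 6), (30, 8, 8), (-18, 8, 10), (3, 8, 12)]),
   (2, 1, [(9, 0, 0), (126, 0, 2), (30, 0, 4), (-42, 1, 1), (-504, 1, 3), (-108, 1, 5),
    (-12, 2, 0), (432, 2, 2), (1164, 2, 4), (111, 2, 6), (54, 3, 1), (-372, 3, 3), (-1728, 3, 5),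
    (-42, 3, 7), (-54, 4, 2), (-960, 4, 4), (960, 4, 6), (54, 4, 8), (42, 5, 3), (1728, 5, 5),
    (372, 5, 7), (-54, 5, 9), (-111, 6, 4), (-1164, 6, 6), (-432, 6, 8), (12, 6, 10), (108, 7, 5),
    (504, 7, 7), (42, 7, 9), (-30, 8, 6), (-126, 8, 8), (-9, 8, 10)]),
   (2, 2, [(9, 0, 0), (-18, 0, 2), (-30, 1, 1), (54, 1, 3), (-18, 2, 0), (390, 2, 2), (45, 2, 4),
    (54, 3, 1), (-1842, 3, 3), (-180, 3, 5), (45, 4, 2), (2820, 4, 4), (45, 4, 6), (-180, 5, 3),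
    (-1842, 5, 5), (54, 5, 7), (45, 6, 4), (390, 6, 6), (-18, 6, 8), (54, 7, 5), (-30, 7, 7),
    (-18, 8, 6), (9, 8, 8)]),
   (2, 3, [(3, 0, 0), (-6, 1, 1), (-12, 2, 0), (-51, 2, 2), (18, 3, 1), (126, 3, 3), (36, 4, 2),
    (-36, 4, 4), (-126, 5, 3), (-18, 5, 5), (51, 6, 4), (12, 6, 6), (6, 7, 5), (-3, 8, 6)]),
   (2, 4, [(-3, 2, 0), (-9, 4, 2), (-3, 6, 4)]),
   (3, 0, [(1, 0, 0), (-12, 0, 2), (30, 0, 4), (-20, 0, 6), (-6, 1, 1), (54, 1, 3), (-108, 1, 5),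
    (60, 1, 7), (24, 2, 2), (-54, 2, 4), (111, 2, 6), (-78, 2, 8), (-56, 3, 3), (42, 3, 5),
    (-42, 3, 7), (56, 3, 9), (78, 4, 4), (-111, 4, 6), (54, 4, 8), (-24, 4, 10), (-60, 5, 5),
    (108, 5, 7), (-54, 5, 9), (6, 5, 11), (20, 6, 6), (-30, 6, 8), (12, 6, 10), (-1, 6, 12)]),
   (3, 1, [(3, 0, 0), (84, 0, 2), (30, 0, 4), (-12, 1, 1), (-252, 1, 3), (-72, 1, 5), (-36, 2, 2),
    (438, 2, 4), (21, 2, 6), (78, 3, 3), (-456, 3, 5), (78, 3, 7), (21, 4, 4), (438, 4, 6),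
    (-36, 4, 8), (-72, 5, 5), (-252, 5, 7), (-12, 5, 9), (30, 6, 6), (84, 6, 8), (3, 6, 10)]),
   (3, 2, [(3, 0, 0), (-12, 0, 2), (-6, 1, 1), (18, 1, 3), (-51, 2, 2), (36, 2, 4), (126, 3, 3),
    (-126, 3, 5), (-36, 4, 4), (51, 4, 6), (-18, 5, 5), (6, 5, 7), (12, 6, 6), (-3, 6, 8)]),
   (3, 3, [(1, 0, 0), (9, 2, 2), (9, 4, 4), (1, 6, 6)]),
   (4, 0, [(-3, 0, 2), (15, 0, 4), (-15, 0, 6), (12, 1, 3), (-42, 1, 5), (30, 1, 7), (-27, 2, 4),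
    (33, 2, 6), (-27, 2, 8), (30, 3, 5), (-42, 3, 7), (12, 3, 9), (-15, 4, 6), (15, 4, 8),
    (-3, 4, 10)]),
   (4, 1, [(21, 0, 2), (15, 0, 4), (-42, 1, 3), (-18, 1, 5), (3, 2, 4), (-3, 2, 6), (18, 3, 5),
    (42, 3, 7), (-15, 4, 6), (-21, 4, 8)]),
   (4, 2, [(-3, 0, 2), (-9, 2, 4), (-3, 4, 6)]),
   (5, 0, [(3, 0, 4), (-6, 0, 6), (-6, 1, 5), (6, 1, 7), (6, 2, 6), (-3, 2, 8)]),
   (5, 1, [(3, 0, 4), (3, 2, 6)]),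
   (6, 0, [(-1, 0, 6)])]

/-- The terms of `pointMassForm`. -/
def pointMassTerms : List (ℕ × List (ℤ × ℕ × ℕ)) :=
  [(0, [(28311552, 4, 0), (-84934656, 6, 2), (84934656, 8, 4), (-28311552, 10, 6)]),
   (1, [(7077888, 4, 0), (-5308416, 4, 2), (-7077888, 5, 1), (40697856, 6, 2), (10616832, 6, 4),
    (-81395712, 7, 3), (40697856, 8, 4), (-5308416, 8, 6), (-7077888, 9, 5), (7077888, 10, 6)]),
   (2, [(4096, 0, 0), (-16384, 1, 1), (-12288, 2, 0), (12288, 2, 2), (24576, 3, 1), (32768, 3, 3),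
    (675840, 4, 0), (2125824, 4, 2), (274432, 4, 4), (-1327104, 5, 1), (811008, 5, 3),
    (-4096, 6, 0), (3612672, 6, 2), (-274432, 6, 6), (-8192, 7, 1), (-811008, 7, 5),
    (-32768, 7, 7), (-3612672, 8, 4), (-2125824, 8, 6), (-12288, 8, 8), (8192, 9, 3),
    (1327104, 9, 5), (-24576, 9, 7), (16384, 9, 9), (4096, 10, 4), (-675840, 10, 6),
    (12288, 10, 8), (-4096, 10, 10)]),
   (3, [(768, 0, 0), (-768, 0, 2), (-3072, 1, 1), (3072, 1, 3), (-2304, 2, 0), (12288, 2, 2),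
    (-3072, 2, 4), (6144, 3, 1), (-44544, 3, 3), (-3072, 3, 5), (29952, 4, 0), (106752, 4, 2),
    (125184, 4, 4), (768, 4, 6), (-86016, 5, 1), (-503808, 5, 3), (-153600, 5, 5), (-3072, 5, 7),
    (-768, 6, 0), (108288, 6, 2), (744960, 6, 4), (125184, 6, 6), (-3072, 6, 8), (-76800, 7, 3),
    (-503808, 7, 5), (-44544, 7, 7), (3072, 7, 9), (-5376, 8, 2), (108288, 8, 4), (106752, 8, 6),
    (12288, 8, 8), (-768, 8, 10), (-86016, 9, 5), (6144, 9, 7), (-3072, 9, 9), (-768, 10, 4),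
    (29952, 10, 6), (-2304, 10, 8), (768, 10, 10)]),
   (4, [(48, 0, 0), (336, 0, 2), (48, 0, 4), (-192, 1, 1), (-1344, 1, 3), (-192, 1, 5),
    (-144, 2, 0), (-768, 2, 2), (1968, 2, 4), (240, 2, 6), (480, 3, 1), (4224, 3, 3),
    (-1248, 3, 5), (576, 4, 0), (-768, 4, 2), (-5616, 4, 4), (-240, 4, 8), (-2112, 5, 1),
    (672, 5, 3), (1248, 5, 7), (192, 5, 9), (-48, 6, 0), (2496, 6, 2), (5616, 6, 6),
    (-1968, 6, 8), (-48, 6, 10), (96, 7, 1), (-672, 7, 5), (-4224, 7, 7), (1344, 7, 9),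
    (-2496, 8, 4), (768, 8, 6), (768, 8, 8), (-336, 8, 10), (-96, 9, 3), (2112, 9, 5),
    (-480, 9, 7), (192, 9, 9), (48, 10, 4), (-576, 10, 6), (144, 10, 8), (-48, 10, 10)]),
   (5, [(1, 0, 0), (-3, 0, 2), (3, 0, 4), (-1, 0, 6), (-4, 1, 1), (12, 1, 3), (-12, 1, 5),
    (4, 1, 7), (-3, 2, 0), (15, 2, 2), (-27, 2, 4), (21, 2, 6), (-6, 2, 8), (12, 3, 1),
    (-40, 3, 3), (48, 3, 5), (-24, 3, 7), (4, 3, 9), (3, 4, 0), (-27, 4, 2), (64, 4, 4),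
    (-60, 4, 6), (21, 4, 8), (-1, 4, 10), (-12, 5, 1), (48, 5, 3), (-72, 5, 5), (48, 5, 7),
    (-12, 5, 9), (-1, 6, 0), (21, 6, 2), (-60, 6, 4), (64, 6, 6), (-27, 6, 8), (3, 6, 10),
    (4, 7, 1), (-24, 7, 3), (48, 7, 5), (-40, 7, 7), (12, 7, 9), (-6, 8, 2), (21, 8, 4),
    (-27, 8, 6), (15, 8, 8), (-3, 8, 10), (4, 9, 3), (-12, 9, 5), (12, 9, 7), (-4, 9, 9),
    (-1, 10, 4), (3, 10, 6), (-3, 10, 8), (1, 10, 10)])]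

/-- The eliminant of the bifurcation equations, in the variables `a`, `b`, `c`, `g = γ ^ 2`,
`h = δ ^ 2` and a homogenizing variable `z`; see `det_bezoutMatrix_eq`. -/
def bifurcationForm {A : Type*} [Add A] [Mul A] [Zero A] [IntCast A] [Pow A ℕ]
    (a b c g h z : A) : A :=
  bifurcationSum bifurcationTerms a b c g h z

/-- The factor of `bifurcationForm a b c (16 * a ^ 2) (16 * b ^ 2) y` that remains after removing
`y * (a * c - b ^ 2) ^ 2`; see `bifurcationForm_pointMass`. -/
def pointMassForm {A : Type*} [Add A] [Mul A] [Zero A] [IntCast A] [Pow A ℕ] (a b c y : A) : A :=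
  pointMassSum pointMassTerms a b c y

namespace PolyExpr

variable {σ : Type} {A : Type*} [CommRing A] (ρ : σ → A)

lemma eval_ternaryForm (m : ℕ) (ts : List (ℤ × ℕ × ℕ)) (a b c : PolyExpr σ) :
    (ternaryForm m ts a b c).eval ρ = ternaryForm m ts (a.eval ρ) (b.eval ρ) (c.eval ρ) := by
  induction ts with
  | nil => simp [ternaryForm]
  | cons t ts ih => simp only [ternaryForm, List.foldr_cons] at ih ⊢; simp [ih]

@[simp] lemma eval_bifurcationForm (a b c g h z : PolyExpr σ) :
    (bifurcationForm a b c g h z).eval ρ = bifurcationForm (a.eval ρ) (b.eval ρ) (c.eval ρ)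
      (g.eval ρ) (h.eval ρ) (z.eval ρ) := by
  unfold bifurcationForm
  induction bifurcationTerms with
  | nil => simp [bifurcationSum]
  | cons t L ih =>
    simp only [bifurcationSum, List.foldr_cons] at ih ⊢; simp [ih, eval_ternaryForm]

@[simp] lemma eval_pointMassForm (a b c y : PolyExpr σ) :
    (pointMassForm a b c y).eval ρ =
      pointMassForm (a.eval ρ) (b.eval ρ) (c.eval ρ) (y.eval ρ) := by
  unfold pointMassForm
  induction pointMassTerms with
  | nil => simp [pointMassSum]
  | cons t L ih =>
    simp only [pointMassSum, List.foldr_cons] at ih ⊢; simp [ih, eval_ternaryForm]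

end PolyExpr

namespace PolyExpr

/-- The polynomial `R` in the variables `q, d, s, χ`. -/
def remaining : PolyExpr (Fin 4) :=
  bifurcationForm (var 1 * var 2) (2 - var 1) (var 1 * (2 - var 2))
    (4 * (1 + var 3) ^ 2) (4 * (1 - var 3) ^ 2) (var 0 ^ 2)

/-- The Hessian determinant at the trivial equilibrium `c₁ = ε₁`, `c₂ = ε₂`. -/
def trivial (ε₁ ε₂ : ℤ) : PolyExpr (Fin 4) :=
  (2 * (1 + var 3) * (ε₁ : PolyExpr (Fin 4)) - var 0 * (var 1 * var 2)) *
    (2 * (1 - var 3) * (ε₂ : PolyExpr (Fin 4)) - var 0 * (var 1 * (2 - var 2))) -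
    var 0 ^ 2 * (2 - var 1) ^ 2

/-- The product of the Hessian determinants at the four trivial equilibria. -/
def trivials : PolyExpr (Fin 4) :=
  trivial 1 1 * trivial 1 (-1) * trivial (-1) 1 * trivial (-1) (-1)

/-- The polynomial `N` in the variables `q, d, s`. -/
def remainingPointMass : PolyExpr (Fin 3) :=
  pointMassForm (var 1 * var 2) (2 - var 1) (var 1 * (2 - var 2))
    (var 0 ^ 2 * (2 + var 1 * (var 2 - 1)) ^ 2)

end PolyExpr

/-! ### Squarefree polynomials -/

/-- A polynomial is squarefree if its restriction to some line is squarefree of the same degree. -/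
lemma squarefree_of_line {σ : Type*} {k : Type*} [Field k] {S : MvPolynomial σ k}
    {ρ : σ → Polynomial k} (hρ : ∀ i, (ρ i).natDegree ≤ 1)
    (hdeg : S.totalDegree ≤ (aeval ρ S).natDegree) (h : Squarefree (aeval ρ S)) :
    Squarefree S := by
  have hle : ∀ g : MvPolynomial σ k, (aeval ρ g).natDegree ≤ g.totalDegree := fun g => by
    rw [g.as_sum, map_sum, ← g.as_sum]
    refine Polynomial.natDegree_sum_le_of_forall_le _ _ fun m hm => ?_
    rw [aeval_monomial, Polynomial.algebraMap_eq]
    refine (Polynomial.natDegree_C_mul_le _ _).trans ?_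
    rw [Finsupp.prod]
    refine (Polynomial.natDegree_prod_le _ _).trans ?_
    calc ∑ i ∈ m.support, (ρ i ^ m i).natDegree ≤ ∑ i ∈ m.support, m i :=
          Finset.sum_le_sum fun i _ => Polynomial.natDegree_pow_le.trans
            (by simpa using Nat.mul_le_mul_left (m i) (hρ i))
      _ ≤ g.totalDegree := le_totalDegree hm
  have h0 : aeval ρ S ≠ 0 := h.ne_zero
  rintro g ⟨r, rfl⟩
  have hu : IsUnit (aeval ρ g) := h _ ⟨aeval ρ r, by simp⟩
  have hg : g ≠ 0 := by rintro rfl; simp at h0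
  have hr : r ≠ 0 := by rintro rfl; simp at h0
  have hg' : aeval ρ g ≠ 0 := hu.ne_zero
  have hr' : aeval ρ r ≠ 0 := fun h => h0 (by simp [h])
  rw [totalDegree_mul_of_isDomain (mul_ne_zero hg hg) hr, totalDegree_mul_of_isDomain hg hg,
    map_mul, map_mul, Polynomial.natDegree_mul (mul_ne_zero hg' hg') hr',
    Polynomial.natDegree_mul hg' hg', Polynomial.natDegree_eq_zero_of_isUnit hu] at hdeg
  have h1 := hle r
  have h2 : g.totalDegree = 0 := by omega
  rw [totalDegree_eq_zero_iff_eq_C] at h2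
  rw [h2] at hg ⊢
  exact (IsUnit.mk0 _ fun h => hg (by rw [h, C_0])).map C

/-- An integer polynomial is squarefree over `ℚ` if it is separable of the same degree modulo
some prime. -/
lemma squarefree_map_of_separable_mod {p : ℕ} [Fact p.Prime] {f : Polynomial ℤ}
    (hdeg : (f.map (Int.castRingHom (ZMod p))).natDegree = f.natDegree)
    (hsep : (f.map (Int.castRingHom (ZMod p))).Separable) :
    Squarefree (f.map (Int.castRingHom ℚ)) := by
  set n := f.natDegree with hn
  have hres : ∀ {K : Type} [Field K] (φ : ℤ →+* K), (f.map φ).natDegree = n → f.map φ ≠ 0 →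
      (φ (f.resultant f.derivative n (n - 1)) = 0 ↔ ¬ (f.map φ).Separable) := by
    intro K _ φ hφ hφ0
    have hd : (f.map φ).derivative.natDegree ≤ n - 1 := by
      rw [← hφ]; exact Polynomial.natDegree_derivative_le _
    obtain ⟨k, hk⟩ := Nat.exists_eq_add_of_le hd
    rw [← Polynomial.resultant_map_map, ← Polynomial.derivative_map, hk,
      Polynomial.resultant_add_right_deg _ _ _ _ _ le_rfl, Polynomial.separable_def]
    have hc : (f.map φ).coeff n ≠ 0 := by
      rw [← hφ]; exact Polynomial.leadingCoeff_ne_zero.mpr hφ0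
    rw [mul_eq_zero, or_iff_right (pow_ne_zero _ hc)]
    rw [← hφ, Polynomial.resultant_eq_zero_iff]
    simp [hφ0]
  have hp0 := hsep.ne_zero
  have hQ : Function.Injective (Int.castRingHom ℚ) := Int.cast_injective
  have hf0 : f ≠ 0 := by rintro rfl; simp at hp0
  have h1 : f.resultant f.derivative n (n - 1) ≠ 0 := fun h => by
    refine (hres (Int.castRingHom (ZMod p)) hdeg hp0).mp ?_ hsep
    rw [h, map_zero]
  refine Polynomial.Separable.squarefree ?_
  by_contra h
  refine h1 (hQ ?_)
  rw [map_zero]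
  exact (hres (Int.castRingHom ℚ) (Polynomial.natDegree_map_eq_of_injective hQ f)
    ((Polynomial.map_ne_zero_iff hQ).mpr hf0)).mpr h

/-- The polynomial with the given list of coefficients. -/
noncomputable def listPoly {R : Type*} [CommRing R] : List ℤ → Polynomial R
  | [] => 0
  | a :: l => Polynomial.C (a : R) + Polynomial.X * listPoly l

/-- Addition of coefficient lists. -/
def listAdd : List ℤ → List ℤ → List ℤ
  | [], m => m
  | a :: l, [] => a :: l
  | a :: l, b :: m => Int.add a b :: listAdd l m

/-- Multiplication of coefficient lists. -/
def listMul : List ℤ → List ℤ → List ℤ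
  | [], _ => []
  | a :: l, m => listAdd (m.map (Int.mul a)) (0 :: listMul l m)

/-- The derivative of a coefficient list. -/
def listDerivative : List ℤ → List ℤ
  | [] => []
  | _ :: l => listAdd l (0 :: listDerivative l)

/-- The value of a coefficient list. -/
def listEval (B : ℤ) : List ℤ → ℤ
  | [] => 0
  | a :: l => Int.add a (Int.mul B (listEval B l))

/-- The lowest `n` digits of `m` to the base `B`, chosen between `-B / 2` and `B / 2`. -/
def listDigits (B : ℕ) : ℕ → ℤ → List ℤ
  | 0, _ => []
  | n + 1, m => Int.bmod m B :: listDigits B n (Int.ediv (m - Int.bmod m B) B)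

section

variable {R : Type*} [CommRing R]

lemma listPoly_add (l m : List ℤ) :
    (listPoly (listAdd l m) : Polynomial R) = listPoly l + listPoly m := by
  induction l generalizing m with
  | nil => simp [listPoly, listAdd]
  | cons a l ih =>
    cases m with
    | nil => simp [listPoly, listAdd]
    | cons b m =>
      simp [listPoly, listAdd, ih]; ring

lemma listPoly_mul (l m : List ℤ) :
    (listPoly (listMul l m) : Polynomial R) = listPoly l * listPoly m := by
  induction l with
  | nil => simp [listPoly, listMul]
  | cons a l ih =>
    have hs : (listPoly (m.map (Int.mul a)) : Polynomial R) = Polynomial.C (a : R) * listPoly m := by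
      clear ih
      induction m with
      | nil => simp [listPoly]
      | cons b m ihm =>
        have : ((Int.mul a b : ℤ) : R) = a * b := Int.cast_mul a b
        simp only [List.map_cons, listPoly, ihm, this, map_mul]; ring
    rw [listMul, listPoly_add, hs, listPoly, listPoly, ih]; simp; ring

lemma listPoly_derivative (l : List ℤ) :
    (listPoly (listDerivative l) : Polynomial R) = (listPoly l).derivative := by
  induction l with
  | nil => simp [listPoly, listDerivative]
  | cons a l ih =>
    rw [listDerivative, listPoly_add, listPoly, listPoly, ih]; simp

lemma listPoly_eval (B : ℤ) (l : List ℤ) : (listPoly l : Polynomial ℤ).eval B = listEval B l := by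
  induction l with
  | nil => simp [listPoly, listEval]
  | cons a l ih =>
    rw [listPoly, listEval]
    simp only [Polynomial.eval_add, Polynomial.eval_mul, Polynomial.eval_C, Polynomial.eval_X, ih]
    rfl

lemma listPoly_map (l : List ℤ) :
    (listPoly l : Polynomial ℤ).map (Int.castRingHom R) = listPoly l := by
  induction l with
  | nil => simp [listPoly]
  | cons a l ih => simp [listPoly, ih]

lemma coeff_listPoly (l : List ℤ) (i : ℕ) :
    (listPoly l : Polynomial R).coeff i = ((l.getD i 0 : ℤ) : R) := by
  induction l generalizing i with
  | nil => simp [listPoly]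
  | cons a l ih => cases i <;> simp [listPoly, ih, -map_intCast, Polynomial.coeff_C]

lemma natDegree_listPoly_lt (l : List ℤ) (n : ℕ) (h : l.length ≤ n + 1) :
    (listPoly l : Polynomial R).natDegree ≤ n := by
  rw [Polynomial.natDegree_le_iff_coeff_eq_zero]
  intro i hi
  rw [coeff_listPoly, List.getD_eq_default _ _ (by omega), Int.cast_zero]

end

/-- A computable criterion for `listPoly l` to be separable modulo `p` of degree `n`: its
leading coefficient is nonzero and `u * l + v * l' = 1` modulo `p`. -/
def separableCheck (p n : ℕ) (u v l : List ℤ) : Bool :=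
  Nat.beq l.length (n + 1) && !decide (Int.emod (l.getD n 0) p = 0) &&
    (listAdd [-1] (listAdd (listMul u (l.map fun a => Int.emod a p))
      (listMul v (listDerivative (l.map fun a => Int.emod a p))))).all
        fun a => decide (Int.emod a p = 0)

lemma separable_of_separableCheck {p n : ℕ} {u v l : List ℤ} (h : separableCheck p n u v l) :
    (listPoly l : Polynomial (ZMod p)).Separable ∧
      (listPoly l : Polynomial (ZMod p)).natDegree = n ∧
      (listPoly l : Polynomial ℤ).natDegree = n := by
  have hzero : ∀ a : ℤ, Int.emod a p = 0 ↔ (a : ZMod p) = 0 := fun a => by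
    rw [ZMod.intCast_zmod_eq_zero_iff_dvd]
    exact ⟨Int.dvd_of_emod_eq_zero, Int.emod_eq_zero_of_dvd⟩
  rw [separableCheck, Bool.and_eq_true, Bool.and_eq_true] at h
  obtain ⟨⟨hlen, hlead⟩, hbez⟩ := h
  have hlen := Nat.eq_of_beq_eq_true hlen
  have hlead' : ((l.getD n 0 : ℤ) : ZMod p) ≠ 0 := by
    rw [Ne, ← hzero]; simpa using hlead
  have hmod : ∀ l : List ℤ,
      (listPoly (l.map fun a => Int.emod a p) : Polynomial (ZMod p)) = listPoly l := by
    intro l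
    induction l with
    | nil => rfl
    | cons a l ih =>
      rw [List.map_cons, listPoly, listPoly, ih]
      have : ((Int.emod a p : ℤ) : ZMod p) = a := ZMod.intCast_mod a p
      rw [this]
  refine ⟨?_, ?_, ?_⟩
  · have hall : ∀ m : List ℤ, (m.all fun a => decide (Int.emod a p = 0)) = true →
        (listPoly m : Polynomial (ZMod p)) = 0 := by
      intro m hm
      induction m with
      | nil => rfl
      | cons a m ih =>
        rw [List.all_cons, Bool.and_eq_true] at hm
        have ha := of_decide_eq_true hm.1
        rw [listPoly, ih hm.2, (hzero a).mp ha]; simp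
    have h0 := hall _ hbez
    rw [listPoly_add, listPoly_add, listPoly_mul, listPoly_mul, listPoly_derivative, hmod] at h0
    refine ⟨listPoly u, listPoly v, ?_⟩
    have h1 : (listPoly [-1] : Polynomial (ZMod p)) = -1 := by simp [listPoly]
    rw [h1] at h0
    linear_combination h0
  · refine le_antisymm (natDegree_listPoly_lt l n hlen.le)
      (Polynomial.le_natDegree_of_ne_zero ?_)
    rwa [coeff_listPoly]
  · refine le_antisymm (natDegree_listPoly_lt l n hlen.le)
      (Polynomial.le_natDegree_of_ne_zero ?_)
    rw [coeff_listPoly]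
    intro h
    rw [Int.cast_id] at h
    rw [h, Int.cast_zero] at hlead'
    exact hlead' rfl

/-- A computable criterion for the polynomial of an expression to be squarefree: its restriction
to the line `Xᵢ = cᵢ + tᵢ * X` is squarefree. The coefficients of the restriction are the digits of
its value at `2 ^ b`. -/
lemma squarefree_eval {σ : Type} (e : PolyExpr σ) (c t : σ → ℕ) (p n b : ℕ) [Fact p.Prime]
    (u v : List ℤ) (hdeg : e.deg (fun _ => 1) = n)
    (hnorm : 2 * e.norm (fun i => c i + t i) < 2 ^ b)
    (h : (fun (m : ℤ) (l : List ℤ) =>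
      decide (listEval (2 ^ b) l = m) &&
        (l.all fun a => Nat.ble (2 * a.natAbs + 1) (2 ^ b)) && separableCheck p n u v l)
      (e.evalInt fun i => c i + t i * 2 ^ b)
      (listDigits (2 ^ b) (n + 1) (e.evalInt fun i => c i + t i * 2 ^ b)) = true) :
    Squarefree (e.eval (X : σ → MvPolynomial σ ℚ)) := by
  -- `m` is the value at `2 ^ b` of the restriction `e.eval ρ`, and `l` its list of coefficients
  set m := e.evalInt fun i => c i + t i * 2 ^ b
  set l := listDigits (2 ^ b) (n + 1) m
  simp only [Bool.and_eq_true] at h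
  obtain ⟨⟨h1, h2⟩, h3⟩ := h
  have h1 : listEval (2 ^ b) l = m := of_decide_eq_true h1
  set ρ : σ → Polynomial ℤ := fun i => Polynomial.C (c i : ℤ) + Polynomial.C (t i : ℤ) * Polynomial.X with hρ
  have hl : e.eval ρ = listPoly l := by
    have hpos : (0 : ℤ) < 2 ^ b := by positivity
    refine Polynomial.eq_of_eval_eq (B := 2 ^ b) (M := (2 ^ b - 1) / 2) (fun i => ?_)
      (fun i => ?_) (by omega) ?_
    · have hν : ∀ i, PolyExpr.NormLE (ρ i) (c i + t i) := fun i =>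
        ⟨Polynomial.C (c i) + Polynomial.C (t i) * Polynomial.X, 0, by simp [hρ], by simp⟩
      have := (PolyExpr.normLE_eval hν e).abs_coeff_le i
      zify at hnorm
      omega
    · rw [coeff_listPoly, Int.cast_id]
      by_cases hi : i < l.length
      · have := (List.all_eq_true.mp h2) _ (List.getElem_mem hi)
        rw [List.getD_eq_getElem _ _ hi]
        have := Nat.le_of_ble_eq_true this
        zify at this
        omega
      · rw [List.getD_eq_default _ _ (by omega)]; simp; omega
    · rw [listPoly_eval, h1]
      have := PolyExpr.map_eval ρ (Polynomial.evalRingHom (2 ^ b)) e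
      rw [Polynomial.coe_evalRingHom] at this
      rw [this]
      simp only [m]
      rw [PolyExpr.evalInt_eq]
      simp [hρ]
  obtain ⟨hs, hd, hd'⟩ := separable_of_separableCheck h3
  have hmapQ : (e.eval ρ).map (Int.castRingHom ℚ) =
      aeval (fun i => (ρ i).map (Int.castRingHom ℚ)) (e.eval (X : σ → MvPolynomial σ ℚ)) := by
    have h4 := PolyExpr.map_eval ρ (Polynomial.mapRingHom (Int.castRingHom ℚ)) e
    have h5 := PolyExpr.map_eval (X : σ → MvPolynomial σ ℚ)
      ((aeval fun i => (ρ i).map (Int.castRingHom ℚ) :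
        MvPolynomial σ ℚ →ₐ[ℚ] Polynomial ℚ) : _ →+* Polynomial ℚ) e
    simp only [Polynomial.coe_mapRingHom] at h4
    rw [h4]
    simpa using h5.symm
  have hsq : Squarefree ((e.eval ρ).map (Int.castRingHom ℚ)) := by
    apply squarefree_map_of_separable_mod (p := p)
    · rw [hl, listPoly_map, hd, hd']
    · rw [hl, listPoly_map]; exact hs
  refine squarefree_of_line (ρ := fun i => (ρ i).map (Int.castRingHom ℚ)) (fun i => ?_) ?_ ?_
  · refine (Polynomial.natDegree_map_le).trans ?_
    simp only [hρ]
    compute_degree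
  · rw [← hmapQ, Polynomial.natDegree_map_eq_of_injective Int.cast_injective, hl, hd', ← hdeg]
    have h6 : e.eval (X : σ → MvPolynomial σ ℚ) =
        (e.eval (X : σ → MvPolynomial σ ℤ)).map (Int.castRingHom ℚ) := by
      rw [PolyExpr.map_eval]; simp
    rw [h6]
    refine le_trans (Finset.sup_mono (support_map_subset _ _)) (PolyExpr.totalDegree_eval_le e)
  · rw [← hmapQ]; exact hsq

/-! ### The Bezout determinant -/

/-- The Bezout matrix of the polynomials `∑ uᵢ * Xⁱ` and `∑ vᵢ * Xⁱ` of degree at most `5`. -/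
def bezoutMatrix {A : Type*} [Add A] [Mul A] [Sub A] (u v : Fin 6 → A) : Fin 5 → Fin 5 → A :=
  let b : Fin 6 → Fin 6 → A := fun i j => u i * v j - u j * v i
  ![![b 1 0, b 2 0, b 3 0, b 4 0, b 5 0],
    ![b 2 0, b 3 0 + b 2 1, b 4 0 + b 3 1, b 5 0 + b 4 1, b 5 1],
    ![b 3 0, b 4 0 + b 3 1, b 5 0 + b 4 1 + b 3 2, b 5 1 + b 4 2, b 5 2],
    ![b 4 0, b 5 0 + b 4 1, b 5 1 + b 4 2, b 5 2 + b 4 3, b 5 3],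
    ![b 5 0, b 5 1, b 5 2, b 5 3, b 5 4]]

section

variable {A : Type*} [Add A] [Mul A] [Sub A] [IntCast A]

/-- The coefficients of a combination of the two equations for a coalescing solution that is free
of the lowest of their powers of `r`; see `firstCombination_mul`. -/
def firstCombination (α κ g h : A) : Fin 6 → A :=
  ![(-3 : ℤ) * (α * α), (-3 : ℤ) * (α * (α * κ + (1 : ℤ))),
    α * α - (α * κ * (α * κ) + α * κ + (1 : ℤ)) - g + α * α * h, (0 : ℤ),
    (-3 : ℤ) * (α * κ), (-1 : ℤ) * (κ * (α * κ + (1 : ℤ)))]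

/-- The coefficients of a combination of the two equations for a coalescing solution that is free
of the highest of their powers of `r`; see `secondCombination_mul`. -/
def secondCombination (α κ g h : A) : Fin 6 → A :=
  ![α * (α * κ + (1 : ℤ)), (3 : ℤ) * (α * κ), (0 : ℤ),
    α * κ * (α * κ) + α * κ + (1 : ℤ) - κ * κ - g * (κ * κ) + h,
    (3 : ℤ) * (κ * (α * κ + (1 : ℤ))), (3 : ℤ) * (κ * κ)]

end

namespace PolyExpr

variable {σ : Type}

/-- The determinant of a matrix of expressions, expanded along the first rows. -/
def det : (n : ℕ) → (Fin n → Fin n → PolyExpr σ) → PolyExpr σ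
  | 0, _ => 1
  | n + 1, M => (List.ofFn fun j : Fin (n + 1) => (((-1) ^ (j : ℕ) : ℤ) : PolyExpr σ) *
      (M 0 j * det n fun i k => M i.succ (j.succAbove k))).foldr (· + ·) 0

lemma eval_det {A : Type*} [CommRing A] (ρ : σ → A) (n : ℕ) (M : Fin n → Fin n → PolyExpr σ) :
    (det n M).eval ρ = Matrix.det (Matrix.of fun i j => (M i j).eval ρ) := by
  induction n with
  | zero => simp [det]
  | succ n ih =>
    have hsum : ∀ l : List (PolyExpr σ),
        (l.foldr (· + ·) 0).eval ρ = (l.map fun e => e.eval ρ).sum := by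
      intro l
      induction l with
      | nil => simp
      | cons e l ihl => simp [ihl]
    rw [det, hsum, Matrix.det_succ_row_zero, List.map_ofFn, List.sum_ofFn]
    refine Finset.sum_congr rfl fun j _ => ?_
    simp only [Function.comp, eval_mul, eval_intCast, ih, Matrix.of_apply]
    push_cast
    rw [mul_assoc]; rfl

end PolyExpr

/-- The Bezout determinant of the two combinations is `bifurcationForm` up to a factor that does
not vanish in the situation of interest. -/
lemma det_bezoutMatrix_eq {A : Type*} [CommRing A] (α κ g h : A) :
    Matrix.det (Matrix.of (bezoutMatrix (firstCombination α κ g h) (secondCombination α κ g h))) =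
      α ^ 2 * κ ^ 2 * (1 + α * κ) ^ 4 * bifurcationForm α 1 κ g h 1 := by
  have hw : Separates (![1, 19, 361, 2527] : Fin 4 → ℕ) ![18, 18, 6, 6] := by
    intro m m' hm hm' h
    simp only [Fin.forall_fin_succ, Fin.sum_univ_succ] at hm hm' h
    funext i
    fin_cases i <;> simp at hm hm' h ⊢ <;> omega
  open PolyExpr in
  have key := eval_eq_eval_of_evalInt_eq hw (b := 64)
    (det 5 (bezoutMatrix (firstCombination (var 0) (var 1) (var 2) (var 3))
      (secondCombination (var 0) (var 1) (var 2) (var 3))))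
    (var 0 ^ 2 * var 1 ^ 2 * (1 + var 0 * var 1) ^ 4 *
      bifurcationForm (var 0) 1 (var 1) (var 2) (var 3) 1)
    (by decide +kernel) (by decide +kernel) (by decide +kernel) (by decide +kernel)
    (by decide +kernel) ![α, κ, g, h]
  rw [PolyExpr.eval_det] at key
  simp only [PolyExpr.eval_mul, PolyExpr.eval_pow, PolyExpr.eval_add, PolyExpr.eval_var,
    PolyExpr.eval_one, PolyExpr.eval_bifurcationForm] at key
  refine Eq.trans ?_ key
  congr 1
  ext i j
  fin_cases i <;> fin_cases j <;>
    simp [bezoutMatrix, firstCombination, secondCombination]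

/-- For point masses, `bifurcationForm` is divisible by `(a * c - b ^ 2) ^ 2`. -/
lemma bifurcationForm_pointMass {A : Type*} [CommRing A] (a b c y : A) :
    bifurcationForm a b c (16 * a ^ 2) (16 * b ^ 2) y =
      y * (a * c - b ^ 2) ^ 2 * pointMassForm a b c y := by
  have hw : Separates (![1, 13, 325, 4225] : Fin 4 → ℕ) ![12, 24, 12, 6] := by
    intro m m' hm hm' h
    simp only [Fin.forall_fin_succ, Fin.sum_univ_succ] at hm hm' h
    funext i
    fin_cases i <;> simp at hm hm' h ⊢ <;> omega
  open PolyExpr in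
  have key := eval_eq_eval_of_evalInt_eq hw (b := 64)
    (bifurcationForm (var 0) (var 1) (var 2) (16 * var 0 ^ 2) (16 * var 1 ^ 2) (var 3))
    (var 3 * (var 0 * var 2 - var 1 ^ 2) ^ 2 * pointMassForm (var 0) (var 1) (var 2) (var 3))
    (by decide +kernel) (by decide +kernel) (by decide +kernel) (by decide +kernel)
    (by decide +kernel) ![a, b, c, y]
  simpa using key

/-! ### The bifurcation form is homogeneous

It has degree `24` if `a`, `b`, `c` have weight `1` and `g`, `h` have weight `2`, and degree `6`
in `g`, `h`, `z`. -/

lemma ternaryForm_smul {A : Type*} [CommRing A] (t a b c : A) (m : ℕ) (ts : List (ℤ × ℕ × ℕ))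
    (h : ∀ x ∈ ts, x.2.1 + x.2.2 ≤ m) :
    ternaryForm m ts (t * a) (t * b) (t * c) = t ^ m * ternaryForm m ts a b c := by
  induction ts with
  | nil => simp [ternaryForm]
  | cons x ts ih =>
    have hx := h x (by simp)
    have ih := ih fun y hy => h y (by simp [hy])
    simp only [ternaryForm, List.foldr_cons] at ih ⊢
    rw [ih]
    have : t ^ m = t ^ x.2.1 * t ^ (m - x.2.1 - x.2.2) * t ^ x.2.2 := by
      rw [← pow_add, ← pow_add]; congr 1; omega
    rw [this, mul_pow, mul_pow, mul_pow]; ring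

lemma bifurcationTerms_bound : ∀ t ∈ bifurcationTerms, t.1 + t.2.1 ≤ 6 ∧
    ∀ x ∈ t.2.2, x.2.1 + x.2.2 ≤ 24 - 2 * (t.1 + t.2.1) := by
  decide +kernel

lemma bifurcationForm_smul {A : Type*} [CommRing A] (t a b c g h z : A) :
    bifurcationForm (t * a) (t * b) (t * c) g h z =
      t ^ 12 * bifurcationForm a b c g h (t ^ 2 * z) := by
  have H := bifurcationTerms_bound
  unfold bifurcationForm
  generalize bifurcationTerms = L at H ⊢
  induction L with
  | nil => simp [bifurcationSum]
  | cons x L ih =>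
    obtain ⟨hx, hx'⟩ := H x (by simp)
    have ih := ih fun y hy => H y (by simp [hy])
    simp only [bifurcationSum, List.foldr_cons] at ih ⊢
    rw [ih, ternaryForm_smul _ _ _ _ _ _ hx']
    have : t ^ (24 - 2 * (x.1 + x.2.1)) = t ^ 12 * (t ^ 2) ^ (6 - x.1 - x.2.1) := by
      rw [← pow_mul, ← pow_add]; congr 1; omega
    rw [this, mul_pow]; ring

lemma bifurcationForm_smul_right {A : Type*} [CommRing A] (t a b c g h z : A) :
    bifurcationForm a b c (t * g) (t * h) (t * z) = t ^ 6 * bifurcationForm a b c g h z := by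
  have H := bifurcationTerms_bound
  unfold bifurcationForm
  generalize bifurcationTerms = L at H ⊢
  induction L with
  | nil => simp [bifurcationSum]
  | cons x L ih =>
    obtain ⟨hx, -⟩ := H x (by simp)
    have ih := ih fun y hy => H y (by simp [hy])
    simp only [bifurcationSum, List.foldr_cons] at ih ⊢
    rw [ih]
    have : t ^ 6 = t ^ x.1 * t ^ x.2.1 * t ^ (6 - x.1 - x.2.1) := by
      rw [← pow_add, ← pow_add]; congr 1; omega
    rw [this, mul_pow, mul_pow, mul_pow]; ring

/-! ### Numbers of terms and squarefreeness

In each use of `card_support_eval_eq`, every weight exceeds the weighted degree in the variables of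
smaller weight, `k` bounds the weighted degree, and `2 ^ (b - 1)` bounds the coefficients. -/

section

open PolyExpr

/-- The number of terms over `ℚ` agrees with that over `ℤ`. -/
lemma card_support_eval_rat {σ : Type} (e : PolyExpr σ) :
    (e.eval (X : σ → MvPolynomial σ ℚ)).support.card =
      (e.eval (X : σ → MvPolynomial σ ℤ)).support.card := by
  have h : e.eval (X : σ → MvPolynomial σ ℚ) =
      (e.eval (X : σ → MvPolynomial σ ℤ)).map (Int.castRingHom ℚ) := by
    rw [PolyExpr.map_eval]; simp
  rw [h, support_map_of_injective _ Int.cast_injective]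

lemma separates_trivial : Separates (![27, 1, 3, 81] : Fin 4 → ℕ) ![2, 2, 2, 2] := by
  intro m m' hm hm' h
  simp only [Fin.forall_fin_succ, Fin.sum_univ_succ] at hm hm' h
  funext i
  fin_cases i <;> simp at hm hm' h ⊢ <;> omega

lemma card_support_trivial {ε₁ ε₂ : ℤ} (h₁ : ε₁ ∈ ({1, -1} : Finset ℤ))
    (h₂ : ε₂ ∈ ({1, -1} : Finset ℤ)) :
    ((trivial ε₁ ε₂).eval (X : Fin 4 → MvPolynomial (Fin 4) ℚ)).support.card = 10 := by
  simp only [Finset.mem_insert, Finset.mem_singleton] at h₁ h₂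
  rcases h₁ with rfl | rfl <;> rcases h₂ with rfl | rfl <;>
    rw [card_support_eval_rat, card_support_eval_eq separates_trivial (b := 16) (k := 244)
      _ (by decide +kernel) (by norm_num) (by decide +kernel) (by norm_num) (by decide +kernel)] <;>
    decide +kernel

lemma card_support_trivials :
    (trivials.eval (X : Fin 4 → MvPolynomial (Fin 4) ℚ)).support.card = 175 := by
  have hw : Separates (![81, 1, 9, 729] : Fin 4 → ℕ) ![8, 8, 8, 8] := by
    intro m m' hm hm' h
    simp only [Fin.forall_fin_succ, Fin.sum_univ_succ] at hm hm' h
    funext i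
    fin_cases i <;> simp at hm hm' h ⊢ <;> omega
  rw [card_support_eval_rat, card_support_eval_eq hw (b := 32) (k := 6561)
    _ (by decide +kernel) (by norm_num) (by decide +kernel) (by norm_num) (by decide +kernel)]
  decide +kernel

lemma card_support_remaining :
    (remaining.eval (X : Fin 4 → MvPolynomial (Fin 4) ℚ)).support.card = 6744 := by
  have hw : Separates (![625, 1, 25, 8125] : Fin 4 → ℕ) ![12, 24, 24, 12] := by
    intro m m' hm hm' h
    simp only [Fin.forall_fin_succ, Fin.sum_univ_succ] at hm hm' h
    funext i
    fin_cases i <;> simp at hm hm' h ⊢ <;> omega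
  rw [card_support_eval_rat, card_support_eval_eq hw (b := 56) (k := 97813)
    _ (by decide +kernel) (by norm_num) (by decide +kernel) (by norm_num) (by decide +kernel)]
  decide +kernel

lemma card_support_trivials_mul_remaining :
    ((trivials * remaining).eval (X : Fin 4 → MvPolynomial (Fin 4) ℚ)).support.card = 23288 := by
  have hw : Separates (![1089, 1, 33, 22869] : Fin 4 → ℕ) ![20, 32, 32, 20] := by
    intro m m' hm hm' h
    simp only [Fin.forall_fin_succ, Fin.sum_univ_succ] at hm hm' h
    funext i
    fin_cases i <;> simp at hm hm' h ⊢ <;> omega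
  rw [card_support_eval_rat, card_support_eval_eq hw (b := 76) (k := 457789)
    _ (by decide +kernel) (by norm_num) (by decide +kernel) (by norm_num) (by decide +kernel)]
  decide +kernel

lemma card_support_remainingPointMass :
    (remainingPointMass.eval (X : Fin 3 → MvPolynomial (Fin 3) ℚ)).support.card = 1924 := by
  have hw : Separates (![961, 1, 31] : Fin 3 → ℕ) ![10, 30, 30] := by
    intro m m' hm hm' h
    simp only [Fin.forall_fin_succ, Fin.sum_univ_succ] at hm hm' h
    funext i
    fin_cases i <;> simp at hm hm' h ⊢ <;> omega
  rw [card_support_eval_rat, card_support_eval_eq hw (b := 64) (k := 10571)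
    _ (by decide +kernel) (by norm_num) (by decide +kernel) (by norm_num) (by decide +kernel)]
  decide +kernel

/-- The product of the polynomials in `q, d, s, χ` whose vanishing makes the elimination of the
angles degenerate: the coefficients `a`, `b`, `c` of the quadratic form and `a * c ± b ^ 2`, the
parameter `q`, and the gravity coefficients `1 ± χ`, each simple factor taken once. -/
def degenerate : PolyExpr (Fin 4) :=
  var 0 * var 1 * var 2 * (2 - var 1) * (2 - var 2) * (1 + var 3) * (1 - var 3) *
    (var 1 ^ 2 * var 2 * (2 - var 2) - (2 - var 1) ^ 2) *
    (var 1 ^ 2 * var 2 * (2 - var 2) + (2 - var 1) ^ 2)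

/-- The analogue of `degenerate` for point masses. -/
def degeneratePointMass : PolyExpr (Fin 3) :=
  var 0 * var 1 * var 2 * (2 - var 1) * (2 - var 2) * (2 + var 1 * (var 2 - 1)) *
    (var 1 ^ 2 * var 2 * (2 - var 2) - (2 - var 1) ^ 2) *
    (var 1 ^ 2 * var 2 * (2 - var 2) + (2 - var 1) ^ 2)

instance fact_prime_hundred_one : Fact (Nat.Prime 101) := ⟨by norm_num⟩
instance fact_prime_hundred_three : Fact (Nat.Prime 103) := ⟨by norm_num⟩

/-- Polynomials `u`, `v` with `u * f + v * f' = 1` modulo `103`, where `f` is the restriction of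
`degenerate * (trivials * remaining)` to a line. -/
def bezoutCoefficients : List ℤ × List ℤ :=
  (
   [8, 26, 47, 64, 44, 100, 66, 89, 30, 49, 95, 77, 46, 79, 25, 25, 57, 99, 67, 62, 45, 45, 0, 47,
    79, 19, 23, 90, 1, 94, 27, 85, 9, 34, 63, 11, 34, 76, 86, 8, 50, 84, 86, 2, 31, 43, 34, 58,
    97, 52, 37, 41, 36, 86, 84, 31, 7, 31, 37, 55, 83, 16, 63, 3, 76, 59, 1, 30, 83, 47, 57, 60,
    46, 24, 23, 3, 85, 92, 46, 37, 50, 101, 43, 58, 36, 22, 20, 98, 25, 33, 61, 28, 77, 0, 25, 66,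
    53, 2],
   [11, 57, 13, 73, 36, 85, 49, 34, 25, 65, 17, 74, 32, 82, 51, 7, 11, 42, 53, 2, 32, 92, 3, 4,
    79, 17, 22, 83, 33, 12, 98, 41, 101, 74, 81, 40, 58, 102, 26, 74, 49, 38, 88, 99, 44, 4, 35,
    67, 69, 66, 20, 30, 9, 60, 99, 3, 92, 17, 28, 70, 51, 52, 49, 29, 84, 46, 92, 68, 2, 48, 92,
    31, 77, 70, 7, 96, 82, 10, 83, 34, 23, 81, 76, 75, 58, 56, 7, 70, 53, 43, 57, 56, 49, 91, 65,
    92, 4, 101, 52])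

/-- Polynomials `u`, `v` with `u * f + v * f' = 1` modulo `101`, where `f` is the restriction of
`degeneratePointMass * remainingPointMass` to a line. -/
def bezoutCoefficientsPointMass : List ℤ × List ℤ :=
  (
   [87, 50, 63, 41, 92, 47, 15, 4, 93, 48, 61, 6, 77, 31, 30, 70, 28, 14, 0, 30, 23, 98, 30, 6,
    88, 29, 37, 83, 90, 88, 74, 60, 67, 84, 88, 97, 40, 86, 24, 88, 83, 45, 92, 76, 57, 89, 9, 17,
    99, 6, 70, 38, 43, 30, 45, 1, 52, 25, 23, 40, 69, 73, 14, 44, 50, 1, 7, 57, 50, 68, 31, 86,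
    73, 40, 64, 44, 59, 90, 49, 9, 47, 91, 84, 74],
   [81, 38, 58, 69, 47, 63, 75, 34, 13, 74, 46, 72, 84, 30, 100, 58, 11, 94, 35, 59, 47, 2, 78,
    80, 94, 60, 95, 10, 47, 68, 37, 66, 40, 64, 34, 64, 61, 30, 54, 69, 32, 98, 33, 7, 44, 38, 72,
    96, 45, 47, 98, 47, 34, 93, 41, 29, 13, 13, 9, 10, 70, 83, 89, 23, 7, 42, 51, 6, 24, 38, 86,
    9, 82, 92, 57, 19, 60, 28, 7, 47, 77, 48, 47, 71, 93])

/-- Squarefreeness on the line with direction `(2, 3, 2, 1)` through `(3, 4, 0, 4)`, on which the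
restriction keeps its degree `99` and has a nonzero discriminant modulo `103`. -/
lemma squarefree_main : Squarefree
    ((degenerate * (trivials * remaining)).eval (X : Fin 4 → MvPolynomial (Fin 4) ℚ)) :=
  squarefree_eval (degenerate * (trivials * remaining)) ![3, 4, 0, 4] ![2, 3, 2, 1] 103 99 512
    bezoutCoefficients.1 bezoutCoefficients.2 (by decide +kernel) (by decide +kernel)
    (by decide +kernel)

/-- Squarefreeness on the line with direction `(3, 2, 2)` through `(4, 1, 0)`, on which the
restriction keeps its degree `85` and has a nonzero discriminant modulo `101`. -/
lemma squarefree_pointMass : Squarefree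
    ((degeneratePointMass * remainingPointMass).eval (X : Fin 3 → MvPolynomial (Fin 3) ℚ)) :=
  squarefree_eval (degeneratePointMass * remainingPointMass) ![4, 1, 0] ![3, 2, 2] 101 85 512
    bezoutCoefficientsPointMass.1 bezoutCoefficientsPointMass.2 (by decide +kernel)
    (by decide +kernel) (by decide +kernel)

end

/-! ### Dixon polynomials from divided differences -/

section Existence

variable {R : Type*} [CommRing R] {n : ℕ}

/-- The matrix of divided differences `D i j` bordered by the polynomials themselves. -/
noncomputable def borderedMatrix (F : Fin (n + 1) → MvPolynomial (Fin n) R)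
    (D : Fin n → Fin (n + 1) → MvPolynomial (Fin n ⊕ Fin n) R) :
    Matrix (Fin (n + 1)) (Fin (n + 1)) (MvPolynomial (Fin n ⊕ Fin n) R) :=
  Matrix.of (Fin.cons (fun j => dixonReplace 0 (F j)) D)

/-- `D i` is the divided difference of `f` in the `i`-th variable, with the variables before it
already replaced. -/
def IsDividedDifference (f : MvPolynomial (Fin n) R) (i : Fin n)
    (D : MvPolynomial (Fin n ⊕ Fin n) R) : Prop :=
  dixonReplace (i : ℕ) f - dixonReplace ((i : ℕ) + 1) f = (X (Sum.inl i) - X (Sum.inr i)) * D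

lemma exists_isDividedDifference (f : MvPolynomial (Fin n) R) (i : Fin n) :
    ∃ D, IsDividedDifference f i D := by
  set I : Ideal (MvPolynomial (Fin n ⊕ Fin n) R) := Ideal.span {X (Sum.inl i) - X (Sum.inr i)}
  have hX : Ideal.Quotient.mk I (X (Sum.inl i)) = Ideal.Quotient.mk I (X (Sum.inr i)) :=
    Ideal.Quotient.eq.mpr (Ideal.mem_span_singleton_self _)
  have h : Ideal.Quotient.mk I (dixonReplace (i : ℕ) f) =
      Ideal.Quotient.mk I (dixonReplace ((i : ℕ) + 1) f) := by
    have : ((Ideal.Quotient.mkₐ R I).comp (rename fun j : Fin n =>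
        if (j : ℕ) < i then Sum.inr j else Sum.inl j)) =
        (Ideal.Quotient.mkₐ R I).comp (rename fun j : Fin n =>
        if (j : ℕ) < (i : ℕ) + 1 then Sum.inr j else Sum.inl j) := by
      ext j
      simp only [AlgHom.comp_apply, rename_X, Ideal.Quotient.mkₐ_eq_mk]
      rcases lt_trichotomy (j : ℕ) i with hj | hj | hj
      · rw [if_pos hj, if_pos (by omega)]
      · rw [if_neg (by omega), if_pos (by omega)]
        rw [Fin.ext hj]; exact hX
      · rw [if_neg (by omega), if_neg (by omega)]
    exact DFunLike.congr_fun this f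
  exact Ideal.mem_span_singleton.mp (Ideal.Quotient.eq.mp h)

/-- Subtracting from each row of the cancellation matrix the preceding one leaves multiples of the
divided differences, and the factors cancel the denominator of the Dixon polynomial. -/
lemma isDixonPolynomial_of_isDividedDifference {F : Fin (n + 1) → MvPolynomial (Fin n) R}
    {D : Fin n → Fin (n + 1) → MvPolynomial (Fin n ⊕ Fin n) R}
    (hD : ∀ i j, IsDividedDifference (F j) i (D i j)) :
    IsDixonPolynomial F ((-1) ^ n * (borderedMatrix F D).det) := by
  set v : Fin (n + 1) → MvPolynomial (Fin n ⊕ Fin n) R :=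
    Fin.cons 1 fun i => -(X (Sum.inl i) - X (Sum.inr i)) with hv
  have h : (dixonCancellation F).det =
      (Matrix.of fun i j => v i * borderedMatrix F D i j).det := by
    refine Matrix.det_eq_of_forall_row_eq_smul_add_pred (fun _ => 1) (fun j => ?_) fun i j => ?_
    · simp [dixonCancellation, borderedMatrix, hv]
    · have := hD i j
      rw [IsDividedDifference] at this
      simp only [dixonCancellation, borderedMatrix, hv, Matrix.of_apply, Fin.cons_succ,
        Fin.val_succ, Fin.val_castSucc]
      linear_combination -this
  rw [IsDixonPolynomial, h, Matrix.det_mul_column, Fin.prod_univ_succ]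
  simp only [hv, Fin.cons_zero, Fin.cons_succ, one_mul, Finset.prod_neg, Finset.card_univ,
    Fintype.card_fin]
  ring

lemma exists_isDixonPolynomial (F : Fin (n + 1) → MvPolynomial (Fin n) R) :
    ∃ P, IsDixonPolynomial F P := by
  choose D hD using fun (i : Fin n) (j : Fin (n + 1)) => exists_isDividedDifference (F j) i
  exact ⟨_, isDixonPolynomial_of_isDividedDifference hD⟩

lemma prod_X_sub_X_ne_zero [IsDomain R] :
    ∏ i : Fin n, (X (Sum.inl i) - X (Sum.inr i) : MvPolynomial (Fin n ⊕ Fin n) R) ≠ 0 := by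
  rw [Finset.prod_ne_zero_iff]
  intro i _ h
  exact Sum.inl_ne_inr (X_injective (sub_eq_zero.mp h))

lemma IsDixonPolynomial.unique [IsDomain R] {F : Fin (n + 1) → MvPolynomial (Fin n) R}
    {P Q : MvPolynomial (Fin n ⊕ Fin n) R} (hP : IsDixonPolynomial F P)
    (hQ : IsDixonPolynomial F Q) : P = Q :=
  mul_right_cancel₀ prod_X_sub_X_ne_zero (hP.trans hQ.symm)

/-- Minors of a Dixon matrix that are larger than the number of its nonzero rows vanish. -/
lemma det_submatrix_dixonMatrix_eq_zero (P : MvPolynomial (Fin n ⊕ Fin n) R) {k : ℕ}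
    (hk : (P.support.image fun m => m.comapDomain Sum.inr Sum.inr_injective.injOn).card < k)
    (r c : Fin k → (Fin n →₀ ℕ)) : ((dixonMatrix P).submatrix r c).det = 0 := by
  set S := P.support.image fun m => m.comapDomain Sum.inr Sum.inr_injective.injOn with hS
  by_cases h : ∀ i, r i ∈ S
  · obtain ⟨i, -, j, -, hij, he⟩ := Finset.exists_ne_map_eq_of_card_lt_of_maps_to
      (s := Finset.univ) (t := S) (f := r) (by simpa using hk) fun i _ => h i
    exact Matrix.det_zero_of_row_eq hij (by funext l; simp [he])
  · push Not at h
    obtain ⟨i, hi⟩ := h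
    refine Matrix.det_eq_zero_of_row_eq_zero i fun j => ?_
    by_contra hne
    apply hi
    rw [hS, Finset.mem_image]
    refine ⟨Finsupp.sumElim (c j) (r i), mem_support_iff.mpr hne, ?_⟩
    ext l; simp

theorem exists_isDixonResultant [IsDomain R] (F : Fin (n + 1) → MvPolynomial (Fin n) R) :
    ∃ D, IsDixonResultant F D := by
  classical
  obtain ⟨P, hP⟩ := exists_isDixonPolynomial F
  set M := (P.support.image fun m => m.comapDomain Sum.inr Sum.inr_injective.injOn).card
  let Q : ℕ → Prop := fun k => ∃ r c : Fin k → (Fin n →₀ ℕ),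
    ((dixonMatrix P).submatrix r c).det ≠ 0
  have h0 : Q 0 := ⟨Fin.elim0, Fin.elim0, by simp⟩
  obtain ⟨r, c, hrc⟩ := Nat.findGreatest_spec (P := Q) (Nat.zero_le M) h0
  refine ⟨_, P, hP, Nat.findGreatest Q M, r, c, rfl, hrc, fun r' c' => ?_⟩
  by_contra hne
  by_cases hM : Nat.findGreatest Q M + 1 ≤ M
  · exact Nat.findGreatest_is_greatest (Nat.lt_succ_self _) hM ⟨r', c', hne⟩
  · exact hne (det_submatrix_dixonMatrix_eq_zero P (by omega) r' c')

lemma IsDixonPolynomial.map {S : Type*} [CommRing S] (φ : R →+* S)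
    {F : Fin (n + 1) → MvPolynomial (Fin n) R} {P : MvPolynomial (Fin n ⊕ Fin n) R}
    (hP : IsDixonPolynomial F P) :
    IsDixonPolynomial (fun j => (F j).map φ) (P.map φ) := by
  have h := congrArg (MvPolynomial.map φ) hP
  rw [RingHom.map_det, map_mul, map_prod] at h
  rw [IsDixonPolynomial]
  simp only [map_sub, map_X] at h
  rw [h]
  congr 1
  ext1 i j
  simp [dixonCancellation, dixonReplace, map_rename]

/-- Dixon resultants are preserved by injective base change. -/
lemma IsDixonResultant.map {S : Type*} [CommRing S] {φ : R →+* S} (hφ : Function.Injective φ)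
    {F : Fin (n + 1) → MvPolynomial (Fin n) R} {D : R} (hD : IsDixonResultant F D) :
    IsDixonResultant (fun j => (F j).map φ) (φ D) := by
  obtain ⟨P, hP, k, r, c, rfl, hne, hmin⟩ := hD
  have hmap : ∀ {k : ℕ} (r c : Fin k → (Fin n →₀ ℕ)),
      ((dixonMatrix (P.map φ)).submatrix r c).det = φ ((dixonMatrix P).submatrix r c).det := by
    intro k r c
    rw [RingHom.map_det]
    congr 1
  refine ⟨P.map φ, hP.map φ, k, r, c, (hmap r c).symm, ?_, fun r' c' => ?_⟩
  · rwa [Ne, map_eq_zero_iff φ hφ]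
  · rw [hmap, hmin, map_zero]

end Existence

/-! ### Minors of maximal rank -/

/-- If all minors of size `k + 1` vanish, every entry is determined by the rows and columns of a
nonzero minor of size `k`. -/
lemma Matrix.mul_det_submatrix_eq {R I J : Type*} [CommRing R] [IsDomain R] (A : Matrix I J R)
    {k : ℕ} {r : Fin k → I} {c : Fin k → J} (hne : (A.submatrix r c).det ≠ 0)
    (hmin : ∀ (r' : Fin (k + 1) → I) (c' : Fin (k + 1) → J), (A.submatrix r' c').det = 0)
    (i : I) (j : J) :
    A i j * (A.submatrix r c).det =
      ∑ a, ∑ b, A i (c a) * (A.submatrix r c).adjugate a b * A (r b) j := by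
  set B := A.submatrix r c with hB
  set u : Matrix Unit (Fin k) R := Matrix.of fun _ a => A i (c a)
  set w : Matrix (Fin k) Unit R := Matrix.of fun b _ => A (r b) j
  set z : Matrix Unit Unit R := Matrix.of fun _ _ => A i j
  set M := Matrix.fromBlocks B w u z with hM
  have hdet : M.det = 0 := by
    let e : Fin k ⊕ Unit ≃ Fin (k + 1) := Fintype.equivOfCardEq (by simp)
    have : M = (A.submatrix ((Sum.elim r fun _ => i) ∘ e.symm)
        ((Sum.elim c fun _ => j) ∘ e.symm)).submatrix e e := by
      ext a b
      rcases a with a | a <;> rcases b with b | b <;> simp [hM, hB, u, w, z]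
    rw [this, Matrix.det_submatrix_equiv_self, hmin]
  have hmul : M * Matrix.fromBlocks B.adjugate (-(B.adjugate * w)) 0 (B.det • 1) =
      Matrix.fromBlocks (B.det • 1) 0 (u * B.adjugate)
        (-(u * (B.adjugate * w)) + B.det • z) := by
    rw [hM, Matrix.fromBlocks_multiply]
    congr 1
    · rw [Matrix.mul_adjugate]; simp
    · rw [Matrix.mul_neg, ← Matrix.mul_assoc, Matrix.mul_adjugate]; simp
    · simp
    · simp
  have h := congrArg Matrix.det hmul
  rw [Matrix.det_mul, hdet, zero_mul, Matrix.det_fromBlocks_zero₁₂, Matrix.det_smul,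
    Matrix.det_one, mul_one, Fintype.card_fin, eq_comm, mul_eq_zero,
    or_iff_right (pow_ne_zero _ hne), Matrix.det_unique] at h
  simp only [Matrix.add_apply, Matrix.neg_apply, Matrix.smul_apply, smul_eq_mul, z,
    Matrix.of_apply] at h
  rw [mul_comm, eq_neg_of_add_eq_zero_right h, neg_neg, Matrix.mul_apply]
  refine Finset.sum_congr rfl fun a _ => ?_
  rw [Matrix.mul_apply, Finset.mul_sum]
  refine Finset.sum_congr rfl fun b _ => ?_
  simp only [u, w, Matrix.of_apply]; ring

section Evaluation

variable {R : Type*} [CommRing R] {n : ℕ}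

/-- Substitution of the point `x` for the auxiliary variables. -/
noncomputable def evalBar (x : Fin n → R) :
    MvPolynomial (Fin n ⊕ Fin n) R →ₐ[R] MvPolynomial (Fin n) R :=
  aeval (Sum.elim X fun i => C (x i))

/-- Substitution of the point `y` for the original variables. -/
noncomputable def evalPlain (y : Fin n → R) :
    MvPolynomial (Fin n ⊕ Fin n) R →ₐ[R] MvPolynomial (Fin n) R :=
  aeval (Sum.elim (fun i => C (y i)) X)

/-- Substitution of `x` for the auxiliary and of `y` for the original variables. -/
noncomputable def evalPair (x y : Fin n → R) : MvPolynomial (Fin n ⊕ Fin n) R →ₐ[R] R :=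
  aeval (Sum.elim y x)

lemma aeval_evalBar (x y : Fin n → R) (P : MvPolynomial (Fin n ⊕ Fin n) R) :
    aeval y (evalBar x P) = evalPair x y P := by
  have : (aeval y).comp (evalBar x) = evalPair x y := by
    ext i; rcases i with i | i <;> simp [evalBar, evalPair]
  exact DFunLike.congr_fun this P

lemma aeval_evalPlain (x y : Fin n → R) (P : MvPolynomial (Fin n ⊕ Fin n) R) :
    aeval x (evalPlain y P) = evalPair x y P := by
  have : (aeval x).comp (evalPlain y) = evalPair x y := by
    ext i; rcases i with i | i <;> simp [evalPlain, evalPair]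
  exact DFunLike.congr_fun this P

lemma evalBar_monomial (x : Fin n → R) (α β : Fin n →₀ ℕ) (t : R) :
    evalBar x (monomial (Finsupp.sumElim β α) t) =
      monomial β (t * α.prod fun i e => x i ^ e) := by
  rw [evalBar, aeval_monomial, Finsupp.prod_sumElim, monomial_eq, map_mul]
  simp only [Finsupp.prod, Function.comp_apply, map_prod, map_pow, Sum.elim_inl, Sum.elim_inr,
    algebraMap_eq]
  ring

lemma evalPlain_monomial (y : Fin n → R) (α β : Fin n →₀ ℕ) (t : R) :
    evalPlain y (monomial (Finsupp.sumElim β α) t) =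
      monomial α (t * β.prod fun i e => y i ^ e) := by
  rw [evalPlain, aeval_monomial, Finsupp.prod_sumElim, monomial_eq, map_mul]
  simp only [Finsupp.prod, Function.comp_apply, map_prod, map_pow, Sum.elim_inl, Sum.elim_inr,
    algebraMap_eq]
  ring

lemma evalPair_monomial (x y : Fin n → R) (α β : Fin n →₀ ℕ) (t : R) :
    evalPair x y (monomial (Finsupp.sumElim β α) t) =
      t * ((β.prod fun i e => y i ^ e) * α.prod fun i e => x i ^ e) := by
  rw [evalPair, aeval_monomial, Finsupp.prod_sumElim]
  rfl

/-- The monomial expansion of `P`, arranged along a finite block of its Dixon matrix. -/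
lemma exists_eq_sum_monomial (P : MvPolynomial (Fin n ⊕ Fin n) R) :
    ∃ A B : Finset (Fin n →₀ ℕ),
      P = ∑ α ∈ A, ∑ β ∈ B, monomial (Finsupp.sumElim β α) (dixonMatrix P α β) ∧
      (∀ α β, α ∉ A → dixonMatrix P α β = 0) ∧ ∀ α β, β ∉ B → dixonMatrix P α β = 0 := by
  classical
  let e : (Fin n ⊕ Fin n →₀ ℕ) ≃ (Fin n →₀ ℕ) × (Fin n →₀ ℕ) :=
    Finsupp.sumFinsuppEquivProdFinsupp.trans (Equiv.prodComm _ _)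
  have he : ∀ m, Finsupp.sumElim (e m).2 (e m).1 = m := by
    intro m
    ext i; rcases i with i | i <;> simp [e, Finsupp.sumFinsuppEquivProdFinsupp]
  have he' : ∀ p, e (Finsupp.sumElim p.2 p.1) = p := by
    intro p
    ext i <;> simp [e, Finsupp.sumFinsuppEquivProdFinsupp]
  have hz : ∀ p : (Fin n →₀ ℕ) × (Fin n →₀ ℕ), p ∉ P.support.map e.toEmbedding →
      dixonMatrix P p.1 p.2 = 0 := by
    intro p hp
    by_contra hne
    exact hp (Finset.mem_map.mpr ⟨Finsupp.sumElim p.2 p.1, mem_support_iff.mpr hne, he' p⟩)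
  refine ⟨(P.support.map e.toEmbedding).image Prod.fst,
    (P.support.map e.toEmbedding).image Prod.snd, ?_, fun α β hα => ?_, fun α β hβ => ?_⟩
  · rw [← Finset.sum_product',
      ← Finset.sum_subset (s₁ := P.support.map e.toEmbedding) Finset.subset_product]
    · rw [Finset.sum_map]
      conv_lhs => rw [P.as_sum]
      refine Finset.sum_congr rfl fun m _ => ?_
      simp only [Equiv.coe_toEmbedding, he]
      simp only [dixonMatrix, Matrix.of_apply, he]
    · intro p _ hp
      rw [hz p hp, monomial_zero]
  · exact hz (α, β) fun h => hα (Finset.mem_image.mpr ⟨_, h, rfl⟩)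
  · exact hz (α, β) fun h => hβ (Finset.mem_image.mpr ⟨_, h, rfl⟩)

/-- The values of a Dixon polynomial in terms of the rows and columns of a maximal minor. -/
lemma evalPair_mul_det [IsDomain R] (P : MvPolynomial (Fin n ⊕ Fin n) R) {k : ℕ}
    {r c : Fin k → (Fin n →₀ ℕ)} (hne : ((dixonMatrix P).submatrix r c).det ≠ 0)
    (hmin : ∀ r' c' : Fin (k + 1) → (Fin n →₀ ℕ), ((dixonMatrix P).submatrix r' c').det = 0)
    (x y : Fin n → R) :
    evalPair x y P * ((dixonMatrix P).submatrix r c).det =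
      ∑ a, ∑ b, (evalBar x P).coeff (c a) * ((dixonMatrix P).submatrix r c).adjugate a b *
        (evalPlain y P).coeff (r b) := by
  classical
  set M := (dixonMatrix P).submatrix r c with hM
  obtain ⟨A, B, hP, hA, hB⟩ := exists_eq_sum_monomial P
  set X' : (Fin n →₀ ℕ) → R := fun α => α.prod fun i e => x i ^ e with hX'
  set Y' : (Fin n →₀ ℕ) → R := fun β => β.prod fun i e => y i ^ e with hY'
  have hbar : ∀ β, (evalBar x P).coeff β = ∑ α ∈ A, dixonMatrix P α β * X' α := by
    intro β
    conv_lhs => rw [hP]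
    simp only [map_sum, evalBar_monomial, coeff_sum, coeff_monomial]
    refine Finset.sum_congr rfl fun α _ => ?_
    rw [Finset.sum_ite_eq']
    split_ifs with h
    · rfl
    · rw [hB α β h, zero_mul]
  have hplain : ∀ α, (evalPlain y P).coeff α = ∑ β ∈ B, dixonMatrix P α β * Y' β := by
    intro α
    conv_lhs => rw [hP]
    simp only [map_sum, evalPlain_monomial, coeff_sum, coeff_monomial]
    rw [Finset.sum_comm]
    refine Finset.sum_congr rfl fun β _ => ?_
    rw [Finset.sum_ite_eq']
    split_ifs with h
    · rfl
    · rw [hA α β h, zero_mul]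
  have hpair : evalPair x y P = ∑ α ∈ A, ∑ β ∈ B, dixonMatrix P α β * (Y' β * X' α) := by
    conv_lhs => rw [hP]
    simp only [map_sum, evalPair_monomial, hX', hY']
  have hmul := fun α β => (dixonMatrix P).mul_det_submatrix_eq hne hmin α β
  rw [← hM] at hmul
  calc evalPair x y P * M.det
      = ∑ α ∈ A, ∑ β ∈ B, (dixonMatrix P α β * M.det) * (Y' β * X' α) := by
        rw [hpair, Finset.sum_mul]
        refine Finset.sum_congr rfl fun α _ => ?_
        rw [Finset.sum_mul]
        exact Finset.sum_congr rfl fun β _ => by ring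
    _ = ∑ α ∈ A, ∑ β ∈ B, ∑ a, ∑ b, (dixonMatrix P α (c a) * X' α) * M.adjugate a b *
          (dixonMatrix P (r b) β * Y' β) := by
        refine Finset.sum_congr rfl fun α _ => Finset.sum_congr rfl fun β _ => ?_
        rw [hmul, Finset.sum_mul]
        refine Finset.sum_congr rfl fun a _ => ?_
        rw [Finset.sum_mul]
        exact Finset.sum_congr rfl fun b _ => by ring
    _ = ∑ a, ∑ b, ∑ α ∈ A, ∑ β ∈ B, (dixonMatrix P α (c a) * X' α) * M.adjugate a b *
          (dixonMatrix P (r b) β * Y' β) := by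
        have h := Finset.sum_comm (s := A ×ˢ B) (t := (Finset.univ : Finset (Fin k × Fin k)))
          (f := fun p m => (dixonMatrix P p.1 (c m.1) * X' p.1) * M.adjugate m.1 m.2 *
            (dixonMatrix P (r m.2) p.2 * Y' p.2))
        simpa only [Finset.sum_product, Fintype.sum_prod_type] using h
    _ = _ := by
        refine Finset.sum_congr rfl fun a _ => Finset.sum_congr rfl fun b _ => ?_
        rw [hbar, hplain, Finset.sum_mul, Finset.sum_mul]
        refine Finset.sum_congr rfl fun α _ => ?_
        rw [Finset.mul_sum]

end Evaluation

/-! ### Coalescing zeros and the Dixon resultant -/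

section Coalescence

variable {R : Type*} [CommRing R] {n : ℕ}

lemma evalPlain_dixonReplace_zero (y : Fin n → R) (f : MvPolynomial (Fin n) R) :
    evalPlain y (dixonReplace 0 f) = C (eval y f) := by
  have : (evalPlain y).comp (rename fun j : Fin n =>
      if (j : ℕ) < 0 then Sum.inr j else Sum.inl j) =
      (Algebra.ofId R (MvPolynomial (Fin n) R)).comp (aeval y) := by
    ext i; simp [evalPlain, Algebra.ofId_apply]
  simpa [dixonReplace, Algebra.ofId_apply, algebraMap_eq, aeval_eq_eval] using DFunLike.congr_fun this f

lemma evalBar_dixonReplace_last (x : Fin n → R) (f : MvPolynomial (Fin n) R) :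
    evalBar x (dixonReplace n f) = C (eval x f) := by
  have : (evalBar x).comp (rename fun j : Fin n =>
      if (j : ℕ) < n then Sum.inr j else Sum.inl j) =
      (Algebra.ofId R (MvPolynomial (Fin n) R)).comp (aeval x) := by
    ext i; simp [evalBar, Algebra.ofId_apply]
  simpa [dixonReplace, Algebra.ofId_apply, algebraMap_eq, aeval_eq_eval] using DFunLike.congr_fun this f

lemma evalPair_dixonReplace_zero (x y : Fin n → R) (f : MvPolynomial (Fin n) R) :
    evalPair x y (dixonReplace 0 f) = eval y f := by
  rw [← aeval_evalPlain, evalPlain_dixonReplace_zero]; simp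

lemma evalPair_dixonReplace_last (x y : Fin n → R) (f : MvPolynomial (Fin n) R) :
    evalPair x y (dixonReplace n f) = eval x f := by
  rw [← aeval_evalBar, evalBar_dixonReplace_last]; simp

lemma map_evalPlain {S : Type*} [CommRing S] (φ : R →+* S) (y : Fin n → R)
    (P : MvPolynomial (Fin n ⊕ Fin n) R) :
    (evalPlain y P).map φ = evalPlain (fun i => φ (y i)) (P.map φ) := by
  have : (MvPolynomial.map φ).comp (evalPlain y).toRingHom =
      (evalPlain fun i => φ (y i)).toRingHom.comp (MvPolynomial.map φ) := by
    refine ringHom_ext (fun r => ?_) fun i => ?_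
    · simp [evalPlain, algebraMap_eq]
    · rcases i with i | i <;> simp [evalPlain]
  exact DFunLike.congr_fun this P

variable {F : Fin (n + 1) → MvPolynomial (Fin n) R}
  {D : Fin n → Fin (n + 1) → MvPolynomial (Fin n ⊕ Fin n) R}

lemma sum_mul_dividedDifference (hD : ∀ i j, IsDividedDifference (F j) i (D i j))
    (j : Fin (n + 1)) :
    ∑ i, (X (Sum.inl i) - X (Sum.inr i)) * D i j = dixonReplace 0 (F j) - dixonReplace n (F j) := by
  rw [← Finset.sum_range_sub' (fun i => dixonReplace i (F j)) n, ← Fin.sum_univ_eq_sum_range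
    (fun i => dixonReplace i (F j) - dixonReplace (i + 1) (F j))]
  exact Finset.sum_congr rfl fun i _ => (hD i j).symm

/-- The determinant of the divided differences of all polynomials but the last. -/
noncomputable def differenceDet (D : Fin n → Fin (n + 1) → MvPolynomial (Fin n ⊕ Fin n) R) :
    MvPolynomial (Fin n ⊕ Fin n) R :=
  Matrix.det (Matrix.of fun i (j : Fin n) => D i j.castSucc)

/-- A determinant whose first row vanishes except in its last column. -/
lemma Matrix.det_cons_eq {A : Type*} [CommRing A] (v : Fin (n + 1) → A)
    (M : Fin n → Fin (n + 1) → A) (hv : ∀ j : Fin n, v j.castSucc = 0) :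
    (Matrix.of (Fin.cons v M : Fin (n + 1) → Fin (n + 1) → A)).det =
      (-1) ^ n * v (Fin.last n) * (Matrix.of fun i (j : Fin n) => M i j.castSucc).det := by
  rw [Matrix.det_succ_row_zero, Fin.sum_univ_castSucc]
  simp only [Matrix.of_apply, Fin.cons_zero, hv, mul_zero, zero_mul, Finset.sum_const_zero,
    zero_add, Fin.val_last]
  congr 2
  ext i j
  simp

/-- With a common zero of all polynomials but the last in the original variables, the border of
the matrix has only one nonzero entry. -/
lemma evalPlain_dixon {y : Fin n → R} (hy : ∀ j : Fin n, eval y (F j.castSucc) = 0) :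
    evalPlain y ((-1) ^ n * (borderedMatrix F D).det) =
      C (eval y (F (Fin.last n))) * evalPlain y (differenceDet D) := by
  have h : (evalPlain y).mapMatrix (borderedMatrix F D) =
      Matrix.of (Fin.cons (fun j => C (eval y (F j))) fun i j => evalPlain y (D i j)) := by
    ext1 i j
    refine Fin.cases ?_ (fun i => ?_) i <;>
      simp [borderedMatrix, evalPlain_dixonReplace_zero]
  rw [map_mul, AlgHom.map_det, h, Matrix.det_cons_eq _ _ (by simp [hy]), differenceDet,
    AlgHom.map_det, map_pow, map_neg, map_one, ← mul_assoc, ← mul_assoc, ← mul_pow]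
  simp only [neg_mul_neg, one_mul, one_pow]
  rfl

/-- The first row of the bordered matrix may be taken in the auxiliary variables. -/
lemma det_borderedMatrix (hD : ∀ i j, IsDividedDifference (F j) i (D i j)) :
    (borderedMatrix F D).det =
      (Matrix.of (Fin.cons (fun j => dixonReplace n (F j)) D :
        Fin (n + 1) → Fin (n + 1) → MvPolynomial (Fin n ⊕ Fin n) R)).det := by
  have h := Matrix.det_updateRow_sum (borderedMatrix F D) 0
    (Fin.cons 1 fun i => -(X (Sum.inl i) - X (Sum.inr i)))
  rw [Fin.cons_zero, one_smul] at h
  rw [← h]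
  congr 1
  ext1 i j
  refine Fin.cases ?_ (fun i => ?_) i
  · have := sum_mul_dividedDifference hD j
    simp only [Matrix.updateRow_self, Fin.sum_univ_succ, Fin.cons_zero, Fin.cons_succ,
      borderedMatrix, Matrix.of_apply, one_smul, Pi.add_apply, Finset.sum_apply, Pi.smul_apply,
      smul_eq_mul, neg_mul, Finset.sum_neg_distrib, this]
    ring
  · rw [Matrix.updateRow_ne (Fin.succ_ne_zero i)]
    simp [borderedMatrix]

/-- The analogue of `evalPlain_dixon` in the auxiliary variables. -/
lemma evalBar_dixon (hD : ∀ i j, IsDividedDifference (F j) i (D i j)) {x : Fin n → R}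
    (hx : ∀ j : Fin n, eval x (F j.castSucc) = 0) :
    evalBar x ((-1) ^ n * (borderedMatrix F D).det) =
      C (eval x (F (Fin.last n))) * evalBar x (differenceDet D) := by
  have h : (evalBar x).mapMatrix (Matrix.of (Fin.cons (fun j => dixonReplace n (F j)) D :
        Fin (n + 1) → Fin (n + 1) → MvPolynomial (Fin n ⊕ Fin n) R)) =
      Matrix.of (Fin.cons (fun j => C (eval x (F j))) fun i j => evalBar x (D i j)) := by
    ext1 i j
    refine Fin.cases ?_ (fun i => ?_) i <;>
      simp [evalBar_dixonReplace_last]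
  rw [det_borderedMatrix hD, map_mul, AlgHom.map_det, h, Matrix.det_cons_eq _ _ (by simp [hx]),
    differenceDet, AlgHom.map_det, map_pow, map_neg, map_one, ← mul_assoc, ← mul_assoc, ← mul_pow]
  simp only [neg_mul_neg, one_mul, one_pow]
  rfl

/-- At two different common zeros, the difference of the zeros is in the kernel of the matrix of
divided differences. -/
lemma evalPair_differenceDet [IsDomain R] (hD : ∀ i j, IsDividedDifference (F j) i (D i j))
    {x y : Fin n → R} (hx : ∀ j : Fin n, eval x (F j.castSucc) = 0)
    (hy : ∀ j : Fin n, eval y (F j.castSucc) = 0) (hxy : x ≠ y) :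
    evalPair x y (differenceDet D) = 0 := by
  rw [differenceDet, AlgHom.map_det, ← Matrix.exists_vecMul_eq_zero_iff]
  refine ⟨y - x, sub_ne_zero.mpr hxy.symm, ?_⟩
  funext j
  have h := congrArg (evalPair x y) (sum_mul_dividedDifference hD j.castSucc)
  rw [map_sub, evalPair_dixonReplace_zero, evalPair_dixonReplace_last, hx, hy, map_sum] at h
  simp only [map_mul, map_sub] at h
  simpa [Matrix.vecMul, dotProduct, evalPair] using h

/-- If two different common zeros of all polynomials but the last coincide in the residue field, but
the last polynomial vanishes at neither, then no Dixon resultant is a unit. The last polynomial is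
assumed to be the Jacobian determinant of the others up to a unit. -/
theorem IsDixonResultant.not_isUnit [IsDomain R] [IsLocalRing R]
    (hD : ∀ i j, IsDividedDifference (F j) i (D i j)) {u : R} (hu : IsUnit u)
    (hJ : ∀ x, (∀ j : Fin n, eval x (F j.castSucc) = 0) →
      evalPair x x (differenceDet D) = u * eval x (F (Fin.last n)))
    {x y : Fin n → R} (hx : ∀ j : Fin n, eval x (F j.castSucc) = 0)
    (hy : ∀ j : Fin n, eval y (F j.castSucc) = 0) (hxy : x ≠ y)
    (hres : ∀ i, IsLocalRing.residue R (x i) = IsLocalRing.residue R (y i))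
    (hfx : eval x (F (Fin.last n)) ≠ 0) (hfy : eval y (F (Fin.last n)) ≠ 0)
    {E : R} (hE : IsDixonResultant F E) : ¬ IsUnit E := by
  obtain ⟨P, hP, k, r, c, rfl, hne, hmin⟩ := hE
  obtain rfl := hP.unique (isDixonPolynomial_of_isDividedDifference hD)
  set P := (-1) ^ n * (borderedMatrix F D).det with hPdef
  set M := (dixonMatrix P).submatrix r c with hM
  set J := differenceDet D with hJdef
  -- `Ψ z` is the value of the maximal minor's bilinear expression at `(x, z)`, divided by the
  -- values of the last polynomial; it depends on `z` polynomially, so congruent points have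
  -- congruent values
  set Ψ : (Fin n → R) → R := fun z => ∑ a, ∑ b, (evalBar x J).coeff (c a) * M.adjugate a b *
    (evalPlain z J).coeff (r b) with hΨ
  have key : ∀ z, (∀ j : Fin n, eval z (F j.castSucc) = 0) → eval z (F (Fin.last n)) ≠ 0 →
      evalPair x z J * M.det = eval z (F (Fin.last n)) * Ψ z := by
    intro z hz hfz
    have h := evalPair_mul_det P hne hmin x z
    rw [← hM, ← aeval_evalBar, evalBar_dixon hD hx, evalPlain_dixon hz, map_mul, aeval_C,
      aeval_evalBar] at h
    apply mul_left_cancel₀ hfx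
    rw [hΨ]
    simp only [Finset.mul_sum, coeff_C_mul, Algebra.algebraMap_self_apply] at h ⊢
    rw [← mul_assoc, h]
    refine Finset.sum_congr rfl fun a _ => Finset.sum_congr rfl fun b _ => ?_
    ring
  have h1 : Ψ y = 0 := by
    have h := key y hy hfy
    rw [evalPair_differenceDet hD hx hy hxy, zero_mul] at h
    exact (mul_eq_zero.mp h.symm).resolve_left hfy
  have h2 : u * M.det = Ψ x := by
    have h := key x hx hfx
    rw [hJ x hx] at h
    exact mul_left_cancel₀ hfx (by rw [← h]; ring)
  have h3 : IsLocalRing.residue R (Ψ x) = IsLocalRing.residue R (Ψ y) := by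
    simp only [hΨ, map_sum, map_mul]
    refine Finset.sum_congr rfl fun a _ => Finset.sum_congr rfl fun b _ => ?_
    rw [← coeff_map _ (evalPlain x J), ← coeff_map _ (evalPlain y J), map_evalPlain, map_evalPlain,
      funext hres]
  intro hunit
  have h4 : IsLocalRing.residue R (u * M.det) = 0 := by rw [h2, h3, h1, map_zero]
  exact (hu.mul hunit).map (IsLocalRing.residue R) |>.ne_zero h4

end Coalescence

/-! ### The general system -/

section System

variable {R : Type*} [CommRing R]

/-- The bifurcation system with general coefficients: `α`, `β`, `κ` stand for `q * a`, `q * b`,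
`q * c`, and `γ`, `δ` for the gravity coefficients `2 * (1 + χ)`, `2 * (1 - χ)`. -/
noncomputable def generalSystem (α β κ γ δ : R) : Fin 5 → MvPolynomial (Fin 4) R :=
  ![X 0 * (C α * X 1 + C β * X 3) - C γ * X 1,
    X 2 * (C β * X 1 + C κ * X 3) - C δ * X 3,
    X 0 ^ 2 + X 1 ^ 2 - 1,
    X 2 ^ 2 + X 3 ^ 2 - 1,
    (C γ * X 0 - C α * (X 0 ^ 2 - X 1 ^ 2) + C β * X 1 * X 3) *
      (C δ * X 2 - C κ * (X 2 ^ 2 - X 3 ^ 2) + C β * X 1 * X 3) - (C β * X 0 * X 2) ^ 2]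

lemma bifurcationSystem_eq (q d s χ : R) :
    bifurcationSystem q d s χ =
      generalSystem (q * (d * s)) (q * (2 - d)) (q * (d * (2 - s))) (2 * (1 + χ)) (2 * (1 - χ)) := by
  funext i
  fin_cases i <;> simp [bifurcationSystem, generalSystem, hessianPoly] <;> ring

lemma pmmrSystem_eq_generalSystem (q d s : R) :
    pmmrSystem q d s = generalSystem (q * (2 + d * (s - 1)) * (d * s))
      (q * (2 + d * (s - 1)) * (2 - d)) (q * (2 + d * (s - 1)) * (d * (2 - s)))
      (4 * (d * s)) (4 * (2 - d)) := by
  funext i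
  fin_cases i <;> simp [pmmrSystem, generalSystem] <;> ring

lemma map_generalSystem {S : Type*} [CommRing S] (φ : R →+* S) (α β κ γ δ : R) :
    (fun j => (generalSystem α β κ γ δ j).map φ) =
      generalSystem (φ α) (φ β) (φ κ) (φ γ) (φ δ) := by
  funext i
  fin_cases i <;> simp [generalSystem]

/-- The divided differences of the first four polynomials of the system. -/
noncomputable def systemDifference (α β κ γ δ : R) :
    Fin 4 → Fin 4 → MvPolynomial (Fin 4 ⊕ Fin 4) R :=
  let x : Fin 4 → MvPolynomial (Fin 4 ⊕ Fin 4) R := fun i => X (Sum.inl i)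
  let y : Fin 4 → MvPolynomial (Fin 4 ⊕ Fin 4) R := fun i => X (Sum.inr i)
  ![![C α * x 1 + C β * x 3, 0, x 0 + y 0, 0],
    ![C α * y 0 - C γ, C β * x 2, x 1 + y 1, 0],
    ![0, C β * y 1 + C κ * x 3, 0, x 2 + y 2],
    ![C β * y 0, C κ * y 2 - C δ, 0, x 3 + y 3]]

lemma isDividedDifference_systemDifference (α β κ γ δ : R) (i j : Fin 4) :
    IsDividedDifference (generalSystem α β κ γ δ j.castSucc) i
      (systemDifference α β κ γ δ i j) := by
  fin_cases i <;> fin_cases j <;>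
    simp [IsDividedDifference, dixonReplace, generalSystem, systemDifference] <;> ring

/-- The Hessian determinant is, up to a constant, the Jacobian determinant of the equilibrium
conditions and the Pythagorean identities. -/
lemma evalPair_det_systemDifference (α β κ γ δ : R) (x : Fin 4 → R) :
    evalPair x x (Matrix.det (Matrix.of (systemDifference α β κ γ δ))) =
      -4 * eval x (generalSystem α β κ γ δ 4) := by
  rw [AlgHom.map_det, Matrix.det_succ_row_zero]
  simp [Fin.sum_univ_succ, Matrix.det_fin_three, systemDifference, generalSystem, evalPair,
    Fin.succAbove]
  ring

/-- The coalescence principle for two equilibria with nonzero Hessian determinant. -/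
theorem IsDixonResultant.not_isUnit_of_generalSystem [IsDomain R] [IsLocalRing R]
    (h2 : IsUnit (2 : R)) {α β κ γ δ : R} {x y : Fin 4 → R}
    (hx : ∀ j : Fin 4, eval x (generalSystem α β κ γ δ j.castSucc) = 0)
    (hy : ∀ j : Fin 4, eval y (generalSystem α β κ γ δ j.castSucc) = 0) (hxy : x ≠ y)
    (hres : ∀ i, IsLocalRing.residue R (x i) = IsLocalRing.residue R (y i))
    (hfx : eval x (generalSystem α β κ γ δ 4) ≠ 0) (hfy : eval y (generalSystem α β κ γ δ 4) ≠ 0)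
    {E : R} (hE : IsDixonResultant (generalSystem α β κ γ δ) E) : ¬ IsUnit E := by
  choose D4 hD4 using exists_isDividedDifference (generalSystem α β κ γ δ 4)
  have hD : ∀ i j, IsDividedDifference (generalSystem α β κ γ δ j) i
      ((Fin.snoc (systemDifference α β κ γ δ i) (D4 i) : Fin 5 → _) j) := by
    intro i j
    refine Fin.lastCases ?_ (fun j => ?_) j
    · rw [Fin.snoc_last]; exact hD4 i
    · rw [Fin.snoc_castSucc]; exact isDividedDifference_systemDifference α β κ γ δ i j
  have h4 : IsUnit (-4 : R) := by
    rw [show (-4 : R) = -(2 * 2) by norm_num]; exact (h2.mul h2).neg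
  refine IsDixonResultant.not_isUnit hD h4 (fun z _ => ?_) hx hy hxy hres hfx hfy hE
  have : differenceDet (fun i => (Fin.snoc (systemDifference α β κ γ δ i) (D4 i) : Fin 5 → _)) =
      Matrix.det (Matrix.of (systemDifference α β κ γ δ)) := by
    simp only [differenceDet, Fin.snoc_castSucc]
  rw [this]
  exact evalPair_det_systemDifference α β κ γ δ z

end System

/-! ### Lifting roots from the residue field -/

section Roots

open Polynomial

/-- Every monic polynomial that is not constant has a root. -/
class HasMonicRoots (O : Type*) [CommRing O] : Prop where
  exists_root : ∀ f : O[X], f.Monic → f.natDegree ≠ 0 → ∃ r, f.IsRoot r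

variable {O : Type*} [CommRing O] [IsLocalRing O] [HasMonicRoots O]

/-- Roots modulo the maximal ideal lift to roots. -/
lemma Polynomial.Monic.exists_isRoot_residue_eq {f : O[X]} (hf : f.Monic) {ρ : O}
    (h : IsLocalRing.residue O (f.eval ρ) = 0) :
    ∃ r, f.IsRoot r ∧ IsLocalRing.residue O r = IsLocalRing.residue O ρ := by
  obtain ⟨n, hn⟩ : ∃ n, f.natDegree = n := ⟨_, rfl⟩
  induction n generalizing f with
  | zero =>
    rw [hf.natDegree_eq_zero.mp hn] at h
    simp at h
  | succ n ih =>
    obtain ⟨r, hr⟩ := HasMonicRoots.exists_root f hf (by omega)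
    obtain ⟨g, rfl⟩ := dvd_iff_isRoot.mpr hr
    have hg : g.Monic := (monic_X_sub_C r).of_mul_monic_left hf
    rw [eval_mul, map_mul, mul_eq_zero] at h
    rcases h with h | h
    · refine ⟨r, hr, ?_⟩
      exact (by simpa [sub_eq_zero] using h : _ = _).symm
    · obtain ⟨t, ht, hρ⟩ := ih hg h (by
        rw [(monic_X_sub_C r).natDegree_mul hg, natDegree_X_sub_C] at hn; omega)
      exact ⟨t, by simp [ht.eq_zero], hρ⟩

/-- A double root modulo the maximal ideal lifts to two roots, or to a double root. -/
lemma Polynomial.Monic.exists_isRoot_pair {f : O[X]} (hf : f.Monic) {ρ : O}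
    (h : IsLocalRing.residue O (f.eval ρ) = 0)
    (h' : IsLocalRing.residue O (f.derivative.eval ρ) = 0) :
    ∃ r t, f.IsRoot r ∧ f.IsRoot t ∧ IsLocalRing.residue O r = IsLocalRing.residue O ρ ∧
      IsLocalRing.residue O t = IsLocalRing.residue O ρ ∧ (r = t → f.derivative.IsRoot r) := by
  obtain ⟨r, hr, hρ⟩ := hf.exists_isRoot_residue_eq h
  obtain ⟨g, rfl⟩ := dvd_iff_isRoot.mpr hr
  have hg : g.Monic := (monic_X_sub_C r).of_mul_monic_left hf
  have hgρ : IsLocalRing.residue O (g.eval ρ) = 0 := by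
    simpa [derivative_mul, hρ] using h'
  obtain ⟨t, ht, htρ⟩ := hg.exists_isRoot_residue_eq hgρ
  refine ⟨r, t, hr, by simp [ht.eq_zero], hρ, htρ, ?_⟩
  rintro rfl
  simp [derivative_mul, ht.eq_zero]

instance isAlgClosed_residueField : IsAlgClosed (IsLocalRing.ResidueField O) := by
  refine IsAlgClosed.of_exists_root _ fun p hp hirr => ?_
  obtain ⟨q, hq, hdeg, hmon⟩ :=
    lifts_and_natDegree_eq_and_monic (f := IsLocalRing.residue O)
      (by rw [mem_lifts]; exact map_surjective _ IsLocalRing.residue_surjective p) hp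
  obtain ⟨r, hr⟩ := HasMonicRoots.exists_root q hmon (by
    rw [hdeg]; exact hirr.natDegree_pos.ne')
  refine ⟨IsLocalRing.residue O r, ?_⟩
  rw [← hq, Polynomial.eval_map, Polynomial.eval₂_hom, hr.eq_zero, map_zero]

lemma exists_sq_eq (a : O) : ∃ s, s ^ 2 = a := by
  nontriviality O
  obtain ⟨s, hs⟩ := HasMonicRoots.exists_root (Polynomial.X ^ 2 - Polynomial.C a) (monic_X_pow_sub_C a two_ne_zero)
    (by rw [natDegree_X_pow_sub_C]; norm_num)
  exact ⟨s, by simpa [sub_eq_zero] using hs.eq_zero⟩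

/-- Square roots of elements that agree in the residue field may be chosen to agree there. -/
lemma exists_sq_eq_residue_eq {a s : O}
    (h : IsLocalRing.residue O a = IsLocalRing.residue O s ^ 2) :
    ∃ t, t ^ 2 = a ∧ IsLocalRing.residue O t = IsLocalRing.residue O s := by
  obtain ⟨t, ht⟩ := exists_sq_eq a
  rw [← ht, map_pow, sq_eq_sq_iff_eq_or_eq_neg] at h
  rcases h with h | h
  · exact ⟨t, ht, h⟩
  · exact ⟨-t, by rw [neg_sq, ht], by rw [map_neg, h, neg_neg]⟩

end Roots

/-! ### Common roots and the Bezout determinant -/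

section Bezout

/-- The polynomial `∑ uᵢ * xⁱ` of degree at most `5`. -/
def quintic {A : Type*} [CommRing A] (u : Fin 6 → A) (x : A) : A := ∑ i, u i * x ^ (i : ℕ)

/-- The powers of a common root form a kernel vector of the Bezout matrix. -/
lemma det_bezoutMatrix_eq_zero {A : Type*} [CommRing A] [IsDomain A] {u v : Fin 6 → A} {x : A}
    (hu : quintic u x = 0) (hv : quintic v x = 0) :
    (Matrix.of (bezoutMatrix u v)).det = 0 := by
  rw [← Matrix.exists_mulVec_eq_zero_iff]
  refine ⟨fun i => x ^ (i : ℕ), fun h => by simpa using congrFun h 0, ?_⟩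
  simp only [quintic, Fin.sum_univ_succ, Fin.sum_univ_zero] at hu hv
  funext i
  fin_cases i <;>
    simp [bezoutMatrix, Matrix.mulVec, dotProduct, Fin.sum_univ_succ] at hu hv ⊢
  · linear_combination (u 1 + u 2 * x + u 3 * x ^ 2 + u 4 * x ^ 3 + u 5 * x ^ 4) * hv -
      (v 1 + v 2 * x + v 3 * x ^ 2 + v 4 * x ^ 3 + v 5 * x ^ 4) * hu
  · linear_combination (u 2 + u 3 * x + u 4 * x ^ 2 + u 5 * x ^ 3) * hv -
      (v 2 + v 3 * x + v 4 * x ^ 2 + v 5 * x ^ 3) * hu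
  · linear_combination (u 3 + u 4 * x + u 5 * x ^ 2) * hv - (v 3 + v 4 * x + v 5 * x ^ 2) * hu
  · linear_combination (u 4 + u 5 * x) * hv - (v 4 + v 5 * x) * hu
  · linear_combination u 5 * hv - v 5 * hu

open Polynomial in
/-- Over an algebraically closed field, two polynomials with vanishing Bezout determinant, one of
them of degree exactly `5`, have a common root. -/
lemma exists_quintic_eq_zero {k : Type*} [Field k] [IsAlgClosed k] {u v : Fin 6 → k}
    (hu : u 5 ≠ 0) (hdet : (Matrix.of (bezoutMatrix u v)).det = 0) :
    ∃ x, quintic u x = 0 ∧ quintic v x = 0 := by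
  obtain ⟨w, hw, hMw⟩ := Matrix.exists_mulVec_eq_zero_iff.mpr hdet
  set f : k[X] := ∑ i, Polynomial.C (u i) * Polynomial.X ^ (i : ℕ) with hf
  set g : k[X] := ∑ i, Polynomial.C (v i) * Polynomial.X ^ (i : ℕ) with hg
  have hfe : ∀ x, f.eval x = quintic u x := fun x => by simp [hf, quintic, eval_finsetSum]
  have hge : ∀ x, g.eval x = quintic v x := fun x => by simp [hg, quintic, eval_finsetSum]
  by_contra! hno
  have hcop : IsCoprime f g := by
    rw [isCoprime_iff_aeval_ne_zero_of_isAlgClosed k k]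
    intro x
    by_contra! h
    rw [Polynomial.coe_aeval_eq_eval, hfe, hge] at h
    exact hno x h.1 h.2
  -- `Q u` is the divided difference of `f` with the powers of the second variable replaced by the
  -- entries of the kernel vector `w`; this makes `f * Q v - g * Q u` the polynomial with
  -- coefficients `-bezoutMatrix u v *ᵥ w`
  let Q : (Fin 6 → k) → k[X] := fun u =>
    Polynomial.C (w 0 * u 1 + w 1 * u 2 + w 2 * u 3 + w 3 * u 4 + w 4 * u 5) +
    Polynomial.C (w 0 * u 2 + w 1 * u 3 + w 2 * u 4 + w 3 * u 5) * Polynomial.X +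
    Polynomial.C (w 0 * u 3 + w 1 * u 4 + w 2 * u 5) * Polynomial.X ^ 2 +
    Polynomial.C (w 0 * u 4 + w 1 * u 5) * Polynomial.X ^ 3 + Polynomial.C (w 0 * u 5) * Polynomial.X ^ 4
  have hFG : f * Q v = g * Q u := by
    have h : ∀ i, (Polynomial.C ((Matrix.of (bezoutMatrix u v)).mulVec w i) : k[X]) = 0 := by
      intro i; rw [hMw]; simp
    have h0 := h 0
    have h1 := h 1
    have h2 := h 2
    have h3 := h 3
    have h4 := h 4
    simp [bezoutMatrix, Matrix.mulVec, dotProduct, Fin.sum_univ_succ] at h0 h1 h2 h3 h4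
    simp [hf, hg, Q, Fin.sum_univ_succ]
    linear_combination -h0 - Polynomial.X * h1 - Polynomial.X ^ 2 * h2 -
      Polynomial.X ^ 3 * h3 - Polynomial.X ^ 4 * h4
  have hdvd : f ∣ Q u := hcop.dvd_of_dvd_mul_left (Dvd.intro _ hFG)
  have hfdeg : f.coeff 5 = u 5 := by
    simp [hf, Polynomial.coeff_C_mul, Polynomial.coeff_X_pow, Fin.sum_univ_succ]
  have hQ : Q u = 0 := by
    refine eq_zero_of_dvd_of_natDegree_lt hdvd (lt_of_lt_of_le (b := 5) ?_ ?_)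
    · refine Nat.lt_succ_of_le ?_
      simp only [Q]
      compute_degree
    · exact le_natDegree_of_ne_zero (by rwa [hfdeg])
  have hpoly : ∀ a₀ a₁ a₂ a₃ a₄ : k, Polynomial.C a₀ + Polynomial.C a₁ * Polynomial.X +
      Polynomial.C a₂ * Polynomial.X ^ 2 + Polynomial.C a₃ * Polynomial.X ^ 3 +
      Polynomial.C a₄ * Polynomial.X ^ 4 = 0 → a₀ = 0 ∧ a₁ = 0 ∧ a₂ = 0 ∧ a₃ = 0 ∧ a₄ = 0 := by
    intro a₀ a₁ a₂ a₃ a₄ h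
    have hc : ∀ i, _ = (0 : k[X]).coeff i := fun i => congrArg (fun p => p.coeff i) h
    have c0 := hc 0
    have c1 := hc 1
    have c2 := hc 2
    have c3 := hc 3
    have c4 := hc 4
    simp [Polynomial.coeff_C, Polynomial.coeff_X, Polynomial.coeff_X_pow] at c0 c1 c2 c3 c4
    exact ⟨c0, c1, c2, c3, c4⟩
  obtain ⟨e0, e1, e2, e3, e4⟩ := hpoly _ _ _ _ _ hQ
  have w0 : w 0 = 0 := by simpa [hu] using e4
  have w1 : w 1 = 0 := by simpa [hu, w0] using e3
  have w2 : w 2 = 0 := by simpa [hu, w0, w1] using e2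
  have w3 : w 3 = 0 := by simpa [hu, w0, w1, w2] using e1
  have w4 : w 4 = 0 := by simpa [hu, w0, w1, w2, w3] using e0
  apply hw
  funext i
  fin_cases i <;> assumption

end Bezout

/-! ### The nontrivial equilibria

For `β = 1` the equilibria with `s₁ ≠ 0` are given by the ratio `r = s₂ / s₁`, a root of a sextic.
-/

section Equilibria

/-- The equation for the ratio `r = s₂ / s₁` at a nontrivial equilibrium with `β = 1`, `γ² = g` and
`δ² = h`. -/
def ratioSextic {A : Type*} [CommRing A] (α κ g h r : A) : A :=
  (r ^ 2 - 1) * (α + r) ^ 2 * (1 + κ * r) ^ 2 -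
    r ^ 2 * (g * (1 + κ * r) ^ 2 - h * (α + r) ^ 2)

/-- The derivative of `ratioSextic` with respect to `r`. -/
def ratioSexticDeriv {A : Type*} [CommRing A] (α κ g h r : A) : A :=
  2 * r * (α + r) ^ 2 * (1 + κ * r) ^ 2 + 2 * (r ^ 2 - 1) * (α + r) * (1 + κ * r) ^ 2 +
    2 * κ * (r ^ 2 - 1) * (α + r) ^ 2 * (1 + κ * r) -
    2 * r * (g * (1 + κ * r) ^ 2 - h * (α + r) ^ 2) -
    r ^ 2 * (2 * κ * g * (1 + κ * r) - 2 * h * (α + r))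

/-- The first equation for a double root of `ratioSextic`. -/
def coalescenceFst {A : Type*} [CommRing A] (α κ g r : A) : A :=
  (α + r) ^ 3 * (1 + κ * r ^ 3) - g * (α * κ - 1) * r ^ 3

/-- The second equation for a double root of `ratioSextic`. -/
def coalescenceSnd {A : Type*} [CommRing A] (α κ h r : A) : A :=
  (1 + κ * r) ^ 3 * (α + r ^ 3) - h * (α * κ - 1) * r ^ 3

section Identities

variable {A : Type*} [CommRing A] (α κ g h r : A)

lemma ratioSextic_mul : r * (α * κ - 1) * ratioSextic α κ g h r =
    (1 + κ * r) ^ 2 * coalescenceFst α κ g r - (α + r) ^ 2 * coalescenceSnd α κ h r := by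
  simp only [ratioSextic, coalescenceFst, coalescenceSnd]; ring

lemma ratioSexticDeriv_mul :
    r * (α * κ - 1) * (r * ratioSexticDeriv α κ g h r + ratioSextic α κ g h r) =
      2 * r * ((1 + κ * r) * κ * coalescenceFst α κ g r - (α + r) * coalescenceSnd α κ h r) +
      3 * ((1 + κ * r) ^ 2 * coalescenceFst α κ g r - (α + r) ^ 2 * coalescenceSnd α κ h r) := by
  simp only [ratioSextic, ratioSexticDeriv, coalescenceFst, coalescenceSnd]; ring

/-- The last factor on the left is the Hessian determinant at the equilibrium with ratio `r`, up
to factors that do not vanish. -/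
lemma hessianFactor_mul : r ^ 3 * (α * κ - 1) *
    ((α + r) ^ 3 * (1 + κ * r) ^ 3 + h * (α + r) ^ 3 - α * g * (1 + κ * r) ^ 3) =
      α * (1 + κ * r) ^ 3 * coalescenceFst α κ g r - (α + r) ^ 3 * coalescenceSnd α κ h r := by
  simp only [coalescenceFst, coalescenceSnd]; ring

lemma firstCombination_mul : r * (α * κ - 1) * quintic (firstCombination α κ g h) r =
    coalescenceFst α κ g r - α ^ 2 * coalescenceSnd α κ h r := by
  simp [quintic, firstCombination, Fin.sum_univ_succ, coalescenceFst, coalescenceSnd]; ring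

lemma secondCombination_mul : (α * κ - 1) * quintic (secondCombination α κ g h) r =
    κ ^ 2 * coalescenceFst α κ g r - coalescenceSnd α κ h r := by
  simp [quintic, secondCombination, Fin.sum_univ_succ, coalescenceFst, coalescenceSnd]; ring

lemma map_ratioSextic {B : Type*} [CommRing B] (φ : A →+* B) :
    φ (ratioSextic α κ g h r) = ratioSextic (φ α) (φ κ) (φ g) (φ h) (φ r) := by
  simp [ratioSextic]

lemma map_ratioSexticDeriv {B : Type*} [CommRing B] (φ : A →+* B) :
    φ (ratioSexticDeriv α κ g h r) = ratioSexticDeriv (φ α) (φ κ) (φ g) (φ h) (φ r) := by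
  simp [ratioSexticDeriv, map_ofNat φ]

lemma map_bezoutMatrix {B : Type*} [CommRing B] (φ : A →+* B) (u v : Fin 6 → A) :
    φ (Matrix.of (bezoutMatrix u v)).det =
      (Matrix.of (bezoutMatrix (fun i => φ (u i)) fun i => φ (v i))).det := by
  rw [RingHom.map_det]
  congr 1
  ext i j
  fin_cases i <;> fin_cases j <;> simp [bezoutMatrix]

lemma map_firstCombination {B : Type*} [CommRing B] (φ : A →+* B) :
    (fun i => φ (firstCombination α κ g h i)) = firstCombination (φ α) (φ κ) (φ g) (φ h) := by
  funext i
  fin_cases i <;> simp [firstCombination, map_ofNat φ]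

lemma map_secondCombination {B : Type*} [CommRing B] (φ : A →+* B) :
    (fun i => φ (secondCombination α κ g h i)) = secondCombination (φ α) (φ κ) (φ g) (φ h) := by
  funext i
  fin_cases i <;> simp [secondCombination, map_ofNat φ]

/-- The determinant that vanishes if two nontrivial equilibria coalesce. -/
def coalescenceDet : A :=
  (Matrix.of (bezoutMatrix (firstCombination α κ g h) (secondCombination α κ g h))).det

lemma map_coalescenceDet {B : Type*} [CommRing B] (φ : A →+* B) :
    φ (coalescenceDet α κ g h) = coalescenceDet (φ α) (φ κ) (φ g) (φ h) := by
  rw [coalescenceDet, map_bezoutMatrix, map_firstCombination, map_secondCombination,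
    coalescenceDet]

end Identities

section Domain

variable {A : Type*} [CommRing A] [IsDomain A] {α κ g h r : A}

/-- The two equations for a double root have no common solution unless `coalescenceDet` vanishes. -/
lemma not_coalescence (hdet : coalescenceDet α κ g h ≠ 0) (hΔ : α * κ - 1 ≠ 0) (hr : r ≠ 0)
    (h₁ : coalescenceFst α κ g r = 0) : coalescenceSnd α κ h r ≠ 0 := by
  intro h₂
  have e₁ := firstCombination_mul α κ g h r
  have e₂ := secondCombination_mul α κ g h r
  rw [h₁, h₂] at e₁ e₂
  exact hdet (det_bezoutMatrix_eq_zero (x := r) (by simpa [hr, hΔ] using e₁) (by simpa [hΔ] using e₂))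

end Domain

section Field

variable {k : Type*} [Field k] {α κ g h r : k}

lemma ratioSextic_ne (hα : α ≠ 0) (hg : g ≠ 0) (hh : h ≠ 0)
    (hΔ : α * κ - 1 ≠ 0) (hr : ratioSextic α κ g h r = 0) :
    r ≠ 0 ∧ α + r ≠ 0 ∧ 1 + κ * r ≠ 0 := by
  have h0 : r ≠ 0 := by
    rintro rfl
    simp [ratioSextic, hα] at hr
  refine ⟨h0, fun hA => ?_, fun hB => ?_⟩
  · have hB : 1 + κ * r ≠ 0 := fun hB => hΔ (by linear_combination κ * hA - hB)
    simp [ratioSextic, hA, h0, hg, hB] at hr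
  · have hA : α + r ≠ 0 := fun hA => hΔ (by linear_combination κ * hA - hB)
    simp [ratioSextic, hB, h0, hh, hA] at hr

/-- A double root of `ratioSextic` where the Bezout determinant vanishes. -/
lemma exists_ratioSextic_double [IsAlgClosed k] (hα : α ≠ 0) (hκ : κ ≠ 0) (hΔ : α * κ - 1 ≠ 0)
    (hs : 1 + α * κ ≠ 0) (hdet : coalescenceDet α κ g h = 0) :
    ∃ r, ratioSextic α κ g h r = 0 ∧ ratioSexticDeriv α κ g h r = 0 := by
  obtain ⟨r, hr₁, hr₂⟩ := exists_quintic_eq_zero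
    (u := firstCombination α κ g h) (v := secondCombination α κ g h)
    (by
      have : α * κ + 1 ≠ 0 := by rwa [add_comm]
      simp [firstCombination, hκ, this]) hdet
  have e₁ := firstCombination_mul α κ g h r
  have e₂ := secondCombination_mul α κ g h r
  rw [hr₁, mul_zero] at e₁
  rw [hr₂, mul_zero] at e₂
  have hF₁ : coalescenceFst α κ g r = 0 := by
    have : (α * κ - 1) * (1 + α * κ) * coalescenceFst α κ g r = 0 := by
      linear_combination e₁ - α ^ 2 * e₂
    simpa [hΔ, hs] using this
  have hF₂ : coalescenceSnd α κ h r = 0 := by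
    rw [hF₁] at e₂; simpa using e₂.symm
  have h0 : r ≠ 0 := by
    rintro rfl
    simp [coalescenceFst, hα] at hF₁
  have hP := ratioSextic_mul α κ g h r
  have hP' := ratioSexticDeriv_mul α κ g h r
  rw [hF₁, hF₂] at hP hP'
  have hP0 : ratioSextic α κ g h r = 0 := by simpa [h0, hΔ] using hP
  refine ⟨r, hP0, ?_⟩
  rw [hP0] at hP'
  simpa [h0, hΔ] using hP'

end Field

end Equilibria

/-! ### Coalescing equilibria -/

section Coalescing

variable {O : Type*} [CommRing O]

/-- An equilibrium with nonzero Hessian determinant. -/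
def IsRegularZero (α β κ γ δ : O) (x : Fin 4 → O) : Prop :=
  (∀ j : Fin 4, eval x (generalSystem α β κ γ δ j.castSucc) = 0) ∧
    eval x (generalSystem α β κ γ δ 4) ≠ 0

/-- Two different regular equilibria coincide in the residue field. -/
def HasCoalescence [IsLocalRing O] (α β κ γ δ : O) : Prop :=
  ∃ x y : Fin 4 → O, IsRegularZero α β κ γ δ x ∧ IsRegularZero α β κ γ δ y ∧ x ≠ y ∧
    ∀ i, IsLocalRing.residue O (x i) = IsLocalRing.residue O (y i)

/-- Parameters, with `β = 1`, that are nondegenerate in the residue field and for which the trivial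
equilibria and those given by roots of `ratioSextic` are regular over `O` itself; the Hessian
determinants may still vanish in the residue field. -/
structure IsRegularParameter (α κ γ δ : O) : Prop where
  two : IsUnit (2 : O)
  fst : IsUnit α
  snd : IsUnit κ
  gravityFst : IsUnit γ
  gravitySnd : IsUnit δ
  discr : IsUnit (α * κ - 1)
  trivial_ne : ∀ ε₁ ε₂ : O, ε₁ ^ 2 = 1 → ε₂ ^ 2 = 1 → (γ * ε₁ - α) * (δ * ε₂ - κ) - 1 ≠ 0
  det_ne : coalescenceDet α κ (γ ^ 2) (δ ^ 2) ≠ 0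

/-- The equilibrium with ratio `s₂ / s₁ = r`. If `s` vanished, a trivial equilibrium would have
Hessian determinant zero; if the Hessian determinant vanished, `r` would solve both equations for
a double root. -/
lemma isRegularZero_point [IsDomain O] {α κ γ δ : O} (hp : IsRegularParameter α κ γ δ)
    {r c e s : O} (hr : IsUnit r) (hA : IsUnit (α + r)) (hB : IsUnit (1 + κ * r))
    (hP : ratioSextic α κ (γ ^ 2) (δ ^ 2) r = 0) (hc : c * (α + r) = γ) (he : e * (1 + κ * r) = δ)
    (hs : s ^ 2 = 1 - c ^ 2) : s ≠ 0 ∧ IsRegularZero α 1 κ γ δ ![c, s, r * e, r * s] := by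
  have h4 : r ^ 2 * (1 - c ^ 2 + e ^ 2) = 1 := by
    have h : (α + r) ^ 2 * (1 + κ * r) ^ 2 * (r ^ 2 * (1 - c ^ 2 + e ^ 2)) =
        (α + r) ^ 2 * (1 + κ * r) ^ 2 * 1 := by
      rw [← hc, ← he] at hP
      simp only [ratioSextic] at hP
      linear_combination hP
    exact ((hA.pow 2).mul (hB.pow 2)).mul_left_cancel h
  have hs0 : s ≠ 0 := by
    rintro rfl
    have hc1 : c ^ 2 = 1 := by linear_combination hs
    have he1 : (r * e) ^ 2 = 1 := by linear_combination h4 + r ^ 2 * hc1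
    refine hp.trivial_ne c (r * e) hc1 he1 ?_
    rw [← hc, ← he]
    linear_combination ((α + r) * ((1 + κ * r) * e ^ 2 * r - κ)) * hc1 + (1 + κ * r) * he1
  have hW : r * (1 + κ * r) * c ^ 2 + (α + r) * e ^ 2 + (α + r) * (1 + κ * r) * s ^ 2 ≠ 0 := by
    intro hW
    have hW' : (α + r) ^ 3 * (1 + κ * r) ^ 3 + δ ^ 2 * (α + r) ^ 3 - α * γ ^ 2 * (1 + κ * r) ^ 3 =
        0 := by
      rw [hs] at hW
      rw [← hc, ← he]
      linear_combination (α + r) ^ 2 * (1 + κ * r) ^ 2 * hW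
    have e₁ := ratioSextic_mul α κ (γ ^ 2) (δ ^ 2) r
    have e₂ := hessianFactor_mul α κ (γ ^ 2) (δ ^ 2) r
    rw [hP, mul_zero] at e₁
    rw [hW', mul_zero] at e₂
    have hF₁ : coalescenceFst α κ (γ ^ 2) r = 0 := by
      have : (1 + κ * r) ^ 2 * (r * (α * κ - 1)) *
          coalescenceFst α κ (γ ^ 2) r = 0 := by
        linear_combination (α + r) * e₁ - e₂
      simpa [hB.ne_zero, hr.ne_zero, hp.discr.ne_zero] using this
    rw [hF₁] at e₁
    exact not_coalescence hp.det_ne hp.discr.ne_zero hr.ne_zero hF₁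
      (by simpa [hA.ne_zero] using e₁)
  refine ⟨hs0, fun j => ?_, ?_⟩
  · rw [← hc, ← he]
    fin_cases j <;> simp [generalSystem]
    · ring
    · ring
    · linear_combination hs
    · linear_combination h4 + r ^ 2 * hs
  · have : eval ![c, s, r * e, r * s] (generalSystem α 1 κ γ δ 4) = s ^ 2 * r *
        (r * (1 + κ * r) * c ^ 2 + (α + r) * e ^ 2 + (α + r) * (1 + κ * r) * s ^ 2) := by
      rw [← hc, ← he]
      simp [generalSystem]
      ring
    rw [this]
    exact mul_ne_zero (mul_ne_zero (pow_ne_zero _ hs0) hr.ne_zero) hW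

section Lifting

/-- A multiple of `ratioSextic` as a monic polynomial, `κ'` being the inverse of `κ`. -/
noncomputable def ratioPoly (α κ' g h : O) : Polynomial O :=
  (Polynomial.X ^ 2 - 1) * (Polynomial.X + Polynomial.C α) ^ 2 *
      (Polynomial.X + Polynomial.C κ') ^ 2 -
    Polynomial.X ^ 2 * (Polynomial.C g * (Polynomial.X + Polynomial.C κ') ^ 2 -
      Polynomial.C (κ' ^ 2 * h) * (Polynomial.X + Polynomial.C α) ^ 2)

lemma monic_ratioPoly [Nontrivial O] (α κ' g h : O) : (ratioPoly α κ' g h).Monic := by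
  unfold ratioPoly
  monicity!

lemma eval_ratioPoly {κ κ' : O} (hκ : κ * κ' = 1) (α g h r : O) :
    (ratioPoly α κ' g h).eval r = κ' ^ 2 * ratioSextic α κ g h r := by
  have e : r + κ' = κ' * (1 + κ * r) := by linear_combination -r * hκ
  simp [ratioPoly, ratioSextic, e]
  ring

lemma eval_derivative_ratioPoly {κ κ' : O} (hκ : κ * κ' = 1) (α g h r : O) :
    (ratioPoly α κ' g h).derivative.eval r = κ' ^ 2 * ratioSexticDeriv α κ g h r := by
  have e : r + κ' = κ' * (1 + κ * r) := by linear_combination -r * hκ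
  simp [ratioPoly, ratioSexticDeriv, Polynomial.derivative_pow, e]
  linear_combination -2 * κ' * (1 + κ * r) * ((r ^ 2 - 1) * (α + r) ^ 2 - r ^ 2 * g) * hκ

lemma exists_mul_eq {a : O} (ha : IsUnit a) (b : O) : ∃ c, c * a = b := by
  obtain ⟨a', h⟩ := ha.exists_left_inv
  exact ⟨b * a', by rw [mul_assoc, h, mul_one]⟩

variable [IsLocalRing O]

lemma residue_ne_zero {a : O} (ha : IsUnit a) : IsLocalRing.residue O a ≠ 0 :=
  (IsLocalRing.residue_ne_zero_iff_isUnit a).mpr ha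

lemma isUnit_of_residue_ne_zero {a : O} (ha : IsLocalRing.residue O a ≠ 0) : IsUnit a :=
  (IsLocalRing.residue_ne_zero_iff_isUnit a).mp ha

/-- Quotients of congruent elements by congruent units are congruent. -/
lemma residue_eq_of_mul_eq {a b c d : O} (hd : IsUnit d)
    (hcd : IsLocalRing.residue O c = IsLocalRing.residue O d)
    (h : IsLocalRing.residue O (a * c) = IsLocalRing.residue O (b * d)) :
    IsLocalRing.residue O a = IsLocalRing.residue O b := by
  rw [map_mul, map_mul, hcd] at h
  exact mul_right_cancel₀ (residue_ne_zero hd) h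

variable {α κ γ δ : O}

/-- The residues of `r`, `α + r` and `1 + κ * r` are nonzero at a root, so the equilibrium with
ratio `r` has coordinates in `O`. -/
lemma IsRegularParameter.isUnit_of_root (hp : IsRegularParameter α κ γ δ) {r : O}
    (hr : IsLocalRing.residue O (ratioSextic α κ (γ ^ 2) (δ ^ 2) r) = 0) :
    IsUnit r ∧ IsUnit (α + r) ∧ IsUnit (1 + κ * r) := by
  rw [map_ratioSextic] at hr
  obtain ⟨h₁, h₂, h₃⟩ := ratioSextic_ne (residue_ne_zero hp.fst)
    (residue_ne_zero (hp.gravityFst.pow 2)) (residue_ne_zero (hp.gravitySnd.pow 2))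
    (by simpa using residue_ne_zero hp.discr) hr
  exact ⟨isUnit_of_residue_ne_zero h₁, isUnit_of_residue_ne_zero (by simpa using h₂),
    isUnit_of_residue_ne_zero (by simpa using h₃)⟩

variable [IsDomain O] [HasMonicRoots O]

/-- Two congruent roots of `ratioSextic` give congruent equilibria. -/
lemma IsRegularParameter.hasCoalescence_of_roots (hp : IsRegularParameter α κ γ δ) {r t : O}
    (hr : ratioSextic α κ (γ ^ 2) (δ ^ 2) r = 0) (ht : ratioSextic α κ (γ ^ 2) (δ ^ 2) t = 0)
    (hrt : r ≠ t) (hres : IsLocalRing.residue O r = IsLocalRing.residue O t) :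
    HasCoalescence α 1 κ γ δ := by
  obtain ⟨r₀, rA, rB⟩ := hp.isUnit_of_root (r := r) (by rw [hr, map_zero])
  obtain ⟨t₀, tA, tB⟩ := hp.isUnit_of_root (r := t) (by rw [ht, map_zero])
  obtain ⟨c, hc⟩ := exists_mul_eq rA γ
  obtain ⟨c', hc'⟩ := exists_mul_eq tA γ
  obtain ⟨e, he⟩ := exists_mul_eq rB δ
  obtain ⟨e', he'⟩ := exists_mul_eq tB δ
  have hcc : IsLocalRing.residue O c = IsLocalRing.residue O c' :=
    residue_eq_of_mul_eq (c := α + r) tA (by simp [hres]) (by rw [hc, hc'])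
  have hee : IsLocalRing.residue O e = IsLocalRing.residue O e' :=
    residue_eq_of_mul_eq (c := 1 + κ * r) tB (by simp [hres]) (by rw [he, he'])
  obtain ⟨s', hs'⟩ := exists_sq_eq (1 - c' ^ 2)
  obtain ⟨s, hs, hss⟩ := exists_sq_eq_residue_eq (a := 1 - c ^ 2) (s := s')
    (by rw [← map_pow, hs']; simp [hcc])
  refine ⟨_, _, (isRegularZero_point hp r₀ rA rB hr hc he hs).2,
    (isRegularZero_point hp t₀ tA tB ht hc' he' hs').2, fun h => ?_, fun i => ?_⟩
  · have h0 : c = c' := by simpa using congrFun h 0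
    have hγ : c' ≠ 0 := by
      rintro rfl
      exact hp.gravityFst.ne_zero (by rw [← hc', zero_mul])
    rw [h0, ← hc'] at hc
    exact hrt (add_left_cancel (mul_left_cancel₀ hγ hc))
  · fin_cases i <;> simp [hcc, hee, hss, hres]

/-- A vanishing Bezout determinant makes two nontrivial equilibria coalesce. -/
theorem IsRegularParameter.hasCoalescence_of_det (hp : IsRegularParameter α κ γ δ)
    (hs : IsUnit (1 + α * κ))
    (hdet : IsLocalRing.residue O (coalescenceDet α κ (γ ^ 2) (δ ^ 2)) = 0) :
    HasCoalescence α 1 κ γ δ := by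
  rw [map_coalescenceDet] at hdet
  obtain ⟨ρ', hρ, hρ'⟩ := exists_ratioSextic_double (residue_ne_zero hp.fst)
    (residue_ne_zero hp.snd) (by simpa using residue_ne_zero hp.discr)
    (by simpa using residue_ne_zero hs) hdet
  obtain ⟨ρ, rfl⟩ := IsLocalRing.residue_surjective ρ'
  rw [← map_ratioSextic] at hρ
  rw [← map_ratioSexticDeriv] at hρ'
  obtain ⟨κ', hκ⟩ := hp.snd.exists_right_inv
  have hκ' : κ' ≠ 0 := right_ne_zero_of_mul_eq_one hκ
  obtain ⟨r, t, hr, ht, hrρ, htρ, hrt⟩ :=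
    (monic_ratioPoly α κ' (γ ^ 2) (δ ^ 2)).exists_isRoot_pair (ρ := ρ)
      (by rw [eval_ratioPoly hκ, map_mul, hρ, mul_zero])
      (by rw [eval_derivative_ratioPoly hκ, map_mul, hρ', mul_zero])
  rw [Polynomial.IsRoot, eval_ratioPoly hκ, mul_eq_zero, or_iff_right (pow_ne_zero 2 hκ')] at hr ht
  refine hp.hasCoalescence_of_roots hr ht (fun h => ?_) (hrρ.trans htρ.symm)
  have hd := hrt h
  rw [Polynomial.IsRoot, eval_derivative_ratioPoly hκ, mul_eq_zero,
    or_iff_right (pow_ne_zero 2 hκ')] at hd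
  obtain ⟨r₀, rA, rB⟩ := hp.isUnit_of_root (r := r) (by rw [hr, map_zero])
  have e₁ := ratioSextic_mul α κ (γ ^ 2) (δ ^ 2) r
  have e₂ := ratioSexticDeriv_mul α κ (γ ^ 2) (δ ^ 2) r
  rw [hr, mul_zero] at e₁
  rw [hr, hd] at e₂
  have hF₁ : coalescenceFst α κ (γ ^ 2) r = 0 := by
    have : 2 * r * (1 + κ * r) * (α * κ - 1) * coalescenceFst α κ (γ ^ 2) r = 0 := by
      linear_combination (2 * r + 3 * (α + r)) * e₁ - (α + r) * e₂
    simpa [hp.two.ne_zero, r₀.ne_zero, rB.ne_zero, hp.discr.ne_zero] using this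
  rw [hF₁] at e₁
  exact not_coalescence hp.det_ne hp.discr.ne_zero r₀.ne_zero hF₁
    (by simpa [rA.ne_zero] using e₁)

/-- A trivial equilibrium with vanishing Hessian determinant coalesces with a nontrivial one. -/
theorem IsRegularParameter.hasCoalescence_of_trivial (hp : IsRegularParameter α κ γ δ) {ε₁ ε₂ : O}
    (h₁ : ε₁ ^ 2 = 1) (h₂ : ε₂ ^ 2 = 1)
    (h : IsLocalRing.residue O ((γ * ε₁ - α) * (δ * ε₂ - κ) - 1) = 0) :
    HasCoalescence α 1 κ γ δ := by
  -- the first equilibrium condition `c₁ * (α + r) = γ` with `c₁ = ε₁` gives the ratio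
  set ρ := γ * ε₁ - α with hρ
  have hmod : IsLocalRing.residue O (1 + κ * ρ) = IsLocalRing.residue O (ρ * (δ * ε₂)) := by
    rw [← sub_eq_zero, ← map_sub, ← neg_eq_zero, ← map_neg, ← h]
    congr 1
    ring
  obtain ⟨κ', hκ⟩ := hp.snd.exists_right_inv
  have hκ' : κ' ≠ 0 := right_ne_zero_of_mul_eq_one hκ
  have hP : IsLocalRing.residue O (ratioSextic α κ (γ ^ 2) (δ ^ 2) ρ) = 0 := by
    have e : ratioSextic α κ (γ ^ 2) (δ ^ 2) ρ =
        γ ^ 2 * ((1 + κ * ρ) ^ 2 * -1 + ρ ^ 2 * δ ^ 2) := by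
      simp only [ratioSextic, hρ]
      linear_combination ((γ * ε₁ - α) ^ 2 * γ ^ 2 * (1 + κ * (γ * ε₁ - α)) ^ 2 -
        γ ^ 2 * (1 + κ * (γ * ε₁ - α)) ^ 2 + (γ * ε₁ - α) ^ 2 * δ ^ 2 * γ ^ 2) * h₁
    rw [e, map_mul, map_add, map_mul, map_pow _ (1 + κ * ρ), hmod, ← map_pow, ← map_mul,
      ← map_add, show (ρ * (δ * ε₂)) ^ 2 * -1 + ρ ^ 2 * δ ^ 2 = 0 by
        linear_combination -ρ ^ 2 * δ ^ 2 * h₂, map_zero, mul_zero]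
  obtain ⟨r, hr, hrρ⟩ :=
    (monic_ratioPoly α κ' (γ ^ 2) (δ ^ 2)).exists_isRoot_residue_eq (ρ := ρ)
      (by rw [eval_ratioPoly hκ, map_mul, hP, mul_zero])
  rw [Polynomial.IsRoot, eval_ratioPoly hκ, mul_eq_zero, or_iff_right (pow_ne_zero 2 hκ')] at hr
  obtain ⟨r₀, rA, rB⟩ := hp.isUnit_of_root (r := r) (by rw [hr, map_zero])
  obtain ⟨c, hc⟩ := exists_mul_eq rA γ
  obtain ⟨e, he⟩ := exists_mul_eq rB δ
  have hcc : IsLocalRing.residue O ε₁ = IsLocalRing.residue O c := by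
    refine residue_eq_of_mul_eq (c := γ * ε₁) rA ?_ ?_
    · rw [map_add, hrρ, hρ, ← map_add]; congr 1; ring
    · rw [hc, show ε₁ * (γ * ε₁) = γ by linear_combination γ * h₁]
  have hee : IsLocalRing.residue O ε₂ = IsLocalRing.residue O (r * e) := by
    refine residue_eq_of_mul_eq (c := r * (δ * ε₂)) rB ?_ ?_
    · simp only [map_add, map_mul, map_one, hrρ] at hmod ⊢
      exact hmod.symm
    · rw [mul_assoc r e, he, show ε₂ * (r * (δ * ε₂)) = r * δ by linear_combination r * δ * h₂]
  obtain ⟨s, hs, hss⟩ := exists_sq_eq_residue_eq (a := 1 - c ^ 2) (s := 0)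
    (by rw [map_sub, map_pow, ← hcc, ← map_pow, h₁]; simp)
  obtain ⟨hs0, hreg⟩ := isRegularZero_point hp r₀ rA rB hr hc he hs
  refine ⟨![ε₁, 0, ε₂, 0], _, ⟨fun j => ?_, ?_⟩, hreg, fun h => ?_, fun i => ?_⟩
  · fin_cases j <;> simp [generalSystem, h₁, h₂]
  · have := hp.trivial_ne ε₁ ε₂ h₁ h₂
    contrapose! this
    rw [← this]
    simp [generalSystem, h₁, h₂]
    linear_combination -ε₂ ^ 2 * h₁ - h₂
  · exact hs0 (by simpa using (congrFun h 1).symm)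
  · rw [map_mul] at hee
    fin_cases i <;> simp [hcc, hee, hss]

end Lifting

end Coalescing

/-! ### Valuation rings dominating a prime element -/

section ValuationRing

variable {R : Type*} [CommRing R]

instance ValuationSubring.hasMonicRoots {K : Type*} [Field K] [IsAlgClosed K]
    (A : ValuationSubring K) : HasMonicRoots A where
  exists_root f hf hdeg := by
    have hmap : (f.map (algebraMap A K)).degree ≠ 0 := by
      rw [hf.degree_map, Polynomial.degree_eq_natDegree hf.ne_zero]
      exact_mod_cast hdeg
    obtain ⟨z, hz⟩ := IsAlgClosed.exists_root _ hmap
    have hz' : f.eval₂ (algebraMap A K) z = 0 := by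
      rwa [Polynomial.IsRoot, Polynomial.eval_map] at hz
    obtain ⟨r, rfl⟩ := IsIntegrallyClosed.algebraMap_eq_of_integral
      (show IsIntegral A z from ⟨f, hf, hz'⟩)
    refine ⟨r, IsFractionRing.injective A K ?_⟩
    rwa [map_zero, ← Polynomial.eval₂_at_apply]

/-- The localization at a prime element is dominated by a valuation ring with an algebraically
closed field of fractions. -/
lemma Prime.exists_valuationSubring {R : Type*} [CommRing R] [IsDomain R] {p : R} (hp : Prime p) :
    ∃ (A : ValuationSubring (AlgebraicClosure (FractionRing R))) (φ : R →+* A),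
      Function.Injective φ ∧ ∀ x, IsUnit (φ x) ↔ ¬ p ∣ x := by
  set K := AlgebraicClosure (FractionRing R)
  set I : Ideal R := Ideal.span {p} with hI
  have hIp : I.IsPrime := (Ideal.span_singleton_prime hp.ne_zero).mpr hp
  have hinj : Function.Injective (algebraMap R K) := by
    rw [IsScalarTower.algebraMap_eq R (FractionRing R) K]
    exact (algebraMap (FractionRing R) K).injective.comp (IsFractionRing.injective R _)
  have hunit : ∀ y : I.primeCompl, IsUnit (algebraMap R K y) := by
    rintro ⟨y, hy⟩
    rw [isUnit_iff_ne_zero, Ne, map_eq_zero_iff _ hinj]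
    rintro rfl
    exact hy I.zero_mem
  obtain ⟨A, h, hloc⟩ := IsLocalRing.exists_factor_valuationRing
    (IsLocalization.lift (S := Localization.AtPrime I) hunit)
  refine ⟨A, (RingHom.codRestrict _ A.toSubring h).comp (algebraMap R (Localization.AtPrime I)),
    fun x y hxy => hinj ?_, fun x => ?_⟩
  · have := congrArg Subtype.val hxy
    simpa using this
  · have : IsUnit _ ↔ _ := isUnit_map_iff (RingHom.codRestrict _ A.toSubring h)
      (algebraMap R (Localization.AtPrime I) x)
    rw [← Ideal.mem_span_singleton, RingHom.comp_apply]
    exact this.trans (IsLocalization.AtPrime.isUnit_to_map_iff _ I x)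

end ValuationRing

/-! ### Prime factors of Dixon resultants -/

section Prime

lemma map_bifurcationForm {A B : Type*} [CommRing A] [CommRing B] (φ : A →+* B)
    (a b c g h z : A) :
    φ (bifurcationForm a b c g h z) = bifurcationForm (φ a) (φ b) (φ c) (φ g) (φ h) (φ z) := by
  have := PolyExpr.map_eval (ρ := ![a, b, c, g, h, z]) φ
    (bifurcationForm (.var 0) (.var 1) (.var 2) (.var 3) (.var 4) (.var 5))
  simpa using this

lemma IsRegularZero.smul {O : Type*} [CommRing O] [IsDomain O] {α β κ γ δ b : O} (hb : b ≠ 0)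
    {x : Fin 4 → O} (hx : IsRegularZero α β κ γ δ x) :
    IsRegularZero (b * α) (b * β) (b * κ) (b * γ) (b * δ) x := by
  have h₄ : eval x (generalSystem (b * α) (b * β) (b * κ) (b * γ) (b * δ) 4) =
      b ^ 2 * eval x (generalSystem α β κ γ δ 4) := by
    simp [generalSystem]; ring
  refine ⟨fun j => ?_, by rw [h₄]; exact mul_ne_zero (pow_ne_zero 2 hb) hx.2⟩
  have hj := hx.1 j
  fin_cases j <;> simp [generalSystem] at hj ⊢
  · linear_combination b * hj
  · linear_combination b * hj
  · exact hj
  · exact hj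

/-- The Hessian determinant at the trivial equilibrium `c₁ = ε₁`, `c₂ = ε₂`. -/
def trivialHessian {A : Type*} [CommRing A] (α β κ γ δ ε₁ ε₂ : A) : A :=
  (γ * ε₁ - α) * (δ * ε₂ - κ) - β ^ 2

/-- A prime that divides the Hessian determinant at a trivial equilibrium, or the eliminant of the
coalescence equations, divides every Dixon resultant. -/
theorem IsDixonResultant.prime_dvd {R : Type*} [CommRing R] [IsDomain R] {p : R} (hp : Prime p)
    {α β κ γ δ : R} (h2 : ¬ p ∣ 2) (hα : ¬ p ∣ α) (hβ : ¬ p ∣ β) (hκ : ¬ p ∣ κ) (hγ : ¬ p ∣ γ)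
    (hδ : ¬ p ∣ δ) (hΔ : ¬ p ∣ α * κ - β ^ 2) (hs : ¬ p ∣ α * κ + β ^ 2)
    (hT : ∀ ε₁ ε₂ : R, ε₁ ^ 2 = 1 → ε₂ ^ 2 = 1 → trivialHessian α β κ γ δ ε₁ ε₂ ≠ 0)
    (hG : bifurcationForm α β κ (γ ^ 2) (δ ^ 2) 1 ≠ 0)
    (hdvd : (∃ ε₁ ε₂ : R, ε₁ ^ 2 = 1 ∧ ε₂ ^ 2 = 1 ∧ p ∣ trivialHessian α β κ γ δ ε₁ ε₂) ∨
      p ∣ bifurcationForm α β κ (γ ^ 2) (δ ^ 2) 1)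
    {D : R} (hD : IsDixonResultant (generalSystem α β κ γ δ) D) : p ∣ D := by
  obtain ⟨O, φ, hφ, hunit⟩ := hp.exists_valuationSubring
  have hD' := hD.map hφ
  rw [map_generalSystem] at hD'
  have hu : ∀ {x : R}, ¬ p ∣ x → IsUnit (φ x) := fun {x} => (hunit x).mpr
  have hB := hu hβ
  obtain ⟨α', hα'⟩ := exists_mul_eq hB (φ α)
  obtain ⟨κ', hκ'⟩ := exists_mul_eq hB (φ κ)
  obtain ⟨γ', hγ'⟩ := exists_mul_eq hB (φ γ)
  obtain ⟨δ', hδ'⟩ := exists_mul_eq hB (φ δ)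
  have hform : φ (bifurcationForm α β κ (γ ^ 2) (δ ^ 2) 1) =
      φ β ^ 24 * bifurcationForm α' 1 κ' (γ' ^ 2) (δ' ^ 2) 1 := by
    have e : bifurcationForm (φ α) (φ β) (φ κ) (φ γ ^ 2) (φ δ ^ 2) (1 : O) =
        bifurcationForm (φ β * α') (φ β * 1) (φ β * κ') (φ β ^ 2 * γ' ^ 2) (φ β ^ 2 * δ' ^ 2) 1 := by
      rw [← hα', ← hκ', ← hγ', ← hδ']
      congr 1 <;> ring
    rw [map_bifurcationForm, map_pow, map_pow, map_one, e, bifurcationForm_smul,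
      bifurcationForm_smul_right]
    ring
  have hdet : coalescenceDet α' κ' (γ' ^ 2) (δ' ^ 2) = α' ^ 2 * κ' ^ 2 * (1 + α' * κ') ^ 4 *
      bifurcationForm α' 1 κ' (γ' ^ 2) (δ' ^ 2) 1 := det_bezoutMatrix_eq _ _ _ _
  have hΔ' : φ β ^ 2 * (α' * κ' - 1) = φ (α * κ - β ^ 2) := by
    rw [map_sub, map_mul, map_pow, ← hα', ← hκ']; ring
  have hs' : φ β ^ 2 * (1 + α' * κ') = φ (α * κ + β ^ 2) := by
    rw [map_add, map_mul, map_pow, ← hα', ← hκ']; ring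
  have hT' : ∀ ε₁ ε₂ : R, φ (trivialHessian α β κ γ δ ε₁ ε₂) =
      φ β ^ 2 * ((γ' * φ ε₁ - α') * (δ' * φ ε₂ - κ') - 1) := by
    intro ε₁ ε₂
    simp only [trivialHessian, map_sub, map_mul, map_pow]
    rw [← hα', ← hκ', ← hγ', ← hδ']; ring
  have u2 : IsUnit (2 : O) := by rw [← map_ofNat φ 2]; exact hu h2
  have uα : IsUnit α' := isUnit_of_mul_isUnit_left (hα' ▸ hu hα)
  have uκ : IsUnit κ' := isUnit_of_mul_isUnit_left (hκ' ▸ hu hκ)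
  have us : IsUnit (1 + α' * κ') := isUnit_of_mul_isUnit_right (hs' ▸ hu hs)
  -- a square root of one in `O` is the image of a square root of one in `R`
  have hsq : ∀ ε : O, ε ^ 2 = 1 → ∃ ε' : R, ε' ^ 2 = 1 ∧ φ ε' = ε := by
    intro ε h
    rcases sq_eq_one_iff.mp h with rfl | rfl
    · exact ⟨1, one_pow 2, map_one φ⟩
    · exact ⟨-1, by ring, by rw [map_neg, map_one]⟩
  have hpar : IsRegularParameter α' κ' γ' δ' :=
    { two := u2
      fst := uα
      snd := uκ
      gravityFst := isUnit_of_mul_isUnit_left (hγ' ▸ hu hγ)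
      gravitySnd := isUnit_of_mul_isUnit_left (hδ' ▸ hu hδ)
      discr := isUnit_of_mul_isUnit_right (hΔ' ▸ hu hΔ)
      trivial_ne := by
        intro ε₁ ε₂ h₁ h₂
        obtain ⟨ε₁, k₁, rfl⟩ := hsq ε₁ h₁
        obtain ⟨ε₂, k₂, rfl⟩ := hsq ε₂ h₂
        intro h0
        refine hT ε₁ ε₂ k₁ k₂ (hφ ?_)
        rw [hT', h0, mul_zero, map_zero]
      det_ne := by
        rw [hdet]
        refine mul_ne_zero (mul_ne_zero (mul_ne_zero (pow_ne_zero _ uα.ne_zero)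
          (pow_ne_zero _ uκ.ne_zero)) (pow_ne_zero _ us.ne_zero)) fun h0 => hG (hφ ?_)
        rw [hform, h0, mul_zero, map_zero] }
  have hres : ∀ {x y : O}, IsUnit x → ∀ {z : R}, φ z = x * y → p ∣ z →
      IsLocalRing.residue O y = 0 := by
    intro x y hx z hz hpz
    rw [IsLocalRing.residue_eq_zero_iff, IsLocalRing.mem_maximalIdeal, mem_nonunits_iff]
    exact fun hy => (hunit z).mp (hz ▸ hx.mul hy) hpz
  have hco : HasCoalescence α' 1 κ' γ' δ' := by
    rcases hdvd with ⟨ε₁, ε₂, k₁, k₂, h⟩ | h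
    · exact hpar.hasCoalescence_of_trivial (ε₁ := φ ε₁) (ε₂ := φ ε₂)
        (by rw [← map_pow, k₁, map_one]) (by rw [← map_pow, k₂, map_one])
        (hres (hB.pow 2) (hT' ε₁ ε₂) h)
    · refine hpar.hasCoalescence_of_det us ?_
      rw [hdet, map_mul, hres (hB.pow 24) hform h, mul_zero]
  obtain ⟨x, y, hx, hy, hxy, hxyres⟩ := hco
  replace hx := hx.smul hB.ne_zero
  replace hy := hy.smul hB.ne_zero
  simp only [mul_comm (φ β), hα', hκ', hγ', hδ', one_mul] at hx hy
  have hnot := hD'.not_isUnit_of_generalSystem u2 hx.1 hy.1 hxy hxyres hx.2 hy.2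
  by_contra hpD
  exact hnot (hu hpD)

end Prime

/-! ### Factors of Dixon resultants -/

section Factors

lemma Squarefree.dvd_of_forall_prime {A : Type*} [CommRing A] [IsDomain A]
    [UniqueFactorizationMonoid A] {a b : A} (ha : Squarefree a)
    (h : ∀ p, Prime p → p ∣ a → p ∣ b) : a ∣ b := by
  induction a using UniqueFactorizationMonoid.induction_on_prime with
  | h₁ => exact absurd ha not_squarefree_zero
  | h₂ x hx => exact hx.dvd
  | h₃ a p ha0 hp ih =>
    obtain ⟨c, rfl⟩ := ih (ha.squarefree_of_dvd (Dvd.intro_left p rfl))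
      fun q hq hqa => h q hq (hqa.mul_left p)
    rcases hp.dvd_or_dvd (h p hp (Dvd.intro a rfl)) with hpa | ⟨k, rfl⟩
    · exact absurd (ha p (mul_dvd_mul_left p hpa)) hp.not_isUnit
    · exact ⟨k, by ring⟩

lemma Squarefree.not_dvd_of_prime {A : Type*} [CommRing A] {a b p : A} (h : Squarefree (a * b))
    (hp : Prime p) (hb : p ∣ b) : ¬ p ∣ a := fun ha => hp.not_isUnit (h p (mul_dvd_mul ha hb))

lemma MvPolynomial.not_prime_dvd_two {σ : Type*} {p : MvPolynomial σ ℚ} (hp : Prime p) :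
    ¬ p ∣ 2 := fun h => hp.not_isUnit (isUnit_of_dvd_unit h (by
  exact map_ofNat (C : ℚ →+* MvPolynomial σ ℚ) 2 ▸ (IsUnit.mk0 (2 : ℚ) two_ne_zero).map C))

end Factors

/-! ### The general pendulum -/

section General

open PolyExpr

lemma trivialPoly_eq {ε₁ ε₂ : ℤ} (h₁ : ε₁ ∈ ({1, -1} : Finset ℤ))
    (h₂ : ε₂ ∈ ({1, -1} : Finset ℤ)) :
    trivialPoly (X 0 : MvPolynomial (Fin 4) ℚ) (X 1) (X 2) (X 3) ε₁ ε₂ =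
      (PolyExpr.trivial ε₁ ε₂).eval X := by
  simp only [Finset.mem_insert, Finset.mem_singleton] at h₁ h₂
  rcases h₁ with rfl | rfl <;> rcases h₂ with rfl | rfl <;>
    simp [trivialPoly, hessianPoly, PolyExpr.trivial] <;> ring

lemma trivialHessian_eq (ε₁ ε₂ : ℤ) :
    trivialHessian (X 0 * (X 1 * X 2)) (X 0 * (2 - X 1)) (X 0 * (X 1 * (2 - X 2)))
      (2 * (1 + X 3)) (2 * (1 - X 3)) (ε₁ : MvPolynomial (Fin 4) ℚ) (ε₂ : MvPolynomial (Fin 4) ℚ) =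
      (PolyExpr.trivial ε₁ ε₂).eval X := by
  simp [trivialHessian, PolyExpr.trivial]
  ring

lemma bifurcationForm_eq_remaining :
    bifurcationForm (X 0 * (X 1 * X 2)) (X 0 * (2 - X 1)) (X 0 * (X 1 * (2 - X 2)))
      ((2 * (1 + X 3)) ^ 2) ((2 * (1 - X 3)) ^ 2) (1 : MvPolynomial (Fin 4) ℚ) =
      X 0 ^ 12 * remaining.eval X := by
  rw [bifurcationForm_smul]
  simp [remaining, mul_pow]
  norm_num

lemma trivial_dvd_trivials {ε₁ ε₂ : ℤ} (h₁ : ε₁ ∈ ({1, -1} : Finset ℤ))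
    (h₂ : ε₂ ∈ ({1, -1} : Finset ℤ)) :
    (PolyExpr.trivial ε₁ ε₂).eval (X : Fin 4 → MvPolynomial (Fin 4) ℚ) ∣ trivials.eval X := by
  simp only [trivials, PolyExpr.eval_mul]
  simp only [Finset.mem_insert, Finset.mem_singleton] at h₁ h₂
  rcases h₁ with rfl | rfl <;> rcases h₂ with rfl | rfl
  · exact ⟨_, by rw [mul_assoc, mul_assoc]⟩
  · exact ⟨_, by rw [mul_comm (PolyExpr.eval X (PolyExpr.trivial 1 1)), mul_assoc, mul_assoc]⟩
  · exact Dvd.dvd.mul_right (Dvd.intro_left _ rfl) _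
  · exact Dvd.intro_left _ rfl

/-- The square roots of one in a polynomial ring are `1` and `-1`. -/
lemma exists_intCast_eq {σ : Type*} {ε : MvPolynomial σ ℚ} (h : ε ^ 2 = 1) :
    ∃ i ∈ ({1, -1} : Finset ℤ), (i : MvPolynomial σ ℚ) = ε := by
  rcases sq_eq_one_iff.mp h with rfl | rfl
  · exact ⟨1, by simp, by simp⟩
  · exact ⟨-1, by simp, by simp⟩

/-- Since the product with `degenerate` is squarefree, each prime factor is simple and
nondegenerate, so `IsDixonResultant.prime_dvd` applies to it. -/
theorem trivials_mul_remaining_dvd {D : MvPolynomial (Fin 4) ℚ}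
    (hD : IsDixonResultant (bifurcationSystem (X 0) (X 1) (X 2) (X 3)) D) :
    (trivials * remaining).eval X ∣ D := by
  have hS := squarefree_main
  rw [PolyExpr.eval_mul] at hS
  have hne : (trivials * remaining).eval (X : Fin 4 → MvPolynomial (Fin 4) ℚ) ≠ 0 :=
    right_ne_zero_of_mul hS.ne_zero
  rw [PolyExpr.eval_mul] at hne
  refine (hS.squarefree_of_dvd (Dvd.intro_left _ rfl)).dvd_of_forall_prime fun p hp hpd => ?_
  have hdeg := hS.not_dvd_of_prime hp hpd
  have h2 := MvPolynomial.not_prime_dvd_two hp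
  simp only [degenerate, PolyExpr.eval_mul, PolyExpr.eval_sub, PolyExpr.eval_add,
    PolyExpr.eval_pow, PolyExpr.eval_var, PolyExpr.eval_ofNat, PolyExpr.eval_one, hp.dvd_mul,
    not_or] at hdeg
  obtain ⟨⟨⟨⟨⟨⟨⟨⟨hq, hd⟩, hs⟩, hb⟩, hs'⟩, hχ⟩, hχ'⟩, hΔ⟩, hΔ'⟩ := hdeg
  have hq2 : ¬ p ∣ X 0 ^ 2 := fun h => hq (hp.dvd_of_dvd_pow h)
  rw [bifurcationSystem_eq] at hD
  refine hD.prime_dvd hp h2 ?_ ?_ ?_ ?_ ?_ ?_ ?_ ?_ ?_ ?_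
  · simp only [hp.dvd_mul, not_or]; exact ⟨hq, hd, hs⟩
  · simp only [hp.dvd_mul, not_or]; exact ⟨hq, hb⟩
  · simp only [hp.dvd_mul, not_or]; exact ⟨hq, hd, hs'⟩
  · simp only [hp.dvd_mul, not_or]; exact ⟨h2, hχ⟩
  · simp only [hp.dvd_mul, not_or]; exact ⟨h2, hχ'⟩
  · rw [show (X 0 * (X 1 * X 2)) * (X 0 * (X 1 * (2 - X 2))) - (X 0 * (2 - X 1)) ^ 2 =
      X 0 ^ 2 * (X 1 ^ 2 * X 2 * (2 - X 2) - (2 - X 1) ^ 2 : MvPolynomial (Fin 4) ℚ) by ring,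
      hp.dvd_mul, not_or]
    exact ⟨hq2, hΔ⟩
  · rw [show (X 0 * (X 1 * X 2)) * (X 0 * (X 1 * (2 - X 2))) + (X 0 * (2 - X 1)) ^ 2 =
      X 0 ^ 2 * (X 1 ^ 2 * X 2 * (2 - X 2) + (2 - X 1) ^ 2 : MvPolynomial (Fin 4) ℚ) by ring,
      hp.dvd_mul, not_or]
    exact ⟨hq2, hΔ'⟩
  · intro ε₁ ε₂ h₁ h₂
    obtain ⟨i, hi, rfl⟩ := exists_intCast_eq h₁
    obtain ⟨j, hj, rfl⟩ := exists_intCast_eq h₂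
    rw [trivialHessian_eq]
    exact ne_zero_of_dvd_ne_zero (left_ne_zero_of_mul hne) (trivial_dvd_trivials hi hj)
  · rw [bifurcationForm_eq_remaining]
    exact mul_ne_zero (pow_ne_zero _ (X_ne_zero 0)) (right_ne_zero_of_mul hne)
  · rw [PolyExpr.eval_mul, hp.dvd_mul] at hpd
    refine hpd.imp (fun h => ?_) fun h => ?_
    · simp only [trivials, PolyExpr.eval_mul, hp.dvd_mul] at h
      have key : ∀ i j : ℤ, i ^ 2 = 1 → j ^ 2 = 1 → p ∣ (PolyExpr.trivial i j).eval X →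
          ∃ ε₁ ε₂ : MvPolynomial (Fin 4) ℚ, ε₁ ^ 2 = 1 ∧ ε₂ ^ 2 = 1 ∧
            p ∣ trivialHessian (X 0 * (X 1 * X 2)) (X 0 * (2 - X 1)) (X 0 * (X 1 * (2 - X 2)))
              (2 * (1 + X 3)) (2 * (1 - X 3)) ε₁ ε₂ := by
        intro i j hi hj h
        exact ⟨i, j, by exact_mod_cast hi, by exact_mod_cast hj, by rwa [trivialHessian_eq]⟩
      rcases h with ((h | h) | h) | h
      · exact key 1 1 (by norm_num) (by norm_num) h
      · exact key 1 (-1) (by norm_num) (by norm_num) h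
      · exact key (-1) 1 (by norm_num) (by norm_num) h
      · exact key (-1) (-1) (by norm_num) (by norm_num) h
    · rw [bifurcationForm_eq_remaining]
      exact h.mul_left _

/-- Otherwise the squarefree polynomial of `squarefree_main` would be divisible by a square. -/
lemma not_trivial_dvd_remaining {ε₁ ε₂ : ℤ} (h₁ : ε₁ ∈ ({1, -1} : Finset ℤ))
    (h₂ : ε₂ ∈ ({1, -1} : Finset ℤ)) :
    ¬ (PolyExpr.trivial ε₁ ε₂).eval (X : Fin 4 → MvPolynomial (Fin 4) ℚ) ∣ remaining.eval X := by
  intro h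
  have hS := squarefree_main
  rw [PolyExpr.eval_mul, PolyExpr.eval_mul] at hS
  have hu := hS _ ((mul_dvd_mul (trivial_dvd_trivials h₁ h₂) h).mul_left _)
  rw [isUnit_iff_eq_C_of_isReduced] at hu
  obtain ⟨r, -, he⟩ := hu
  have hc := card_support_trivial h₁ h₂
  have hle : (C r : MvPolynomial (Fin 4) ℚ).support.card ≤ 1 :=
    Finset.card_le_card support_monomial_subset
  rw [he] at hc
  omega

lemma vars_remaining : (remaining.eval (X : Fin 4 → MvPolynomial (Fin 4) ℚ)).vars = Finset.univ := by
  rw [Finset.eq_univ_iff_forall]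
  intro i
  by_contra hi
  have key : ∀ x y : Fin 4 → ℤ, (∀ j, j ≠ i → x j = y j) →
      remaining.evalInt x = remaining.evalInt y := by
    intro x y hxy
    have hev : ∀ z : Fin 4 → ℤ, ((remaining.evalInt z : ℤ) : ℚ) =
        eval (fun j => (z j : ℚ)) (remaining.eval (X : Fin 4 → MvPolynomial (Fin 4) ℚ)) := by
      intro z
      rw [evalInt_eq, PolyExpr.map_eval]
      simpa using PolyExpr.map_eval (ρ := z) (Int.castRingHom ℚ) remaining
    have : ((remaining.evalInt x : ℤ) : ℚ) = remaining.evalInt y := by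
      rw [hev, hev]
      refine eval₂Hom_congr' rfl (fun j hj _ => ?_) rfl
      rw [hxy j (by rintro rfl; exact hi hj)]
    exact_mod_cast this
  -- the value at one point changes with each of its coordinates
  have hcheck : ∀ i : Fin 4, remaining.evalInt (Function.update ![1, 1, 1, 3] i 5) ≠
      remaining.evalInt ![1, 1, 1, 3] := by
    decide +kernel
  exact hcheck i (key _ _ fun j hj => Function.update_of_ne hj _ _)

end General

/-! ### Point masses on massless rods -/

section PointMass

open PolyExpr

lemma bifurcationForm_pointMass_smul {A : Type*} [CommRing A] (t a b c : A) :
    bifurcationForm (t * a) (t * b) (t * c) ((4 * a) ^ 2) ((4 * b) ^ 2) 1 =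
      t ^ 14 * (a * c - b ^ 2) ^ 2 * pointMassForm a b c (t ^ 2) := by
  rw [bifurcationForm_smul, mul_one, show (4 * a) ^ 2 = 16 * a ^ 2 by ring,
    show (4 * b) ^ 2 = 16 * b ^ 2 by ring, bifurcationForm_pointMass]
  ring

lemma remainingPointMass_eval {A : Type*} [CommRing A] (ρ : Fin 3 → A) :
    remainingPointMass.eval ρ = pointMassForm (ρ 1 * ρ 2) (2 - ρ 1) (ρ 1 * (2 - ρ 2))
      ((ρ 0 * (2 + ρ 1 * (ρ 2 - 1))) ^ 2) := by
  simp [remainingPointMass, mul_pow]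

lemma degeneratePointMass_eval {A : Type*} [CommRing A] (ρ : Fin 3 → A) :
    degeneratePointMass.eval ρ = ρ 0 * ρ 1 * ρ 2 * (2 - ρ 1) * (2 - ρ 2) *
      (2 + ρ 1 * (ρ 2 - 1)) * (ρ 1 ^ 2 * ρ 2 * (2 - ρ 2) - (2 - ρ 1) ^ 2) *
      (ρ 1 ^ 2 * ρ 2 * (2 - ρ 2) + (2 - ρ 1) ^ 2) := by
  simp [degeneratePointMass]

/-- The analogue of `trivials_mul_remaining_dvd`: each prime factor is simple and nondegenerate. -/
theorem remainingPointMass_dvd {D : MvPolynomial (Fin 3) ℚ}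
    (hD : IsDixonResultant (pmmrSystem (X 0) (X 1) (X 2)) D) :
    remainingPointMass.eval X ∣ D := by
  have hS := squarefree_pointMass
  rw [PolyExpr.eval_mul] at hS
  have hne := hS.ne_zero
  refine (hS.squarefree_of_dvd (Dvd.intro_left _ rfl)).dvd_of_forall_prime fun p hp hpd => ?_
  have hdeg := hS.not_dvd_of_prime hp hpd
  have h2 := MvPolynomial.not_prime_dvd_two hp
  have h4 : ¬ p ∣ 4 := by
    rw [show (4 : MvPolynomial (Fin 3) ℚ) = 2 * 2 by norm_num, hp.dvd_mul, or_self]; exact h2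
  simp only [degeneratePointMass_eval, hp.dvd_mul, not_or] at hdeg
  obtain ⟨⟨⟨⟨⟨⟨⟨hq, hd⟩, hs⟩, hb⟩, hs'⟩, he⟩, hΔ⟩, hΔ'⟩ := hdeg
  simp only [degeneratePointMass_eval, mul_ne_zero_iff] at hne
  obtain ⟨⟨⟨⟨⟨⟨⟨⟨nq, nd⟩, ns⟩, nb⟩, ns'⟩, ne⟩, nΔ⟩, nΔ'⟩, nN⟩ := hne
  set e : MvPolynomial (Fin 3) ℚ := 2 + X 1 * (X 2 - 1) with hedef
  have hqe : ¬ p ∣ (X 0 * e) ^ 2 := fun h => by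
    rcases hp.dvd_or_dvd (hp.dvd_of_dvd_pow h) with h | h
    · exact hq h
    · exact he h
  have hform : bifurcationForm (X 0 * e * (X 1 * X 2)) (X 0 * e * (2 - X 1))
      (X 0 * e * (X 1 * (2 - X 2))) ((4 * (X 1 * X 2)) ^ 2) ((4 * (2 - X 1)) ^ 2)
      (1 : MvPolynomial (Fin 3) ℚ) = (X 0 * e) ^ 14 *
        (X 1 ^ 2 * X 2 * (2 - X 2) - (2 - X 1) ^ 2) ^ 2 * remainingPointMass.eval X := by
    rw [bifurcationForm_pointMass_smul, remainingPointMass_eval, ← hedef,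
      show X 1 * X 2 * (X 1 * (2 - X 2)) - (2 - X 1) ^ 2 =
        (X 1 ^ 2 * X 2 * (2 - X 2) - (2 - X 1) ^ 2 : MvPolynomial (Fin 3) ℚ) by ring]
  rw [pmmrSystem_eq_generalSystem] at hD
  refine hD.prime_dvd hp h2 ?_ ?_ ?_ ?_ ?_ ?_ ?_ ?_ ?_ (.inr ?_)
  · simp only [hp.dvd_mul, not_or]; exact ⟨⟨hq, he⟩, hd, hs⟩
  · simp only [hp.dvd_mul, not_or]; exact ⟨⟨hq, he⟩, hb⟩
  · simp only [hp.dvd_mul, not_or]; exact ⟨⟨hq, he⟩, hd, hs'⟩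
  · simp only [hp.dvd_mul, not_or]; exact ⟨h4, hd, hs⟩
  · simp only [hp.dvd_mul, not_or]; exact ⟨h4, hb⟩
  · rw [show X 0 * e * (X 1 * X 2) * (X 0 * e * (X 1 * (2 - X 2))) - (X 0 * e * (2 - X 1)) ^ 2 =
      (X 0 * e) ^ 2 * (X 1 ^ 2 * X 2 * (2 - X 2) - (2 - X 1) ^ 2) by ring, hp.dvd_mul, not_or]
    exact ⟨hqe, hΔ⟩
  · rw [show X 0 * e * (X 1 * X 2) * (X 0 * e * (X 1 * (2 - X 2))) + (X 0 * e * (2 - X 1)) ^ 2 =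
      (X 0 * e) ^ 2 * (X 1 ^ 2 * X 2 * (2 - X 2) + (2 - X 1) ^ 2) by ring, hp.dvd_mul, not_or]
    exact ⟨hqe, hΔ'⟩
  · intro ε₁ ε₂ _ _ h0
    -- at `q = d = 1`, `s = 0` the coefficients `α` and `γ` vanish and `β = 1`
    have := congrArg (MvPolynomial.eval (![1, 1, 0] : Fin 3 → ℚ)) h0
    simp [trivialHessian] at this
    norm_num at this
  · rw [hform]
    exact mul_ne_zero (mul_ne_zero (pow_ne_zero _ (mul_ne_zero nq ne)) (pow_ne_zero _ nΔ)) nN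
  · rw [hform]
    exact hpd.mul_left _

/-- A degenerate factor that vanishes at `(0, 2, 0)`, and so is not constant, is no factor of a
polynomial whose product with all degenerate ones is squarefree. -/
lemma not_dvd_remainingPointMass {f : MvPolynomial (Fin 3) ℚ}
    (hf : f ∣ degeneratePointMass.eval X) (h0 : MvPolynomial.eval ![0, 2, 0] f = 0) :
    ¬ f ∣ remainingPointMass.eval X := by
  intro h
  have hS := squarefree_pointMass
  rw [PolyExpr.eval_mul] at hS
  have hu := (hS f (mul_dvd_mul hf h)).map (MvPolynomial.eval (![0, 2, 0] : Fin 3 → ℚ))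
  rw [h0] at hu
  exact not_isUnit_zero hu

/-- Substitution of the value of `χ` for point masses. -/
lemma remaining_eval_pointMass {K : Type*} [Field K] (q d s : K) (he : 2 + d * (s - 1) ≠ 0) :
    remaining.eval ![q, d, s, (d * (1 + s) - 2) / (2 + d * (s - 1))] =
      q ^ 2 * (d ^ 2 * s * (2 - s) - (2 - d) ^ 2) ^ 2 * remainingPointMass.eval ![q, d, s] /
        (2 + d * (s - 1)) ^ 10 := by
  set e := 2 + d * (s - 1) with hedef
  set χ := (d * (1 + s) - 2) / e with hχ
  have h₁ : e * (1 + χ) = 2 * (d * s) := by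
    rw [hχ]; field_simp; rw [hedef]; ring
  have h₂ : e * (1 - χ) = 2 * (2 - d) := by
    rw [hχ]; field_simp; rw [hedef]; ring
  have key : e ^ 12 * remaining.eval ![q, d, s, χ] =
      q ^ 2 * e ^ 2 * (d ^ 2 * s * (2 - s) - (2 - d) ^ 2) ^ 2 *
        remainingPointMass.eval ![q, d, s] := by
    have h₃ : remaining.eval ![q, d, s, χ] = bifurcationForm (d * s) (2 - d) (d * (2 - s))
        (4 * (1 + χ) ^ 2) (4 * (1 - χ) ^ 2) (q ^ 2) := by
      simp [remaining]
    have h₄ := bifurcationForm_smul_right (e ^ 2) (d * s) (2 - d) (d * (2 - s))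
      (4 * (1 + χ) ^ 2) (4 * (1 - χ) ^ 2) (q ^ 2)
    rw [show e ^ 2 * (4 * (1 + χ) ^ 2) = 16 * (d * s) ^ 2 by
        linear_combination 4 * (e * (1 + χ) + 2 * (d * s)) * h₁,
      show e ^ 2 * (4 * (1 - χ) ^ 2) = 16 * (2 - d) ^ 2 by
        linear_combination 4 * (e * (1 - χ) + 2 * (2 - d)) * h₂, bifurcationForm_pointMass] at h₄
    rw [h₃, remainingPointMass_eval]
    simp only [Matrix.cons_val_zero, Matrix.cons_val_one, Matrix.cons_val]
    rw [← hedef, show (q * e) ^ 2 = e ^ 2 * q ^ 2 by ring]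
    linear_combination -h₄
  rw [eq_div_iff (pow_ne_zero _ he)]
  refine mul_left_cancel₀ (pow_ne_zero 2 he) ?_
  linear_combination key

end PointMass

theorem mainTheorem2 :
    ∃ (R : MvPolynomial (Fin 4) ℚ) (N : MvPolynomial (Fin 3) ℚ),
      -- the polynomials attached to the four trivial equilibria and their product
      (let T : ℤ → ℤ → MvPolynomial (Fin 4) ℚ := trivialPoly (X 0) (X 1) (X 2) (X 3)
       let T₄ : MvPolynomial (Fin 4) ℚ := T 1 1 * T 1 (-1) * T (-1) 1 * T (-1) (-1)
       (∃ D, IsDixonResultant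
          (bifurcationSystem (X 0 : MvPolynomial (Fin 4) ℚ) (X 1) (X 2) (X 3)) D) ∧
       (∀ D, IsDixonResultant
          (bifurcationSystem (X 0 : MvPolynomial (Fin 4) ℚ) (X 1) (X 2) (X 3)) D →
            T₄ * R ∣ D) ∧
       (T₄ * R).support.card = 23288 ∧
       (∀ ε₁ ∈ ({1, -1} : Finset ℤ), ∀ ε₂ ∈ ({1, -1} : Finset ℤ),
          (T ε₁ ε₂).support.card = 10 ∧ ¬ T ε₁ ε₂ ∣ R) ∧
       T₄.support.card = 175 ∧
       R.support.card = 6744 ∧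
       R.vars = Finset.univ) ∧
      -- the special case of point masses on massless rods
      (let q : MvPolynomial (Fin 3) ℚ := X 0
       let d : MvPolynomial (Fin 3) ℚ := X 1
       let s : MvPolynomial (Fin 3) ℚ := X 2
       let num : MvPolynomial (Fin 3) ℚ := d * (1 + s) - 2
       let den : MvPolynomial (Fin 3) ℚ := 2 + d * (s - 1)
       let Δ : MvPolynomial (Fin 3) ℚ := d ^ 2 * s * (2 - s) - (2 - d) ^ 2
       let ι := algebraMap (MvPolynomial (Fin 3) ℚ) (FractionRing (MvPolynomial (Fin 3) ℚ))
       (∃ D, IsDixonResultant (pmmrSystem q d s) D) ∧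
       (∀ D, IsDixonResultant (pmmrSystem q d s) D → N ∣ D) ∧
       N.support.card = 1924 ∧
       aeval ![ι q, ι d, ι s, ι num / ι den] R = ι (q ^ 2 * Δ ^ 2 * N) / ι den ^ 10 ∧
       ¬ den ∣ N ∧ ¬ q ∣ N ∧ ¬ Δ ∣ N) := by
  refine ⟨PolyExpr.remaining.eval X, PolyExpr.remainingPointMass.eval X, ?_, ?_⟩
  · have hT : trivialPoly (X 0 : MvPolynomial (Fin 4) ℚ) (X 1) (X 2) (X 3) 1 1 *
        trivialPoly (X 0) (X 1) (X 2) (X 3) 1 (-1) * trivialPoly (X 0) (X 1) (X 2) (X 3) (-1) 1 *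
        trivialPoly (X 0) (X 1) (X 2) (X 3) (-1) (-1) = PolyExpr.trivials.eval X := by
      rw [trivialPoly_eq (by simp) (by simp), trivialPoly_eq (by simp) (by simp),
        trivialPoly_eq (by simp) (by simp), trivialPoly_eq (by simp) (by simp)]
      rfl
    intro T T₄
    have hT₄ : T₄ = PolyExpr.trivials.eval X := hT
    rw [hT₄, ← PolyExpr.eval_mul]
    refine ⟨exists_isDixonResultant _, fun D => trivials_mul_remaining_dvd,
      card_support_trivials_mul_remaining, fun ε₁ h₁ ε₂ h₂ => ?_, card_support_trivials,
      card_support_remaining, vars_remaining⟩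
    rw [show T ε₁ ε₂ = _ from trivialPoly_eq h₁ h₂]
    exact ⟨card_support_trivial h₁ h₂, not_trivial_dvd_remaining h₁ h₂⟩
  · intro q d s num den Δ ι
    refine ⟨exists_isDixonResultant _, fun D => remainingPointMass_dvd,
      card_support_remainingPointMass, ?_, ?_, ?_, ?_⟩
    · have hden : ι den ≠ 0 := by
        rw [Ne, map_eq_zero_iff ι (IsFractionRing.injective _ _)]
        intro h
        simpa [den, d, s] using congrArg (MvPolynomial.eval (![0, 0, 0] : Fin 3 → ℚ)) h
      have hι : ι 2 = 2 := map_ofNat (algebraMap _ _) 2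
      have hd : ι den = 2 + ι d * (ι s - 1) := by simp [den, hι]
      have hR : aeval ![ι q, ι d, ι s, ι num / ι den]
            (PolyExpr.remaining.eval (X : Fin 4 → MvPolynomial (Fin 4) ℚ)) =
          PolyExpr.remaining.eval ![ι q, ι d, ι s, ι num / ι den] := by
        have := PolyExpr.map_eval (ρ := (X : Fin 4 → MvPolynomial (Fin 4) ℚ))
          (aeval ![ι q, ι d, ι s, ι num / ι den]).toRingHom PolyExpr.remaining
        simpa using this
      have hN : ι (PolyExpr.remainingPointMass.eval X) =
          PolyExpr.remainingPointMass.eval ![ι q, ι d, ι s] := by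
        rw [PolyExpr.map_eval]
        congr 1
        funext i
        fin_cases i <;> rfl
      rw [hd] at hden
      rw [hR, map_mul, map_mul, hN, hd, show ι num = ι d * (1 + ι s) - 2 by simp [num, hι],
        remaining_eval_pointMass _ _ _ hden]
      simp [Δ, hι]
    · refine not_dvd_remainingPointMass ?_ (by simp [den, d, s])
      rw [degeneratePointMass_eval]
      exact ((Dvd.intro_left _ rfl).mul_right _).mul_right _
    · refine not_dvd_remainingPointMass ?_ (by simp [q])
      rw [degeneratePointMass_eval]
      simp only [mul_assoc]
      exact Dvd.intro _ rfl
    · refine not_dvd_remainingPointMass ?_ (by simp [Δ, d, s])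
      rw [degeneratePointMass_eval]
      exact (Dvd.intro_left _ rfl).mul_right _
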